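/- Let $K\subset\mathbb R$ be a real-quadratic number field with ring of integers $\mathcal O$ and non-trivial automorphism $x\mapsto x'$; write $a\gg0$ if $a>0$ and $a'>0$. Let $0\neq\mathcal I\subseteq\mathcal O$ be a primitive ideal (i.e. $\frac1n\mathcal I\subseteq\mathcal O$ with $n\in\mathbb N$ implies $n=1$) of reduced norm $N=[\mathcal O:\mathcal I]$. Put $$\Gamma_K(\mathcal I)=\Big\{\begin{pmatrix}\alpha&\beta\\ \gamma&\delta\end{pmatrix}\in SL_2(K):\ \alpha,\delta\in\mathcal O,\ \beta\in\mathcal I,\ \gamma\in\mathcal I^{-1}\Big\},$$ $$\Gamma_K^*(\mathcal I)=\Big\{\tfrac1{\sqrt{\det L}}L\in SL_2(\mathbb R):\ L\in\begin{pmatrix}\mathcal O&\mathcal I\\ \mathcal I^{-1}&\mathcal O\end{pmatrix},\ \det L\gg0,\ \mathcal I(L)^2=\mathcal O\det L\Big\},$$ where $\mathcal I(L)=\alpha\mathcal O+\beta\mathcal I^{-1}+\gamma\mathcal I+\delta\mathcal O$ for $L=\begin{pmatrix}\alpha&\beta\\ \gamma&\delta\end{pmatrix}$. For $M=\frac1{\sqrt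 d}L$ with $L\in K^{2\times2}$, $d\in K$, $d\gg0$, $\det L=d$, put $M'=\frac1{\sqrt{d'}}L'$ (this is determined by $M$ up to sign; for $M\in SL_2(K)$ choose $M'$ to be the entrywise conjugate of $M$). For a non-degenerate symmetric even integral matrix $T\in\mathbb Z^{n\times n}$ let $SO_0(T;\mathbb R)$ be the connected component of the identity in $SO(T;\mathbb R)=\{U\in SL_n(\mathbb R): U^{tr}TU=T\}$, let $SO_0(T;\mathbb Z)$ be its subgroup of integral matrices, and let $\mathcal D(T;\mathbb Z)=\{U\in SO_0(T;\mathbb Z): U\in I+\mathbb Z^{n\times n}T\}$. For $T\in\mathbb Z^{2\times 2}$ let $T_1=\begin{pmatrix}0&0&1\\0&T&0\\1&0&0\end{pmatrix}\in\mathbb Z^{4\times4}$. Let $B=(u,v)$ be a $\mathbb Z$-basis of $\mathcal I$, $G=\begin{pmatrix}u&v\\u'&v'\end{pmatrix}$, $\widehat G=\mathrm{diag}(1,G,1)$, $S=\begin{pmatrix}2uu'&uv'+u'v\\uv'+u'v&2vv'\end{pmatrix}$, $T=\frac1NS$, $H_N=\mathrm{diag}(N,1,1,1)$, and $$\widetilde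 M=\widehat G^{-1}\begin{pmatrix}\alpha\alpha'&-\alpha\beta'&-\alpha'\beta&-\beta\beta'\\-\alpha\gamma'&\alpha\delta'&\beta\gamma'&\beta\delta'\\-\alpha'\gamma&\beta'\gamma&\alpha'\delta&\beta'\delta\\-\gamma\gamma'&\gamma\delta'&\gamma'\delta&\delta\delta'\end{pmatrix}\widehat G,\qquad M=\begin{pmatrix}\alpha&\beta\\ \gamma&\delta\end{pmatrix},\quad M'=\begin{pmatrix}\alpha'&\beta'\\ \gamma'&\delta'\end{pmatrix}.$$ Then $T$ is an integral, even, symmetric, non-degenerate matrix, and the mappings $$\psi_B:\Gamma_K(\mathcal I)/\{\pm I\}\to\mathcal D(T_1;\mathbb Z),\quad \pm M\mapsto H_N^{-1}\widetilde MH_N,$$ $$\widetilde\psi_B:\Gamma^*_K(\mathcal I)/\{\pm I\}\to SO_0(T_1;\mathbb Z)/\{\pm I\},\quad \pm M\mapsto\pm H_N^{-1}\widetilde MH_N,$$ are (well defined and) isomorphisms of groups. -/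

import Mathlib

open scoped nonZeroDivisors

namespace HilbertModular

noncomputable section

/-! ### Orthogonal groups and discriminant kernels -/

/-- The subgroup `{±I}` of `SL_n(R)` (just `{I}` if `-I` has determinant different from `1`). -/
def pmI (n : Type*) [Fintype n] [DecidableEq n] (R : Type*) [CommRing R] :
    Subgroup (Matrix.SpecialLinearGroup n R) where
  carrier := {U | (U : Matrix n n R) = 1 ∨ (U : Matrix n n R) = -1}
  one_mem' := by simp
  mul_mem' := by
    rintro a b (ha | ha) (hb | hb) <;> simp [ha, hb]
  inv_mem' := by
    rintro a (ha | ha)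
    · left
      have : a = 1 := Subtype.ext ha
      simp [this]
    · right
      have h1 : ((a⁻¹ : Matrix.SpecialLinearGroup n R) : Matrix n n R) * (a : Matrix n n R) = 1 := by
        rw [← Matrix.SpecialLinearGroup.coe_mul]; simp
      rw [ha] at h1
      rw [mul_neg, mul_one] at h1
      rw [← h1, neg_neg]

instance pmI_normal (n : Type*) [Fintype n] [DecidableEq n] (R : Type*) [CommRing R] :
    (pmI n R).Normal where
  conj_mem := by
    rintro a (ha | ha) g
    · left
      have : a = 1 := Subtype.ext ha
      simp [this]
    · right
      have h1 : (g : Matrix n n R) * ((g⁻¹ : Matrix.SpecialLinearGroup n R) : Matrix n n R) = 1 := by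
        rw [← Matrix.SpecialLinearGroup.coe_mul]; simp
      rw [Matrix.SpecialLinearGroup.coe_mul, Matrix.SpecialLinearGroup.coe_mul, ha, mul_neg, mul_one,
        neg_mul, h1]

/-- For a subgroup `Γ` of `SL_n(R)`, the subgroup `{±I} ∩ Γ` of `Γ`. -/
abbrev pm {n : Type*} [Fintype n] [DecidableEq n] {R : Type*} [CommRing R]
    (Γ : Subgroup (Matrix.SpecialLinearGroup n R)) : Subgroup Γ :=
  (pmI n R).subgroupOf Γ

section Orthogonal

variable {n : Type*} [Fintype n] [DecidableEq n]

/-- `SO(T; ℝ) = {U ∈ SL_n(ℝ) ; Uᵗ T U = T}`. -/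
def SOReal (T : Matrix n n ℤ) : Subgroup (Matrix.SpecialLinearGroup n ℝ) where
  carrier := {U | (U : Matrix n n ℝ).transpose * T.map (Int.cast : ℤ → ℝ) * (U : Matrix n n ℝ)
    = T.map (Int.cast : ℤ → ℝ)}
  one_mem' := by simp
  mul_mem' := by
    intro a b ha hb
    simp only [Set.mem_ofPred_eq] at ha hb ⊢
    rw [Matrix.SpecialLinearGroup.coe_mul, Matrix.transpose_mul]
    calc _ = (b : Matrix n n ℝ).transpose * ((a : Matrix n n ℝ).transpose
          * T.map (Int.cast : ℤ → ℝ) * (a : Matrix n n ℝ)) * (b : Matrix n n ℝ) := by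
          simp only [Matrix.mul_assoc]
      _ = _ := by rw [ha, hb]
  inv_mem' := by
    intro a ha
    simp only [Set.mem_ofPred_eq] at ha ⊢
    have h1 : (a : Matrix n n ℝ) * ((a⁻¹ : Matrix.SpecialLinearGroup n ℝ) : Matrix n n ℝ) = 1 := by
      rw [← Matrix.SpecialLinearGroup.coe_mul]; simp
    have h2 : ((a⁻¹ : Matrix.SpecialLinearGroup n ℝ) : Matrix n n ℝ).transpose
        * (a : Matrix n n ℝ).transpose = 1 := by
      rw [← Matrix.transpose_mul, h1, Matrix.transpose_one]
    set c := ((a⁻¹ : Matrix.SpecialLinearGroup n ℝ) : Matrix n n ℝ)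
    calc c.transpose * T.map (Int.cast : ℤ → ℝ) * c
        = c.transpose * ((a : Matrix n n ℝ).transpose
          * T.map (Int.cast : ℤ → ℝ) * (a : Matrix n n ℝ)) * c := by rw [ha]
      _ = (c.transpose * (a : Matrix n n ℝ).transpose)
          * T.map (Int.cast : ℤ → ℝ) * ((a : Matrix n n ℝ) * c) := by
          simp only [Matrix.mul_assoc]
      _ = _ := by rw [h1, h2, Matrix.one_mul, Matrix.mul_one]

/-- `SO₀(T; ℝ)`, the connected component of the identity matrix in `SO(T; ℝ)`. -/
def SO0Real (T : Matrix n n ℤ) : Subgroup (Matrix.SpecialLinearGroup n ℝ) :=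
  (Subgroup.connectedComponentOfOne (SOReal T)).map (SOReal T).subtype

/-- `SO₀(T; ℤ)`, the group of integral matrices in `SO₀(T; ℝ)`. -/
def SO0Int (T : Matrix n n ℤ) : Subgroup (Matrix.SpecialLinearGroup n ℤ) :=
  (SO0Real T).comap (Matrix.SpecialLinearGroup.map (Int.castRingHom ℝ))

/-- The discriminant kernel `D(T; ℤ) = {U ∈ SO₀(T; ℤ) ; U ∈ I + ℤ^{n × n} T}`. -/
def discKernel (T : Matrix n n ℤ) : Subgroup (Matrix.SpecialLinearGroup n ℤ) where
  carrier := {U | U ∈ SO0Int T ∧ ∃ X : Matrix n n ℤ, (U : Matrix n n ℤ) = 1 + X * T}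
  one_mem' := ⟨one_mem _, 0, by simp⟩
  mul_mem' := by
    rintro a b ⟨ha, X, hX⟩ ⟨hb, Y, hY⟩
    refine ⟨mul_mem ha hb, X + Y + X * T * Y, ?_⟩
    rw [Matrix.SpecialLinearGroup.coe_mul, hX, hY]
    noncomm_ring
  inv_mem' := by
    rintro a ⟨ha, X, hX⟩
    refine ⟨inv_mem ha, -(((a⁻¹ : Matrix.SpecialLinearGroup n ℤ) : Matrix n n ℤ) * X), ?_⟩
    have h1 : ((a⁻¹ : Matrix.SpecialLinearGroup n ℤ) : Matrix n n ℤ) * (a : Matrix n n ℤ) = 1 := by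
      rw [← Matrix.SpecialLinearGroup.coe_mul]; simp
    rw [hX, mul_add, mul_one] at h1
    rw [neg_mul, Matrix.mul_assoc, ← h1]
    abel_nf

end Orthogonal

/-- `T_N`, the orthogonal sum of `T` and the hyperbolic plane rescaled by `N`. -/
def addHyperbolic (N : ℤ) (T : Matrix (Fin 2) (Fin 2) ℤ) : Matrix (Fin 4) (Fin 4) ℤ :=
  !![0, 0, 0, N;
     0, T 0 0, T 0 1, 0;
     0, T 1 0, T 1 1, 0;
     N, 0, 0, 0]

/-! ### Hilbert modular groups -/

section Groups

open NumberField FractionalIdeal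

variable {K : Type*} [Field K] [NumberField K]

/-- The matrices with diagonal entries in `𝓞 K`, upper right entry in `I` and
lower left entry in `I⁻¹`. -/
def InOrder (I : Ideal (𝓞 K)) (L : Matrix (Fin 2) (Fin 2) K) : Prop :=
  L 0 0 ∈ (1 : FractionalIdeal (𝓞 K)⁰ K) ∧ L 0 1 ∈ (I : FractionalIdeal (𝓞 K)⁰ K) ∧
  L 1 0 ∈ (I : FractionalIdeal (𝓞 K)⁰ K)⁻¹ ∧ L 1 1 ∈ (1 : FractionalIdeal (𝓞 K)⁰ K)

theorem InOrder.one (I : Ideal (𝓞 K)) : InOrder I (1 : Matrix (Fin 2) (Fin 2) K) := by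
  refine ⟨?_, ?_, ?_, ?_⟩ <;> simp [FractionalIdeal.zero_mem]

theorem coe_mul_inv_le (I : Ideal (𝓞 K)) :
    (I : FractionalIdeal (𝓞 K)⁰ K) * (I : FractionalIdeal (𝓞 K)⁰ K)⁻¹ ≤ 1 := by
  by_cases h : (I : FractionalIdeal (𝓞 K)⁰ K) = 0
  · rw [h, zero_mul]; exact FractionalIdeal.zero_le _
  · rw [mul_inv_cancel₀ h]

theorem InOrder.mul {I : Ideal (𝓞 K)} {L M : Matrix (Fin 2) (Fin 2) K}
    (hL : InOrder I L) (hM : InOrder I M) : InOrder I (L * M) := by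
  obtain ⟨a, b, c, d⟩ := hL
  obtain ⟨a', b', c', d'⟩ := hM
  simp only [InOrder, Matrix.mul_apply, Fin.sum_univ_two]
  refine ⟨?_, ?_, ?_, ?_⟩
  · refine Submodule.add_mem (1 : FractionalIdeal (𝓞 K)⁰ K).1 ?_ ?_
    · simpa using FractionalIdeal.mul_mem_mul a a'
    · exact coe_mul_inv_le I (FractionalIdeal.mul_mem_mul b c')
  · refine Submodule.add_mem (I : FractionalIdeal (𝓞 K)⁰ K).1 ?_ ?_
    · simpa using FractionalIdeal.mul_mem_mul a b'
    · simpa using FractionalIdeal.mul_mem_mul b d'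
  · refine Submodule.add_mem ((I : FractionalIdeal (𝓞 K)⁰ K)⁻¹).1 ?_ ?_
    · simpa using FractionalIdeal.mul_mem_mul c a'
    · simpa using FractionalIdeal.mul_mem_mul d c'
  · refine Submodule.add_mem (1 : FractionalIdeal (𝓞 K)⁰ K).1 ?_ ?_
    · exact coe_mul_inv_le I (mul_comm (M 0 1) (L 1 0) ▸ FractionalIdeal.mul_mem_mul b' c)
    · simpa using FractionalIdeal.mul_mem_mul d d'

theorem InOrder.adjugate {I : Ideal (𝓞 K)} {L : Matrix (Fin 2) (Fin 2) K}
    (hL : InOrder I L) : InOrder I L.adjugate := by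
  obtain ⟨a, b, c, d⟩ := hL
  simp only [InOrder, Matrix.adjugate_fin_two]
  exact ⟨d, Submodule.neg_mem (I : FractionalIdeal (𝓞 K)⁰ K).1 b,
    Submodule.neg_mem ((I : FractionalIdeal (𝓞 K)⁰ K)⁻¹).1 c, a⟩

/-- The (general) Hilbert modular group `Γ_K(I)` with respect to the ideal `I`. -/
def hilbertModularGroup (I : Ideal (𝓞 K)) : Subgroup (Matrix.SpecialLinearGroup (Fin 2) K) where
  carrier := {M | InOrder I (M : Matrix (Fin 2) (Fin 2) K)}
  one_mem' := by simpa using InOrder.one I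
  mul_mem' := by
    intro a b ha hb
    simpa using InOrder.mul ha hb
  inv_mem' := by
    intro a ha
    simpa [Matrix.SpecialLinearGroup.coe_inv] using InOrder.adjugate ha

/-- The ideal `I(L)` attached to `L = (α, β; γ, δ)` relative to `I`: the fractional ideal
`α 𝓞 + β I⁻¹ + γ I + δ 𝓞`. For `I = 𝓞 K` it is the ideal generated by the entries of `L`. -/
def contentIdeal (I : Ideal (𝓞 K)) (L : Matrix (Fin 2) (Fin 2) K) : FractionalIdeal (𝓞 K)⁰ K :=
  spanSingleton (𝓞 K)⁰ (L 0 0) + spanSingleton (𝓞 K)⁰ (L 0 1) * (I : FractionalIdeal (𝓞 K)⁰ K)⁻¹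
    + spanSingleton (𝓞 K)⁰ (L 1 0) * (I : FractionalIdeal (𝓞 K)⁰ K)
    + spanSingleton (𝓞 K)⁰ (L 1 1)

theorem contentIdeal_le_iff {I : Ideal (𝓞 K)} (hI : I ≠ ⊥) {L : Matrix (Fin 2) (Fin 2) K}
    {A : FractionalIdeal (𝓞 K)⁰ K} :
    contentIdeal I L ≤ A ↔ L 0 0 ∈ A ∧ L 0 1 ∈ A * (I : FractionalIdeal (𝓞 K)⁰ K) ∧
      L 1 0 ∈ A * (I : FractionalIdeal (𝓞 K)⁰ K)⁻¹ ∧ L 1 1 ∈ A := by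
  have h0 : (I : FractionalIdeal (𝓞 K)⁰ K) ≠ 0 := by simpa using hI
  have key : ∀ (J : FractionalIdeal (𝓞 K)⁰ K) (x : K), J ≠ 0 →
      (spanSingleton (𝓞 K)⁰ x * J ≤ A ↔ x ∈ A * J⁻¹) := by
    intro J x hJ
    rw [← spanSingleton_le_iff_mem]
    constructor
    · intro h
      calc _ = spanSingleton (𝓞 K)⁰ x * J * J⁻¹ := by rw [mul_assoc, mul_inv_cancel₀ hJ, mul_one]
        _ ≤ _ := by gcongr
    · intro h
      calc spanSingleton (𝓞 K)⁰ x * J ≤ A * J⁻¹ * J := by gcongr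
        _ = A := by rw [mul_assoc, inv_mul_cancel₀ hJ, mul_one]
  have k1 := key (I : FractionalIdeal (𝓞 K)⁰ K)⁻¹ (L 0 1) (inv_ne_zero h0)
  rw [inv_inv] at k1
  have k2 := key (I : FractionalIdeal (𝓞 K)⁰ K) (L 1 0) h0
  rw [contentIdeal, ← k1, ← k2, ← spanSingleton_le_iff_mem, ← spanSingleton_le_iff_mem]
  simp only [← FractionalIdeal.sup_eq_add, sup_le_iff, and_assoc]

theorem contentIdeal_mul_le {I : Ideal (𝓞 K)} (hI : I ≠ ⊥) (L M : Matrix (Fin 2) (Fin 2) K) :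
    contentIdeal I (L * M) ≤ contentIdeal I L * contentIdeal I M := by
  have h0 : (I : FractionalIdeal (𝓞 K)⁰ K) ≠ 0 := by simpa using hI
  obtain ⟨a, b, c, d⟩ := (contentIdeal_le_iff hI).1 (le_refl (contentIdeal I L))
  obtain ⟨a', b', c', d'⟩ := (contentIdeal_le_iff hI).1 (le_refl (contentIdeal I M))
  set A := contentIdeal I L
  set B := contentIdeal I M
  set J := (I : FractionalIdeal (𝓞 K)⁰ K)
  have hJ : J * J⁻¹ = 1 := mul_inv_cancel₀ h0
  rw [contentIdeal_le_iff hI]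
  simp only [Matrix.mul_apply, Fin.sum_univ_two]
  refine ⟨Submodule.add_mem (A * B).1 ?_ ?_, Submodule.add_mem (A * B * J).1 ?_ ?_,
    Submodule.add_mem (A * B * J⁻¹).1 ?_ ?_, Submodule.add_mem (A * B).1 ?_ ?_⟩
  · exact FractionalIdeal.mul_mem_mul a a'
  · have := FractionalIdeal.mul_mem_mul b c'
    rwa [show A * J * (B * J⁻¹) = A * B * (J * J⁻¹) by ring, hJ, mul_one] at this
  · have := FractionalIdeal.mul_mem_mul a b'
    rwa [← mul_assoc] at this
  · have := FractionalIdeal.mul_mem_mul b d'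
    rwa [show A * J * B = A * B * J by ring] at this
  · have := FractionalIdeal.mul_mem_mul c a'
    rwa [show A * J⁻¹ * B = A * B * J⁻¹ by ring] at this
  · have := FractionalIdeal.mul_mem_mul d c'
    rwa [← mul_assoc] at this
  · have := FractionalIdeal.mul_mem_mul c b'
    rwa [show A * J⁻¹ * (B * J) = A * B * (J * J⁻¹) by ring, hJ, mul_one] at this
  · exact FractionalIdeal.mul_mem_mul d d'

theorem spanSingleton_det_le {I : Ideal (𝓞 K)} (hI : I ≠ ⊥) (L : Matrix (Fin 2) (Fin 2) K) :
    spanSingleton (𝓞 K)⁰ L.det ≤ contentIdeal I L ^ 2 := by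
  have h0 : (I : FractionalIdeal (𝓞 K)⁰ K) ≠ 0 := by simpa using hI
  obtain ⟨a, b, c, d⟩ := (contentIdeal_le_iff hI).1 (le_refl (contentIdeal I L))
  set A := contentIdeal I L
  set J := (I : FractionalIdeal (𝓞 K)⁰ K)
  have hJ : J * J⁻¹ = 1 := mul_inv_cancel₀ h0
  rw [spanSingleton_le_iff_mem, Matrix.det_fin_two, sq]
  refine Submodule.sub_mem (A * A).1 (FractionalIdeal.mul_mem_mul a d) ?_
  have := FractionalIdeal.mul_mem_mul b c
  rwa [show A * J * (A * J⁻¹) = A * A * (J * J⁻¹) by ring, hJ, mul_one] at this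

theorem contentIdeal_adjugate (I : Ideal (𝓞 K)) (L : Matrix (Fin 2) (Fin 2) K) :
    contentIdeal I L.adjugate = contentIdeal I L := by
  have hneg : ∀ x : K, spanSingleton (𝓞 K)⁰ (-x) = spanSingleton (𝓞 K)⁰ x := by
    intro x
    apply le_antisymm <;> rw [spanSingleton_le_iff_mem]
    · exact Submodule.neg_mem (spanSingleton (𝓞 K)⁰ x).1 (mem_spanSingleton_self _ x)
    · have := Submodule.neg_mem (spanSingleton (𝓞 K)⁰ (-x)).1 (mem_spanSingleton_self _ (-x))
      rwa [neg_neg] at this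
  simp only [contentIdeal, Matrix.adjugate_fin_two, Matrix.of_apply, Matrix.cons_val', Matrix.cons_val_zero,
    Matrix.cons_val_one, Matrix.cons_val_fin_one, hneg]
  ring

/-- `a ≫ 0`, for the real embedding `ι` and the nontrivial automorphism `conj` of `K`. -/
def TotallyPositive (ι : K →+* ℝ) (conj : K ≃ₐ[ℚ] K) (a : K) : Prop :=
  0 < ι a ∧ 0 < ι (conj a)

/-- The extended group `Γ*_K(I)`, consisting of the matrices `(det L)^{-1/2} L` in `SL₂(ℝ)` with
`L ∈ (𝓞, I; I⁻¹, 𝓞)`, `det L ≫ 0` and `I(L)² = 𝓞 det L`. -/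
def hurwitzMaassGroup (ι : K →+* ℝ) (conj : K ≃ₐ[ℚ] K) (I : Ideal (𝓞 K)) (hI : I ≠ ⊥) :
    Subgroup (Matrix.SpecialLinearGroup (Fin 2) ℝ) where
  carrier := {M | ∃ L : Matrix (Fin 2) (Fin 2) K, InOrder I L ∧ TotallyPositive ι conj L.det ∧
    contentIdeal I L ^ 2 = spanSingleton (𝓞 K)⁰ L.det ∧
    (M : Matrix (Fin 2) (Fin 2) ℝ) = (Real.sqrt (ι L.det))⁻¹ • L.map ι}
  one_mem' := by
    refine ⟨1, InOrder.one I, ?_, ?_, ?_⟩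
    · simp [TotallyPositive]
    · have h1 : contentIdeal I (1 : Matrix (Fin 2) (Fin 2) K) = 1 := by
        simp [contentIdeal, ← FractionalIdeal.sup_eq_add]
      simp [h1]
    · simp
  mul_mem' := by
    rintro M M' ⟨L, h1, h2, h3, h4⟩ ⟨L', h1', h2', h3', h4'⟩
    refine ⟨L * L', h1.mul h1', ?_, ?_, ?_⟩
    · rw [Matrix.det_mul]
      simp only [TotallyPositive, map_mul]
      exact ⟨mul_pos h2.1 h2'.1, mul_pos h2.2 h2'.2⟩
    · refine le_antisymm ?_ (spanSingleton_det_le hI _)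
      have hh := contentIdeal_mul_le hI L L'
      calc contentIdeal I (L * L') ^ 2 ≤ (contentIdeal I L * contentIdeal I L') ^ 2 := by
            rw [sq, sq]; exact mul_le_mul' hh hh
        _ = _ := by rw [mul_pow, h3, h3', spanSingleton_mul_spanSingleton, Matrix.det_mul]
    · rw [Matrix.SpecialLinearGroup.coe_mul, h4, h4', Matrix.det_mul, map_mul,
        Real.sqrt_mul h2.1.le, Matrix.map_mul, Matrix.smul_mul, Matrix.mul_smul, smul_smul, mul_inv]
  inv_mem' := by
    rintro M ⟨L, h1, h2, h3, h4⟩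
    have hd : L.adjugate.det = L.det := by simp [Matrix.det_adjugate]
    refine ⟨L.adjugate, h1.adjugate, by rwa [hd], by rwa [hd, contentIdeal_adjugate], ?_⟩
    rw [hd, Matrix.SpecialLinearGroup.coe_inv, h4, Matrix.adjugate_smul]
    simp only [Fintype.card_fin, Nat.add_one_sub_one, pow_one]
    congr 1
    ext i j
    fin_cases i <;> fin_cases j <;> simp [Matrix.adjugate_fin_two]

/-- `I` is primitive: `(1/n) I ⊆ 𝓞 K` with a natural number `n ≥ 1` forces `n = 1`. -/
def IsPrimitiveIdeal (I : Ideal (𝓞 K)) : Prop :=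
  ∀ n : ℕ, 0 < n → (∀ x ∈ I, ∃ y : 𝓞 K, (n : K)⁻¹ * (x : K) = (y : K)) → n = 1

/-- `M'` is a conjugate of `M ∈ SL₂(ℝ)`: one has `M = d^{-1/2} L` and `M' = d'^{-1/2} L'` with
a matrix `L` over `K` and a totally positive `d ∈ K` (for example a natural number `d = ℓ`, where
`d' = ℓ`). The conjugate of `M` is unique up to sign. -/
def IsConjugate (ι : K →+* ℝ) (conj : K ≃ₐ[ℚ] K)
    (M M' : Matrix.SpecialLinearGroup (Fin 2) ℝ) : Prop :=
  ∃ (d : K) (L : Matrix (Fin 2) (Fin 2) K), TotallyPositive ι conj d ∧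
    (M : Matrix (Fin 2) (Fin 2) ℝ) = (Real.sqrt (ι d))⁻¹ • L.map ι ∧
    (M' : Matrix (Fin 2) (Fin 2) ℝ) = (Real.sqrt (ι (conj d)))⁻¹ • L.map (fun x => ι (conj x))

/-- The matrix `G = (u, v; u', v')` of a pair `(u, v)` of elements of `K`. -/
def baseChange (ι : K →+* ℝ) (conj : K ≃ₐ[ℚ] K) (u v : K) : Matrix (Fin 2) (Fin 2) ℝ :=
  !![ι u, ι v; ι (conj u), ι (conj v)]

/-- The Gram matrix `S = Gᵗ P G = (2uu', uv' + u'v; uv' + u'v, 2vv')`, where `P = (0, 1; 1, 0)`. -/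
def gramMatrix (ι : K →+* ℝ) (conj : K ≃ₐ[ℚ] K) (u v : K) : Matrix (Fin 2) (Fin 2) ℝ :=
  (baseChange ι conj u v).transpose * !![0, 1; 1, 0] * baseChange ι conj u v

end Groups

/-! ### The map to the orthogonal group -/

/-- `Ω(M, M')` for `M = (α, β; γ, δ)` and `M' = (α', β'; γ', δ')`. -/
def Omega (M M' : Matrix (Fin 2) (Fin 2) ℝ) : Matrix (Fin 4) (Fin 4) ℝ :=
  !![M 0 0 * M' 0 0, -(M 0 0 * M' 0 1), -(M' 0 0 * M 0 1), -(M 0 1 * M' 0 1);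
     -(M 0 0 * M' 1 0), M 0 0 * M' 1 1, M 0 1 * M' 1 0, M 0 1 * M' 1 1;
     -(M' 0 0 * M 1 0), M' 0 1 * M 1 0, M' 0 0 * M 1 1, M' 0 1 * M 1 1;
     -(M 1 0 * M' 1 0), M 1 0 * M' 1 1, M' 1 0 * M 1 1, M 1 1 * M' 1 1]

/-- `Ĝ = diag(1, G, 1)`. -/
def hat (G : Matrix (Fin 2) (Fin 2) ℝ) : Matrix (Fin 4) (Fin 4) ℝ :=
  !![1, 0, 0, 0;
     0, G 0 0, G 0 1, 0;
     0, G 1 0, G 1 1, 0;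
     0, 0, 0, 1]

/-- `M̃ = Ĝ⁻¹ Ω(M, M') Ĝ`. -/
def tilde (G M M' : Matrix (Fin 2) (Fin 2) ℝ) : Matrix (Fin 4) (Fin 4) ℝ :=
  (hat G)⁻¹ * Omega M M' * hat G

/-- `H_N = diag(N, 1, 1, 1)`. -/
def HMat (N : ℕ) : Matrix (Fin 4) (Fin 4) ℝ :=
  Matrix.diagonal ![(N : ℝ), 1, 1, 1]

end

end HilbertModular

open scoped nonZeroDivisors

namespace HilbertModular

open NumberField FractionalIdeal

/-! ### Quadratic fields: conjugation, integrality, and I · I' = (N). -/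

section Quadratic
variable {K : Type*} [Field K] [NumberField K]

/-! Up to the sign change diag(1, -1, -1, -1), Ω(A, B) is the Kronecker product of A and B, that is,
the action X ↦ A X Bᵗ on 2 × 2 matrices, which preserves the determinant form when det A = det B =
1. The columns of Ĝ H_N form a basis of the lattice of vectors (N a, x, x', b) with a, b ∈ ℤ and x ∈
I, on which this form has Gram matrix N · T₁. So H_N⁻¹ M̃ H_N is the matrix of Ω(M, M') on that
lattice.

Real points: the image of SL₂(ℝ) × SL₂(ℝ) is connected and contains a neighbourhood of the identity
(a Gauss decomposition), so it is exactly SO₀(T₁; ℝ) (`mem_SO0Real_iff`).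

Descent to K: if Ω(A, B) is integral on the lattice, all products A_pq B_kl lie in K, and
conjugation exchanges the roles of A and B. Fixing k, l with B_kl ≠ 0 gives L = B_kl A over K, with
conjugate L' = A_kl B and rational r = A_kl B_kl (`exists_matrix_of_intertwine`).

Integrality: Ω(L, L')/r preserves the lattice iff L_ij L'_kl ∈ (r) w_ij w'_kl for the weights w =
(1, I; I⁻¹, 1), that is, iff the content satisfies I(L) I(L)' ⊆ (r)
(`PairwiseIntegral.isLatticeVector`, `pairwiseIntegral_of_isLatticeVector`,
`PairwiseIntegral.content_le`). Together with det L · det L' = r² this forces I(L)² = (det L)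
(`PairwiseIntegral.content_sq`); the converse is `exists_content_mul_conj_le`. This identifies the
extended group with SO₀(T₁; ℤ) modulo signs.

Discriminant kernel: it consists of the U acting trivially on the dual lattice modulo the lattice.
For such U and e = det L / r, the semilinear involution t ↦ e t' of the content A satisfies t - e t'
∈ (w - w') A, where w - w' generates the group of all s - s' with s integral. Hence A = k𝓞 for a
generator k of the fixed points (`PairwiseIntegral.exists_content_eq`). Then r/(k k') is a rational
unit, positive because det L is, so it equals 1 and k⁻¹ L lies in Γ_K(I). Conversely, elements of
Γ_K(I) have content 𝓞, and `PairwiseIntegral.dual_congr` shows that they act trivially. -/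

theorem aut_eq_one_or_eq (hK : Module.finrank ℚ K = 2) {σ : K ≃ₐ[ℚ] K}
    (hσ : σ ≠ AlgEquiv.refl) (τ : K ≃ₐ[ℚ] K) : τ = 1 ∨ τ = σ := by
  classical
  have : Algebra.IsQuadraticExtension ℚ K := { finrank_eq_two' := hK }
  have hc : Nat.card (K ≃ₐ[ℚ] K) = 2 := by rw [IsGalois.card_aut_eq_finrank, hK]
  rw [Nat.card_eq_fintype_card] at hc
  by_contra! h
  have : ({1, σ, τ} : Finset (K ≃ₐ[ℚ] K)).card = 3 := by
    rw [Finset.card_eq_three]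
    exact ⟨1, σ, τ, fun h => hσ h.symm, fun h' => h.1 h'.symm, fun h' => h.2 h'.symm, rfl⟩
  have := Finset.card_le_univ ({1, σ, τ} : Finset (K ≃ₐ[ℚ] K))
  omega

theorem conj_conj (hK : Module.finrank ℚ K = 2) {σ : K ≃ₐ[ℚ] K}
    (hσ : σ ≠ AlgEquiv.refl) (x : K) : σ (σ x) = x := by
  rcases aut_eq_one_or_eq hK hσ (σ * σ) with h | h
  · exact DFunLike.congr_fun h x
  · exact absurd (mul_eq_left.1 h) hσ

theorem exists_rat_of_conj_eq (hK : Module.finrank ℚ K = 2) {σ : K ≃ₐ[ℚ] K}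
    (hσ : σ ≠ AlgEquiv.refl) {x : K} (hx : σ x = x) : ∃ q : ℚ, (q : K) = x := by
  have : Algebra.IsQuadraticExtension ℚ K := { finrank_eq_two' := hK }
  have := (IsGalois.mem_bot_iff_fixed (F := ℚ) (E := K) x).2 fun τ => by
    rcases aut_eq_one_or_eq hK hσ τ with h | h
    · rw [h]; rfl
    · rw [h, hx]
  obtain ⟨q, hq⟩ := IntermediateField.mem_bot.1 this
  exact ⟨q, by simpa using hq⟩

theorem norm_eq_mul_conj (hK : Module.finrank ℚ K = 2) {σ : K ≃ₐ[ℚ] K}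
    (hσ : σ ≠ AlgEquiv.refl) (x : K) : ((Algebra.norm ℚ x : ℚ) : K) = x * σ x := by
  classical
  have : Algebra.IsQuadraticExtension ℚ K := { finrank_eq_two' := hK }
  have h := Algebra.norm_eq_prod_automorphisms ℚ x
  have hu : (Finset.univ : Finset (Gal(K/ℚ))) = {1, σ} := by
    ext τ
    simpa using aut_eq_one_or_eq hK hσ τ
  rw [hu] at h
  rw [Finset.prod_pair (fun h : 1 = σ => hσ h.symm)] at h
  simpa using h

theorem exists_integral_ne_conj {σ : K ≃ₐ[ℚ] K}
    (hσ : σ ≠ AlgEquiv.refl) : ∃ x : K, x ∈ (1 : FractionalIdeal (𝓞 K)⁰ K) ∧ x ≠ σ x := by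
  by_contra! h
  apply hσ
  ext x
  obtain ⟨a, b, -, rfl⟩ := IsFractionRing.div_surjective (A := 𝓞 K) x
  rw [map_div₀, ← h _ ((mem_one_iff _).2 ⟨a, rfl⟩), ← h _ ((mem_one_iff _).2 ⟨b, rfl⟩)]
  rfl

theorem mem_one_iff_isIntegral {x : K} : x ∈ (1 : FractionalIdeal (𝓞 K)⁰ K) ↔ IsIntegral ℤ x := by
  rw [mem_one_iff]
  constructor
  · rintro ⟨y, rfl⟩
    exact y.isIntegral_coe
  · intro h
    exact ⟨⟨x, h⟩, rfl⟩

theorem exists_int_of_mem_one (hK : Module.finrank ℚ K = 2) {σ : K ≃ₐ[ℚ] K}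
    (hσ : σ ≠ AlgEquiv.refl) {x : K} (hx : σ x = x) (h1 : x ∈ (1 : FractionalIdeal (𝓞 K)⁰ K)) :
    ∃ n : ℤ, (n : K) = x := by
  obtain ⟨q, rfl⟩ := exists_rat_of_conj_eq hK hσ hx
  rw [mem_one_iff_isIntegral] at h1
  have : IsIntegral ℤ q := (isIntegral_algHom_iff ((algebraMap ℚ K).toIntAlgHom) (algebraMap ℚ K).injective).1 (by simpa using h1)
  obtain ⟨n, hn⟩ := IsIntegrallyClosed.isIntegral_iff.1 this
  exact ⟨n, by rw [← hn]; simp⟩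

theorem intCast_mem_one (n : ℤ) : (n : K) ∈ (1 : FractionalIdeal (𝓞 K)⁰ K) :=
  mem_one_iff_isIntegral.2 (by simpa using isIntegral_algebraMap (R := ℤ) (A := K) (x := n))

/-- An element `x` lies in `A` if `x + y ∈ A` and `x y ∈ A²`. -/
theorem mem_of_add_mem_of_mul_mem {A : FractionalIdeal (𝓞 K)⁰ K} {x y : K}
    (hs : x + y ∈ A) (hp : x * y ∈ A * A) : x ∈ A := by
  by_cases hA : A = 0
  · subst hA
    simp only [mul_zero, mem_zero_iff, mul_eq_zero] at hs hp ⊢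
    rcases hp with h | h
    · exact h
    · simpa [h] using hs
  have hA' : A⁻¹ ≠ 0 := inv_ne_zero hA
  -- For t ∈ A⁻¹ the sum and the product of x t and y t are integral, so x t is a root of a monic
  -- integral quadratic.
  have h : x ∈ A⁻¹⁻¹ := by
    rw [mem_inv_iff hA']
    intro t ht
    obtain ⟨a, ha⟩ := (mem_one_iff _).1 (by
      rw [← mul_inv_cancel₀ hA]; exact mul_mem_mul hs ht : (x + y) * t ∈ (1 : FractionalIdeal (𝓞 K)⁰ K))
    obtain ⟨b, hb⟩ := (mem_one_iff _).1 (by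
      have := mul_mem_mul hp (mul_mem_mul ht ht)
      rwa [show A * A * (A⁻¹ * A⁻¹) = (A * A⁻¹) * (A * A⁻¹) by ring, mul_inv_cancel₀ hA, one_mul] at this :
      (x * y) * (t * t) ∈ (1 : FractionalIdeal (𝓞 K)⁰ K))
    have : IsIntegral (𝓞 K) (x * t) := by
      refine ⟨Polynomial.X ^ 2 - Polynomial.C a * Polynomial.X + Polynomial.C b, by monicity!, ?_⟩
      simp [ha, hb]
      ring
    obtain ⟨c, hc⟩ := IsIntegrallyClosed.isIntegral_iff.1 this
    exact (mem_one_iff _).2 ⟨c, hc⟩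
  rwa [inv_inv] at h

/-- The conjugate of a fractional ideal. -/
noncomputable def conjIdeal (σ : K ≃ₐ[ℚ] K) :
    FractionalIdeal (𝓞 K)⁰ K ≃+* FractionalIdeal (𝓞 K)⁰ K :=
  ringEquivOfRingEquiv K K (RingOfIntegers.mapRingEquiv (σ : K ≃+* K))

theorem fieldEquivOfRingEquiv_mapRingEquiv (σ : K ≃ₐ[ℚ] K) (x : K) :
    IsFractionRing.ringEquivOfRingEquiv (K := K) (L := K)
      (RingOfIntegers.mapRingEquiv (σ : K ≃+* K)) x = σ x := by
  obtain ⟨a, b, -, rfl⟩ := IsFractionRing.div_surjective (A := 𝓞 K) x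
  rw [map_div₀, IsFractionRing.ringEquivOfRingEquiv_algebraMap,
    IsFractionRing.ringEquivOfRingEquiv_algebraMap, map_div₀]
  rfl

theorem conj_mem_conjIdeal {σ : K ≃ₐ[ℚ] K} {A : FractionalIdeal (𝓞 K)⁰ K} {x : K} (hx : x ∈ A) :
    σ x ∈ conjIdeal σ A :=
  ⟨x, hx, fieldEquivOfRingEquiv_mapRingEquiv σ x⟩

theorem exists_of_mem_conjIdeal {σ : K ≃ₐ[ℚ] K} {A : FractionalIdeal (𝓞 K)⁰ K} {x : K}
    (hx : x ∈ conjIdeal σ A) : ∃ y ∈ A, σ y = x := by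
  obtain ⟨y, hy, h⟩ := hx
  exact ⟨y, hy, (fieldEquivOfRingEquiv_mapRingEquiv σ y).symm.trans h⟩

theorem mem_conjIdeal (hK : Module.finrank ℚ K = 2) {σ : K ≃ₐ[ℚ] K} (hσ : σ ≠ AlgEquiv.refl)
    {A : FractionalIdeal (𝓞 K)⁰ K} {x : K} : x ∈ conjIdeal σ A ↔ σ x ∈ A := by
  constructor
  · intro h
    obtain ⟨y, hy, rfl⟩ := exists_of_mem_conjIdeal h
    rwa [conj_conj hK hσ]
  · intro h
    rw [← conj_conj hK hσ x]
    exact conj_mem_conjIdeal h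

theorem conjIdeal_conjIdeal (hK : Module.finrank ℚ K = 2) {σ : K ≃ₐ[ℚ] K} (hσ : σ ≠ AlgEquiv.refl)
    (A : FractionalIdeal (𝓞 K)⁰ K) : conjIdeal σ (conjIdeal σ A) = A := by
  ext x
  rw [mem_conjIdeal hK hσ, mem_conjIdeal hK hσ, conj_conj hK hσ]

theorem conjIdeal_mono {σ : K ≃ₐ[ℚ] K} {A B : FractionalIdeal (𝓞 K)⁰ K} (h : A ≤ B) :
    conjIdeal σ A ≤ conjIdeal σ B := by
  intro x hx
  obtain ⟨y, hy, rfl⟩ := exists_of_mem_conjIdeal hx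
  exact conj_mem_conjIdeal (h hy)

theorem conjIdeal_spanSingleton (hK : Module.finrank ℚ K = 2) {σ : K ≃ₐ[ℚ] K}
    (hσ : σ ≠ AlgEquiv.refl) (x : K) :
    conjIdeal σ (spanSingleton (𝓞 K)⁰ x) = spanSingleton (𝓞 K)⁰ (σ x) := by
  have key : ∀ y : K, spanSingleton (𝓞 K)⁰ (σ y) ≤ conjIdeal σ (spanSingleton (𝓞 K)⁰ y) :=
    fun y => spanSingleton_le_iff_mem.2 (conj_mem_conjIdeal (mem_spanSingleton_self _ y))
  refine le_antisymm ?_ (key x)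
  have := conjIdeal_mono (σ := σ) (key (σ x))
  rwa [conj_conj hK hσ, conjIdeal_conjIdeal hK hσ] at this

theorem conj_mem_one {σ : K ≃ₐ[ℚ] K} {x : K} (hx : x ∈ (1 : FractionalIdeal (𝓞 K)⁰ K)) :
    σ x ∈ (1 : FractionalIdeal (𝓞 K)⁰ K) := by
  have := conj_mem_conjIdeal (σ := σ) hx
  rwa [map_one] at this

theorem mem_spanSingleton_iff_div {x r : K} (hr : r ≠ 0) :
    x ∈ spanSingleton (𝓞 K)⁰ r ↔ x / r ∈ (1 : FractionalIdeal (𝓞 K)⁰ K) := by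
  rw [mem_spanSingleton, mem_one_iff]
  refine exists_congr fun z => ?_
  rw [Algebra.smul_def, eq_div_iff hr]

theorem absNorm_map_ringEquiv (e : 𝓞 K ≃+* 𝓞 K) (I : Ideal (𝓞 K)) :
    Ideal.absNorm (I.map (e : 𝓞 K →+* 𝓞 K)) = Ideal.absNorm I := by
  rw [Ideal.absNorm_apply, Ideal.absNorm_apply, Submodule.cardQuot_apply, Submodule.cardQuot_apply]
  exact (Nat.card_congr (Ideal.quotientEquiv I _ e rfl).toEquiv).symm

theorem conjIdeal_coeIdeal (σ : K ≃ₐ[ℚ] K) (I : Ideal (𝓞 K)) :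
    conjIdeal σ (I : FractionalIdeal (𝓞 K)⁰ K) =
      ((I.map (RingOfIntegers.mapRingEquiv (σ : K ≃+* K) : 𝓞 K →+* 𝓞 K) : Ideal (𝓞 K)) :
        FractionalIdeal (𝓞 K)⁰ K) := by
  ext x
  constructor
  · intro h
    obtain ⟨y, hy, rfl⟩ := exists_of_mem_conjIdeal h
    obtain ⟨z, hz, rfl⟩ := (mem_coeIdeal _).1 hy
    exact (mem_coeIdeal _).2 ⟨_, Ideal.mem_map_of_mem _ hz, rfl⟩
  · intro h
    obtain ⟨z, hz, rfl⟩ := (mem_coeIdeal _).1 h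
    obtain ⟨w, hw, rfl⟩ := (Ideal.mem_map_iff_of_surjective _ (RingEquiv.surjective _)).1 hz
    exact conj_mem_conjIdeal (mem_coeIdeal_of_mem _ hw)

theorem absNorm_conjIdeal_coeIdeal (σ : K ≃ₐ[ℚ] K) (I : Ideal (𝓞 K)) :
    absNorm (conjIdeal σ (I : FractionalIdeal (𝓞 K)⁰ K)) = (Ideal.absNorm I : ℚ) := by
  rw [conjIdeal_coeIdeal, coeIdeal_absNorm, absNorm_map_ringEquiv]

theorem eq_one_of_le_one_of_absNorm_eq_one {A : FractionalIdeal (𝓞 K)⁰ K} (h : A ≤ 1)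
    (hA : absNorm A = 1) : A = 1 := by
  obtain ⟨I, rfl⟩ := le_one_iff_exists_coeIdeal.1 h
  rw [coeIdeal_absNorm, Nat.cast_eq_one, Ideal.absNorm_eq_one_iff] at hA
  rw [hA, coeIdeal_top]

/-- An ideal times its conjugate is generated by the absolute norm. -/
theorem coeIdeal_mul_conjIdeal (hK : Module.finrank ℚ K = 2) {σ : K ≃ₐ[ℚ] K}
    (hσ : σ ≠ AlgEquiv.refl) {I : Ideal (𝓞 K)} (hI : I ≠ ⊥) :
    (I : FractionalIdeal (𝓞 K)⁰ K) * conjIdeal σ I =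
      spanSingleton (𝓞 K)⁰ ((Ideal.absNorm I : ℕ) : K) := by
  have hN : ((Ideal.absNorm I : ℕ) : K) ≠ 0 := by
    simpa [Ideal.absNorm_eq_zero_iff] using hI
  set N := Ideal.absNorm I
  have hnorm : ∀ x ∈ (I : FractionalIdeal (𝓞 K)⁰ K),
      x * σ x ∈ spanSingleton (𝓞 K)⁰ (N : K) := by
    intro x hx
    obtain ⟨y, hy, rfl⟩ := (mem_coeIdeal _).1 hx
    obtain ⟨k, hk⟩ := Ideal.absNorm_dvd_norm_of_mem hy
    rw [mem_spanSingleton_iff_div hN, ← norm_eq_mul_conj hK hσ]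
    have h2 : Algebra.norm ℚ (algebraMap (𝓞 K) K y) = ((Algebra.norm ℤ y : ℤ) : ℚ) :=
      (Algebra.coe_norm_int y).symm
    rw [h2, hk]
    have : (((N * k : ℤ) : ℚ) : K) / (N : K) = (k : K) := by
      push_cast; field_simp
    rw [this]
    exact intCast_mem_one k
  -- Polarising the norm puts x y' + x' y in (N), and the product of the two summands is the product
  -- of the norms of x and y, hence in (N)². The sum-and-product criterion then separates them.
  have hle : (I : FractionalIdeal (𝓞 K)⁰ K) * conjIdeal σ I ≤ spanSingleton (𝓞 K)⁰ (N : K) := by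
    rw [FractionalIdeal.mul_le]
    intro x hx z hz
    obtain ⟨y, hy, rfl⟩ := exists_of_mem_conjIdeal hz
    refine mem_of_add_mem_of_mul_mem (y := y * σ x) ?_ ?_
    · have h := Submodule.sub_mem (spanSingleton (𝓞 K)⁰ (N : K)).1
        (Submodule.sub_mem (spanSingleton (𝓞 K)⁰ (N : K)).1
          (hnorm (x + y) (Submodule.add_mem (I : FractionalIdeal (𝓞 K)⁰ K).1 hx hy)) (hnorm x hx))
        (hnorm y hy)
      rwa [show (x + y) * σ (x + y) - x * σ x - y * σ y = x * σ y + y * σ x by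
        rw [map_add]; ring] at h
    · rw [show x * σ y * (y * σ x) = (x * σ x) * (y * σ y) by ring]
      exact mul_mem_mul (hnorm x hx) (hnorm y hy)
  have hN2 : absNorm (spanSingleton (𝓞 K)⁰ (N : K)) = (N : ℚ) ^ 2 := by
    rw [absNorm_span_singleton]
    have h2 : Algebra.norm ℚ ((N : K)) = (N : ℚ) ^ 2 := by
      have := Algebra.norm_algebraMap (S := K) (N : ℚ)
      rwa [hK, map_natCast] at this
    rw [h2, abs_of_nonneg (by positivity)]
  have hS : spanSingleton (𝓞 K)⁰ (N : K) ≠ 0 := spanSingleton_ne_zero_iff.2 hN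
  have hNQ : (N : ℚ) ≠ 0 := by exact_mod_cast hN
  -- Both sides of the inclusion have absolute norm N², so the quotient is an integral ideal of norm
  -- 1.
  have h1 : (I : FractionalIdeal (𝓞 K)⁰ K) * conjIdeal σ I * (spanSingleton (𝓞 K)⁰ (N : K))⁻¹ = 1 := by
    apply eq_one_of_le_one_of_absNorm_eq_one
    · rw [← mul_inv_cancel₀ hS]
      gcongr
    · rw [map_mul, map_mul, map_inv₀, hN2, absNorm_conjIdeal_coeIdeal, coeIdeal_absNorm]
      field_simp
      rfl
  rw [← mul_one ((I : FractionalIdeal (𝓞 K)⁰ K) * conjIdeal σ I), ← inv_mul_cancel₀ hS, ← mul_assoc,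
    h1, one_mul]

end Quadratic

/-! ### The tensor product action Ω on the determinant form. -/

section OmegaMatrix
variable {R : Type*} [CommRing R]

/-- `Ω(M, M')` over an arbitrary commutative ring. -/
def omegaMatrix (M M' : Matrix (Fin 2) (Fin 2) R) : Matrix (Fin 4) (Fin 4) R :=
  !![M 0 0 * M' 0 0, -(M 0 0 * M' 0 1), -(M' 0 0 * M 0 1), -(M 0 1 * M' 0 1);
     -(M 0 0 * M' 1 0), M 0 0 * M' 1 1, M 0 1 * M' 1 0, M 0 1 * M' 1 1;
     -(M' 0 0 * M 1 0), M' 0 1 * M 1 0, M' 0 0 * M 1 1, M' 0 1 * M 1 1;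
     -(M 1 0 * M' 1 0), M 1 0 * M' 1 1, M' 1 0 * M 1 1, M 1 1 * M' 1 1]

theorem Omega_eq (M M' : Matrix (Fin 2) (Fin 2) ℝ) : Omega M M' = omegaMatrix M M' := rfl

/-- The Gram matrix of the bilinear form attached to the determinant on `2 × 2` matrices. -/
def antidiag (R : Type*) [CommRing R] : Matrix (Fin 4) (Fin 4) R :=
  !![0, 0, 0, 1; 0, 0, 1, 0; 0, 1, 0, 0; 1, 0, 0, 0]

/-- Ω is the Kronecker product conjugated by diag(1, -1, -1, -1), hence multiplicative in the pair.
-/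
theorem omegaMatrix_mul (A B A' B' : Matrix (Fin 2) (Fin 2) R) :
    omegaMatrix (A * B) (A' * B') = omegaMatrix A A' * omegaMatrix B B' := by
  ext i j
  fin_cases i <;> fin_cases j <;>
    simp [omegaMatrix, Matrix.mul_apply, Fin.sum_univ_succ] <;> ring

theorem omegaMatrix_one : omegaMatrix (1 : Matrix (Fin 2) (Fin 2) R) 1 = 1 := by
  ext i j
  fin_cases i <;> fin_cases j <;> simp [omegaMatrix]

theorem omegaMatrix_smul (a b : R) (A B : Matrix (Fin 2) (Fin 2) R) :
    omegaMatrix (a • A) (b • B) = (a * b) • omegaMatrix A B := by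
  ext i j
  fin_cases i <;> fin_cases j <;> simp [omegaMatrix] <;> ring

theorem omegaMatrix_map {S : Type*} [CommRing S] (f : R →+* S) (A B : Matrix (Fin 2) (Fin 2) R) :
    (omegaMatrix A B).map f = omegaMatrix (A.map f) (B.map f) := by
  ext i j
  fin_cases i <;> fin_cases j <;> simp [omegaMatrix]

theorem det_omegaMatrix_one_right (A : Matrix (Fin 2) (Fin 2) R) :
    (omegaMatrix A 1).det = A.det ^ 2 := by
  rw [Matrix.det_fin_two]
  simp [omegaMatrix, Matrix.det_succ_row_zero, Fin.sum_univ_succ, Fin.succAbove, Matrix.submatrix]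
  ring

theorem det_omegaMatrix_one_left (A : Matrix (Fin 2) (Fin 2) R) :
    (omegaMatrix 1 A).det = A.det ^ 2 := by
  rw [Matrix.det_fin_two]
  simp [omegaMatrix, Matrix.det_succ_row_zero, Fin.sum_univ_succ, Fin.succAbove, Matrix.submatrix]
  ring

theorem det_omegaMatrix (A B : Matrix (Fin 2) (Fin 2) R) :
    (omegaMatrix A B).det = A.det ^ 2 * B.det ^ 2 := by
  have h : omegaMatrix A B = omegaMatrix A 1 * omegaMatrix 1 B := by
    rw [← omegaMatrix_mul, mul_one, one_mul]
  rw [h, Matrix.det_mul, det_omegaMatrix_one_right, det_omegaMatrix_one_left]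

/-- In signed coordinates Ω(A, B) is X ↦ A X Bᵗ, and the form x₀x₃ + x₁x₂ is -det X. -/
theorem omegaMatrix_transpose_mul (A B : Matrix (Fin 2) (Fin 2) R) :
    (omegaMatrix A B).transpose * antidiag R * omegaMatrix A B = (A.det * B.det) • antidiag R := by
  ext i j
  fin_cases i <;> fin_cases j <;>
    simp [omegaMatrix, antidiag, Matrix.mul_apply, Fin.sum_univ_succ, Matrix.det_fin_two] <;> ring

end OmegaMatrix

/-! ### Gauss decomposition in the real orthogonal group. -/

section RealOrthogonal
open Matrix

/-- Special linear matrices with prescribed entries. -/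
theorem exists_omegaMatrix_of_fixed {W : Matrix (Fin 4) (Fin 4) ℝ}
    (hW : W.transpose * antidiag ℝ * W = antidiag ℝ) (h11 : 0 < W 1 1)
    (h0 : ∀ i, W i 0 = (1 : Matrix (Fin 4) (Fin 4) ℝ) i 0)
    (h3 : ∀ i, W i 3 = (1 : Matrix (Fin 4) (Fin 4) ℝ) i 3) :
    ∃ A B : SpecialLinearGroup (Fin 2) ℝ, W = omegaMatrix (A : Matrix (Fin 2) (Fin 2) ℝ) B := by
  have e := fun i j => congrFun (congrFun hW i) j
  have a0 := h0 0; have a1 := h0 1; have a2 := h0 2; have a3 := h0 3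
  have b0 := h3 0; have b1 := h3 1; have b2 := h3 2; have b3 := h3 3
  simp only [one_apply] at a0 a1 a2 a3 b0 b1 b2 b3
  simp at a0 a1 a2 a3 b0 b1 b2 b3
  have e01 := e 0 1; have e02 := e 0 2; have e31 := e 3 1; have e32 := e 3 2
  have e11 := e 1 1; have e12 := e 1 2; have e22 := e 2 2
  simp [antidiag, Matrix.mul_apply, Fin.sum_univ_succ, a0, a1, a2, a3, b0, b1, b2, b3]
    at e01 e02 e31 e32 e11 e12 e22
  rw [e01, e31] at e11
  rw [e01, e32] at e12
  rw [e02, e32] at e22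
  -- W fixes e₀ and e₃, so it acts on the hyperbolic plane spanned by e₁ and e₂. An isometry of that
  -- plane with nonzero entry W₁₁ is diagonal, with mutually inverse entries.
  have h21 : W 2 1 = 0 := by
    rcases mul_eq_zero.1 (show W 1 1 * W 2 1 = 0 by linarith only [e11]) with h | h
    · exact absurd h h11.ne'
    · exact h
  rw [h21] at e12
  have h22 : W 1 1 * W 2 2 = 1 := by rw [e02] at e12; linarith only [e12]
  have h22' : W 2 2 ≠ 0 := right_ne_zero_of_mul (h22.trans_ne one_ne_zero)
  have h12 : W 1 2 = 0 := by
    rcases mul_eq_zero.1 (show W 1 2 * W 2 2 = 0 by linarith only [e22]) with h | h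
    · exact h
    · exact absurd h h22'
  have hs : 0 < Real.sqrt (W 1 1) := Real.sqrt_pos.2 h11
  have hs2 : Real.sqrt (W 1 1) * Real.sqrt (W 1 1) = W 1 1 := Real.mul_self_sqrt h11.le
  have h22e : W 2 2 = (Real.sqrt (W 1 1))⁻¹ * (Real.sqrt (W 1 1))⁻¹ := by
    rw [← mul_inv, hs2]; exact eq_inv_of_mul_eq_one_right h22
  -- Inverse tori in the two factors cancel on e₀ and e₃ and multiply e₁ by the square; this is
  -- where positivity of W₁₁ is needed.
  refine ⟨⟨!![Real.sqrt (W 1 1), 0; 0, (Real.sqrt (W 1 1))⁻¹], by simp [hs.ne']⟩,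
    ⟨!![(Real.sqrt (W 1 1))⁻¹, 0; 0, Real.sqrt (W 1 1)], by simp [hs.ne']⟩, ?_⟩
  ext i j
  fin_cases i <;> fin_cases j <;>
    simp [omegaMatrix, a0, a1, a2, a3, b0, b1, b2, b3, e01, e02, e31, e32, h12, h21, hs2, hs.ne',
      h22e]

theorem mul_omegaMatrix_orthogonal {W : Matrix (Fin 4) (Fin 4) ℝ}
    (hW : W.transpose * antidiag ℝ * W = antidiag ℝ) (A B : SpecialLinearGroup (Fin 2) ℝ) :
    (omegaMatrix (A : Matrix (Fin 2) (Fin 2) ℝ) B * W).transpose * antidiag ℝ * (omegaMatrix (A : Matrix (Fin 2) (Fin 2) ℝ) B * W) = antidiag ℝ := by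
  rw [transpose_mul]
  calc _ = W.transpose * ((omegaMatrix A.1 B.1).transpose * antidiag ℝ * omegaMatrix A.1 B.1) * W := by
        simp only [Matrix.mul_assoc]
    _ = _ := by rw [omegaMatrix_transpose_mul, A.2, B.2, mul_one, one_smul, hW]

theorem exists_of_omegaMatrix_mul {W : Matrix (Fin 4) (Fin 4) ℝ}
    (A B : SpecialLinearGroup (Fin 2) ℝ)
    (h : ∃ A' B' : SpecialLinearGroup (Fin 2) ℝ, omegaMatrix (A : Matrix (Fin 2) (Fin 2) ℝ) B * W = omegaMatrix (A' : Matrix (Fin 2) (Fin 2) ℝ) B') :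
    ∃ A' B' : SpecialLinearGroup (Fin 2) ℝ, W = omegaMatrix (A' : Matrix (Fin 2) (Fin 2) ℝ) B' := by
  obtain ⟨A', B', h⟩ := h
  refine ⟨A⁻¹ * A', B⁻¹ * B', ?_⟩
  have hA : (A⁻¹).1 * A.1 = 1 := congrArg Subtype.val (inv_mul_cancel A)
  have hB : (B⁻¹).1 * B.1 = 1 := congrArg Subtype.val (inv_mul_cancel B)
  change W = omegaMatrix ((A⁻¹).1 * A'.1) ((B⁻¹).1 * B'.1)
  rw [omegaMatrix_mul, ← h, ← Matrix.mul_assoc, ← omegaMatrix_mul, hA, hB, omegaMatrix_one,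
    Matrix.one_mul]

/-- Membership criterion for the image of `SL₂(ℝ) × SL₂(ℝ)`, a case of the Gauss decomposition. -/
theorem exists_omegaMatrix_of_pos {W : Matrix (Fin 4) (Fin 4) ℝ}
    (hW : W.transpose * antidiag ℝ * W = antidiag ℝ) (h00 : W 0 0 ≠ 0)
    (h11 : 0 < W 0 0 * W 1 1 - W 0 1 * W 1 0) :
    ∃ A B : SpecialLinearGroup (Fin 2) ℝ, W = omegaMatrix (A : Matrix (Fin 2) (Fin 2) ℝ) B := by
  set x := W 0 0 with hx
  -- normalise the first column
  let A1 : SpecialLinearGroup (Fin 2) ℝ := ⟨!![x⁻¹, 0; W 2 0, x], by simp [h00]⟩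
  let B1 : SpecialLinearGroup (Fin 2) ℝ := ⟨!![1, 0; W 1 0 / x, 1], by simp⟩
  apply exists_of_omegaMatrix_mul A1 B1
  have e00 := congrFun (congrFun hW 0) 0
  simp [antidiag, Matrix.mul_apply, Fin.sum_univ_succ] at e00
  have hV := mul_omegaMatrix_orthogonal hW A1 B1
  have c0 : (omegaMatrix A1.1 B1.1 * W) 0 0 = 1 := by
    simp [A1, B1, omegaMatrix, Matrix.mul_apply, Fin.sum_univ_succ]
    rw [← hx]; field_simp
  have c1 : (omegaMatrix A1.1 B1.1 * W) 1 0 = 0 := by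
    simp [A1, B1, omegaMatrix, Matrix.mul_apply, Fin.sum_univ_succ]
    rw [← hx]; field_simp; ring
  have c2 : (omegaMatrix A1.1 B1.1 * W) 2 0 = 0 := by
    simp [A1, B1, omegaMatrix, Matrix.mul_apply, Fin.sum_univ_succ]
    rw [← hx]; field_simp; ring
  have c3 : (omegaMatrix A1.1 B1.1 * W) 3 0 = 0 := by
    simp [A1, B1, omegaMatrix, Matrix.mul_apply, Fin.sum_univ_succ]
    rw [← hx] at e00 ⊢; field_simp; linarith
  -- The sign of the upper left 2 × 2 minor survives in the (1, 1) entry.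
  have c11 : 0 < (omegaMatrix A1.1 B1.1 * W) 1 1 := by
    have : (omegaMatrix A1.1 B1.1 * W) 1 1 = (x * W 1 1 - W 0 1 * W 1 0) / x ^ 2 := by
      simp [A1, B1, omegaMatrix, Matrix.mul_apply, Fin.sum_univ_succ]
      field_simp; ring
    rw [this]; positivity
  generalize omegaMatrix A1.1 B1.1 * W = V at *
  clear hW h11 e00
  -- normalise the last column
  let A2 : SpecialLinearGroup (Fin 2) ℝ := ⟨!![1, -V 1 3; 0, 1], by simp⟩
  let B2 : SpecialLinearGroup (Fin 2) ℝ := ⟨!![1, -V 2 3; 0, 1], by simp⟩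
  apply exists_of_omegaMatrix_mul A2 B2
  have e03 := congrFun (congrFun hV 0) 3
  have e33 := congrFun (congrFun hV 3) 3
  have e01 := congrFun (congrFun hV 0) 1
  simp [antidiag, Matrix.mul_apply, Fin.sum_univ_succ, c0, c1, c2, c3] at e03 e33 e01
  rw [e03] at e33
  have f11 : (omegaMatrix A2.1 B2.1 * V) 1 1 = V 1 1 := by
    simp [A2, B2, omegaMatrix, Matrix.mul_apply, Fin.sum_univ_succ, e01]
  refine exists_omegaMatrix_of_fixed (mul_omegaMatrix_orthogonal hV A2 B2)
    (f11 ▸ c11) ?_ ?_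
  · intro i
    fin_cases i <;>
      simp [A2, B2, omegaMatrix, Matrix.mul_apply, Fin.sum_univ_succ, c0, c1, c2, c3, one_apply]
  · intro i
    fin_cases i <;>
      simp [A2, B2, omegaMatrix, Matrix.mul_apply, Fin.sum_univ_succ, e03, one_apply]
    linarith

end RealOrthogonal

/-! ### The identity component as the image of SL₂(ℝ) × SL₂(ℝ). -/

section IdentityComponent
open Matrix

/-- The upper unipotent matrix with entry `t`. -/
def upperUnipotent (t : ℝ) : SpecialLinearGroup (Fin 2) ℝ := ⟨!![1, t; 0, 1], by simp⟩

/-- The lower unipotent matrix with entry `t`. -/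
def lowerUnipotent (t : ℝ) : SpecialLinearGroup (Fin 2) ℝ := ⟨!![1, 0; t, 1], by simp⟩

theorem continuous_coe_specialLinearGroup {n : Type*} [Fintype n] [DecidableEq n] :
    Continuous fun A : SpecialLinearGroup n ℝ => A.1 :=
  SpecialLinearGroup.isClosedEmbedding_val.continuous

/-- A subgroup of `SL₂(ℝ)` that contains the elementary matrices is everything. -/
theorem mem_of_elementary_mem {S : Subgroup (SpecialLinearGroup (Fin 2) ℝ)}
    (hu : ∀ t : ℝ, upperUnipotent t ∈ S)
    (hl : ∀ t : ℝ, lowerUnipotent t ∈ S)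
    (A : SpecialLinearGroup (Fin 2) ℝ) : A ∈ S := by
  have key : ∀ A : SpecialLinearGroup (Fin 2) ℝ, A.1 1 0 ≠ 0 → A ∈ S := by
    intro A hc
    have hd := A.2
    rw [det_fin_two] at hd
    -- With lower left entry c ≠ 0 the matrix is upper · lower · upper. The case c = 0 is reduced to
    -- this one by a lower unipotent.
    have := mul_mem (mul_mem (hu ((A.1 0 0 - 1) / A.1 1 0)) (hl (A.1 1 0)))
      (hu ((A.1 1 1 - 1) / A.1 1 0))
    refine (congrArg (· ∈ S) (Subtype.ext ?_)).mpr this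
    change A.1 = !![1, (A.1 0 0 - 1) / A.1 1 0; 0, 1] * !![1, 0; A.1 1 0, 1] *
      !![1, (A.1 1 1 - 1) / A.1 1 0; 0, 1]
    ext i j
    fin_cases i <;> fin_cases j <;> simp [Matrix.mul_apply, Fin.sum_univ_succ] <;> field_simp
    · ring
    · linarith
    · ring
  by_cases hc : A.1 1 0 = 0
  · have hd := A.2
    rw [det_fin_two, hc, mul_zero, sub_zero] at hd
    have h := key (lowerUnipotent 1 * A) (by
      change ((!![1, 0; 1, 1] : Matrix (Fin 2) (Fin 2) ℝ) * A.1) 1 0 ≠ 0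
      simp [Matrix.mul_apply, Fin.sum_univ_succ, hc]
      exact left_ne_zero_of_mul (hd.trans_ne one_ne_zero))
    exact (Subgroup.mul_mem_cancel_left S (hl 1)).1 h
  · exact key A hc

/-- The homomorphism `(A, B) ↦ Q⁻¹ Ω(A, B) Q`. -/
noncomputable def conjOmega (Q : Matrix (Fin 4) (Fin 4) ℝ) (hQ : IsUnit Q.det) :
    SpecialLinearGroup (Fin 2) ℝ × SpecialLinearGroup (Fin 2) ℝ →*
      SpecialLinearGroup (Fin 4) ℝ :=
  MonoidHom.mk' (fun p => ⟨Q⁻¹ * omegaMatrix p.1.1 p.2.1 * Q, by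
      rw [det_mul, det_mul, mul_right_comm, ← det_mul, nonsing_inv_mul _ hQ, det_one, one_mul,
        det_omegaMatrix, p.1.2, p.2.2]
      norm_num⟩) fun p q => by
    apply Subtype.ext
    change Q⁻¹ * omegaMatrix (p.1.1 * q.1.1) (p.2.1 * q.2.1) * Q =
      (Q⁻¹ * omegaMatrix p.1.1 p.2.1 * Q) * (Q⁻¹ * omegaMatrix q.1.1 q.2.1 * Q)
    rw [omegaMatrix_mul]
    simp only [Matrix.mul_assoc]
    rw [mul_nonsing_inv_cancel_left _ _ hQ]

theorem coe_conjOmega (Q : Matrix (Fin 4) (Fin 4) ℝ) (hQ : IsUnit Q.det)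
    (A B : SpecialLinearGroup (Fin 2) ℝ) :
    (conjOmega Q hQ (A, B)).1 = Q⁻¹ * omegaMatrix A.1 B.1 * Q := rfl

variable {T : Matrix (Fin 4) (Fin 4) ℤ} {Q : Matrix (Fin 4) (Fin 4) ℝ} {c : ℝ}

theorem mem_SOReal {U : SpecialLinearGroup (Fin 4) ℝ} :
    U ∈ SOReal T ↔ U.1.transpose * T.map (Int.cast : ℤ → ℝ) * U.1 = T.map (Int.cast : ℤ → ℝ) :=
  Iff.rfl

/-- The change of basis Q carries the determinant form to c times the form of T, and isometries do
not see the scalar c. -/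
theorem mem_SOReal_iff (hQ : IsUnit Q.det) (hc : c ≠ 0)
    (hT : Q.transpose * antidiag ℝ * Q = c • T.map (Int.cast : ℤ → ℝ))
    {U : SpecialLinearGroup (Fin 4) ℝ} :
    U ∈ SOReal T ↔ (Q * U.1 * Q⁻¹).transpose * antidiag ℝ * (Q * U.1 * Q⁻¹) = antidiag ℝ := by
  rw [mem_SOReal]
  have h1 : Q⁻¹ * Q = 1 := nonsing_inv_mul _ hQ
  have h2 : Q * Q⁻¹ = 1 := mul_nonsing_inv _ hQ
  have h1t : Q.transpose * Q⁻¹.transpose = 1 := by rw [← transpose_mul, h1, transpose_one]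
  have h2t : Q⁻¹.transpose * Q.transpose = 1 := by rw [← transpose_mul, h2, transpose_one]
  have hP : antidiag ℝ = Q⁻¹.transpose * (c • T.map (Int.cast : ℤ → ℝ)) * Q⁻¹ := by
    rw [← hT]
    calc _ = (Q⁻¹.transpose * Q.transpose) * antidiag ℝ * (Q * Q⁻¹) := by rw [h2t, h2]; simp
      _ = _ := by simp only [Matrix.mul_assoc]
  have e : (Q * U.1 * Q⁻¹).transpose * antidiag ℝ * (Q * U.1 * Q⁻¹) =
      Q⁻¹.transpose * (c • (U.1.transpose * T.map (Int.cast : ℤ → ℝ) * U.1)) * Q⁻¹ := by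
    rw [transpose_mul, transpose_mul]
    calc _ = Q⁻¹.transpose * (U.1.transpose * (Q.transpose * antidiag ℝ * Q) * U.1) * Q⁻¹ := by
          simp only [Matrix.mul_assoc]
      _ = _ := by rw [hT, Matrix.mul_smul, Matrix.smul_mul]
  rw [e]
  constructor
  · intro h
    rw [h, ← hP]
  · intro h
    rw [hP] at h
    have h' := congrArg (fun X => Q.transpose * X * Q) h
    have h3 : ∀ X : Matrix (Fin 4) (Fin 4) ℝ,
        Q.transpose * (Q⁻¹.transpose * X * Q⁻¹) * Q = X := by
      intro X
      calc _ = (Q.transpose * Q⁻¹.transpose) * X * (Q⁻¹ * Q) := by simp only [Matrix.mul_assoc]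
        _ = X := by rw [h1t, h1]; simp
    simp only [h3] at h'
    exact smul_right_injective _ hc h'

theorem conjOmega_mem_SOReal (hQ : IsUnit Q.det) (hc : c ≠ 0)
    (hT : Q.transpose * antidiag ℝ * Q = c • T.map (Int.cast : ℤ → ℝ))
    (p : SpecialLinearGroup (Fin 2) ℝ × SpecialLinearGroup (Fin 2) ℝ) :
    conjOmega Q hQ p ∈ SOReal T := by
  rw [mem_SOReal_iff hQ hc hT]
  have : Q * (conjOmega Q hQ p).1 * Q⁻¹ = omegaMatrix p.1.1 p.2.1 := by
    rw [show p = (p.1, p.2) from rfl, coe_conjOmega, Matrix.mul_assoc, Matrix.mul_assoc,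
      mul_nonsing_inv _ hQ, Matrix.mul_one, mul_nonsing_inv_cancel_left _ _ hQ]
  rw [this, omegaMatrix_transpose_mul, p.1.2, p.2.2, mul_one, one_smul]

theorem continuous_conjOmega (hQ : IsUnit Q.det) : Continuous (conjOmega Q hQ) := by
  refine Continuous.subtype_mk ?_ _
  have h : Continuous fun p : SpecialLinearGroup (Fin 2) ℝ × SpecialLinearGroup (Fin 2) ℝ =>
      omegaMatrix p.1.1 p.2.1 := by
    have h1 : ∀ i j, Continuous fun p : SpecialLinearGroup (Fin 2) ℝ ×
        SpecialLinearGroup (Fin 2) ℝ => p.1.1 i j :=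
      fun i j => (continuous_coe_specialLinearGroup.comp continuous_fst).matrix_elem i j
    have h2 : ∀ i j, Continuous fun p : SpecialLinearGroup (Fin 2) ℝ ×
        SpecialLinearGroup (Fin 2) ℝ => p.2.1 i j :=
      fun i j => (continuous_coe_specialLinearGroup.comp continuous_snd).matrix_elem i j
    refine continuous_matrix fun i j => ?_
    fin_cases i <;> fin_cases j <;> simp only [omegaMatrix] <;>
      first
      | exact (h1 _ _).mul (h2 _ _)
      | exact (h2 _ _).mul (h1 _ _)
      | exact ((h1 _ _).mul (h2 _ _)).neg
      | exact ((h2 _ _).mul (h1 _ _)).neg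
  exact (continuous_const.matrix_mul h).matrix_mul continuous_const

/-- The homomorphism `conjOmega` as a map to the special orthogonal group. -/
noncomputable def conjOmegaSO (hQ : IsUnit Q.det) (hc : c ≠ 0)
    (hT : Q.transpose * antidiag ℝ * Q = c • T.map (Int.cast : ℤ → ℝ)) :
    SpecialLinearGroup (Fin 2) ℝ × SpecialLinearGroup (Fin 2) ℝ →* SOReal T :=
  (conjOmega Q hQ).codRestrict (SOReal T) (conjOmega_mem_SOReal hQ hc hT)

theorem continuous_conjOmegaSO (hQ : IsUnit Q.det) (hc : c ≠ 0)
    (hT : Q.transpose * antidiag ℝ * Q = c • T.map (Int.cast : ℤ → ℝ)) :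
    Continuous (conjOmegaSO hQ hc hT) :=
  (continuous_conjOmega hQ).subtype_mk _

/-- The elementary one-parameter subgroups of each factor pass through the identity and generate
that factor, so they carry everything into the component. -/
theorem conjOmegaSO_mem_connectedComponent (hQ : IsUnit Q.det) (hc : c ≠ 0)
    (hT : Q.transpose * antidiag ℝ * Q = c • T.map (Int.cast : ℤ → ℝ))
    (p : SpecialLinearGroup (Fin 2) ℝ × SpecialLinearGroup (Fin 2) ℝ) :
    conjOmegaSO hQ hc hT p ∈ Subgroup.connectedComponentOfOne (SOReal T) := by
  have path : ∀ f : ℝ → SpecialLinearGroup (Fin 2) ℝ × SpecialLinearGroup (Fin 2) ℝ,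
      Continuous f → f 0 = 1 → ∀ t,
        conjOmegaSO hQ hc hT (f t) ∈ Subgroup.connectedComponentOfOne (SOReal T) := by
    intro f hf h0 t
    have hpre := isPreconnected_range ((continuous_conjOmegaSO hQ hc hT).comp hf)
    exact hpre.subset_connectedComponent ⟨0, by simp [h0]⟩ ⟨t, rfl⟩
  have cu : Continuous upperUnipotent := by
    refine Continuous.subtype_mk (continuous_matrix fun i j => ?_) _
    fin_cases i <;> fin_cases j <;> simp <;> fun_prop
  have cl : Continuous lowerUnipotent := by
    refine Continuous.subtype_mk (continuous_matrix fun i j => ?_) _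
    fin_cases i <;> fin_cases j <;> simp <;> fun_prop
  have zu : upperUnipotent 0 = 1 := Subtype.ext one_fin_two.symm
  have zl : lowerUnipotent 0 = 1 := Subtype.ext one_fin_two.symm
  let S := (Subgroup.connectedComponentOfOne (SOReal T)).comap (conjOmegaSO hQ hc hT)
  have hl : ∀ A, A ∈ S.comap (MonoidHom.inl _ _) :=
    mem_of_elementary_mem (fun t => path (fun t => (upperUnipotent t, 1)) (cu.prodMk continuous_const)
      (Prod.ext zu rfl) t) (fun t => path (fun t => (lowerUnipotent t, 1)) (cl.prodMk continuous_const)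
      (Prod.ext zl rfl) t)
  have hr : ∀ A, A ∈ S.comap (MonoidHom.inr _ _) :=
    mem_of_elementary_mem (fun t => path (fun t => (1, upperUnipotent t)) (continuous_const.prodMk cu)
      (Prod.ext rfl zu) t) (fun t => path (fun t => (1, lowerUnipotent t)) (continuous_const.prodMk cl)
      (Prod.ext rfl zl) t)
  change p ∈ S
  have h2 : p = MonoidHom.inl _ _ p.1 * MonoidHom.inr _ _ p.2 := by
    ext1 <;> simp
  rw [h2]
  exact mul_mem (hl p.1) (hr p.2)

/-- The inequalities of the Gauss decomposition define an open neighbourhood of the identity inside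
the range, and a subgroup containing a neighbourhood of 1 is open. -/
theorem isOpen_range_conjOmegaSO (hQ : IsUnit Q.det) (hc : c ≠ 0)
    (hT : Q.transpose * antidiag ℝ * Q = c • T.map (Int.cast : ℤ → ℝ)) :
    IsOpen ((conjOmegaSO hQ hc hT).range : Set (SOReal T)) := by
  have hcont : Continuous fun U : SOReal T => Q * U.1.1 * Q⁻¹ :=
    (continuous_const.matrix_mul (continuous_coe_specialLinearGroup.comp continuous_subtype_val)).matrix_mul
      continuous_const
  have hW : ∀ i j, Continuous fun U : SOReal T => (Q * U.1.1 * Q⁻¹) i j :=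
    fun i j => hcont.matrix_elem i j
  have h1 : Q * (1 : SOReal T).1.1 * Q⁻¹ = 1 := by
    change Q * 1 * Q⁻¹ = 1
    rw [Matrix.mul_one, mul_nonsing_inv _ hQ]
  apply Subgroup.isOpen_of_mem_nhds _ (g := 1)
  have o1 : IsOpen {U : SOReal T | (Q * U.1.1 * Q⁻¹) 0 0 ≠ 0} :=
    isOpen_ne_fun (hW 0 0) continuous_const
  have o2 : IsOpen {U : SOReal T | 0 < (Q * U.1.1 * Q⁻¹) 0 0 * (Q * U.1.1 * Q⁻¹) 1 1 -
      (Q * U.1.1 * Q⁻¹) 0 1 * (Q * U.1.1 * Q⁻¹) 1 0} :=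
    isOpen_lt continuous_const (((hW 0 0).mul (hW 1 1)).sub ((hW 0 1).mul (hW 1 0)))
  refine Filter.mem_of_superset ((o1.inter o2).mem_nhds ?_) ?_
  · constructor
    · change (Q * (1 : SOReal T).1.1 * Q⁻¹) 0 0 ≠ 0
      rw [h1]; simp
    · change 0 < (Q * (1 : SOReal T).1.1 * Q⁻¹) 0 0 * (Q * (1 : SOReal T).1.1 * Q⁻¹) 1 1 -
        (Q * (1 : SOReal T).1.1 * Q⁻¹) 0 1 * (Q * (1 : SOReal T).1.1 * Q⁻¹) 1 0
      rw [h1]; simp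
  · rintro U ⟨hU1, hU2⟩
    obtain ⟨A, B, h⟩ := exists_omegaMatrix_of_pos ((mem_SOReal_iff hQ hc hT).1 U.2) hU1 hU2
    refine ⟨(A, B), Subtype.ext (Subtype.ext ?_)⟩
    change Q⁻¹ * omegaMatrix A.1 B.1 * Q = U.1.1
    rw [← h, Matrix.mul_assoc, Matrix.mul_assoc, nonsing_inv_mul _ hQ, Matrix.mul_one,
      nonsing_inv_mul_cancel_left _ _ hQ]

/-- The identity component of the orthogonal group of signature `(2, 2)` is the image of
`SL₂(ℝ) × SL₂(ℝ)`. -/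
theorem mem_SO0Real_iff (hQ : IsUnit Q.det) (hc : c ≠ 0)
    (hT : Q.transpose * antidiag ℝ * Q = c • T.map (Int.cast : ℤ → ℝ))
    {U : SpecialLinearGroup (Fin 4) ℝ} :
    U ∈ SO0Real T ↔ ∃ A B, U = conjOmega Q hQ (A, B) := by
  constructor
  · rintro ⟨V, hV, rfl⟩
    have ho := isOpen_range_conjOmegaSO hQ hc hT
    -- An open subgroup is closed, so it contains the component of the identity.
    have hcl : IsClopen ((conjOmegaSO hQ hc hT).range : Set (SOReal T)) :=
      ⟨Subgroup.isClosed_of_isOpen _ ho, ho⟩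
    obtain ⟨⟨A, B⟩, h⟩ := hcl.connectedComponent_subset (one_mem _) hV
    exact ⟨A, B, congrArg Subtype.val h.symm⟩
  · rintro ⟨A, B, rfl⟩
    exact ⟨_, conjOmegaSO_mem_connectedComponent hQ hc hT (A, B), rfl⟩

end IdentityComponent

/-! ### The content ideal and its conjugate. -/

section Content
variable {K : Type*} [Field K] [NumberField K]

theorem mul_conj_mem {σ : K ≃ₐ[ℚ] K} {A B : FractionalIdeal (𝓞 K)⁰ K} {x y : K}
    (hx : x ∈ A) (hy : y ∈ B) : x * σ y ∈ A * conjIdeal σ B :=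
  mul_mem_mul hx (conj_mem_conjIdeal hy)

theorem inv_mul_mem_iff {A : FractionalIdeal (𝓞 K)⁰ K} {r x : K} (hr : r ≠ 0) :
    r⁻¹ * x ∈ A ↔ x ∈ spanSingleton (𝓞 K)⁰ r * A := by
  rw [mem_singleton_mul]
  constructor
  · intro h
    exact ⟨_, h, by field_simp⟩
  · rintro ⟨y, hy, rfl⟩
    rwa [inv_mul_cancel_left₀ hr]

theorem mem_mul_inv_of_forall {A B : FractionalIdeal (𝓞 K)⁰ K} (hB : B ≠ 0) {x : K}
    (h : ∀ y ∈ B, x * y ∈ A) : x ∈ A * B⁻¹ := by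
  rw [← spanSingleton_le_iff_mem]
  calc spanSingleton (𝓞 K)⁰ x = spanSingleton (𝓞 K)⁰ x * B * B⁻¹ := by
        rw [mul_assoc, mul_inv_cancel₀ hB, mul_one]
    _ ≤ A * B⁻¹ := by
        gcongr
        rw [spanSingleton_mul_le_iff]
        exact h

theorem add_mem' {A : FractionalIdeal (𝓞 K)⁰ K} {x y : K} (hx : x ∈ A) (hy : y ∈ A) : x + y ∈ A :=
  Submodule.add_mem A.1 hx hy

theorem sub_mem' {A : FractionalIdeal (𝓞 K)⁰ K} {x y : K} (hx : x ∈ A) (hy : y ∈ A) : x - y ∈ A :=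
  Submodule.sub_mem A.1 hx hy

theorem neg_mem' {A : FractionalIdeal (𝓞 K)⁰ K} {x : K} (hx : x ∈ A) : -x ∈ A :=
  Submodule.neg_mem A.1 hx

/-- The fractional ideals `(1, J; J⁻¹, 1)`. -/
noncomputable def weight (J : FractionalIdeal (𝓞 K)⁰ K) : Matrix (Fin 2) (Fin 2) (FractionalIdeal (𝓞 K)⁰ K) :=
  !![1, J; J⁻¹, 1]

theorem contentIdeal_le_iff_weight {I : Ideal (𝓞 K)} (hI : I ≠ ⊥) {L : Matrix (Fin 2) (Fin 2) K}
    {A : FractionalIdeal (𝓞 K)⁰ K} :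
    contentIdeal I L ≤ A ↔ ∀ i j, L i j ∈ A * weight (I : FractionalIdeal (𝓞 K)⁰ K) i j := by
  rw [contentIdeal_le_iff hI]
  simp [Fin.forall_fin_two, weight, and_assoc]

theorem contentIdeal_smul (I : Ideal (𝓞 K)) (t : K) (L : Matrix (Fin 2) (Fin 2) K) :
    contentIdeal I (t • L) = spanSingleton (𝓞 K)⁰ t * contentIdeal I L := by
  simp only [contentIdeal, Matrix.smul_apply, smul_eq_mul, ← spanSingleton_mul_spanSingleton]
  ring

/-- The integrality condition on products of entries of `L` and of its conjugate. -/
def PairwiseIntegral (σ : K ≃ₐ[ℚ] K) (J : FractionalIdeal (𝓞 K)⁰ K) (L : Matrix (Fin 2) (Fin 2) K)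
    (r : K) : Prop :=
  ∀ i j k l, L i j * σ (L k l) ∈
    spanSingleton (𝓞 K)⁰ r * weight J i j * conjIdeal σ (weight J k l)

variable {σ : K ≃ₐ[ℚ] K} {I : Ideal (𝓞 K)} {L : Matrix (Fin 2) (Fin 2) K} {r : K}

theorem pairwiseIntegral_of_content_le (hI : I ≠ ⊥)
    (h : contentIdeal I L * conjIdeal σ (contentIdeal I L) ≤ spanSingleton (𝓞 K)⁰ r) :
    PairwiseIntegral σ I L r := by
  intro i j k l
  have h1 := (contentIdeal_le_iff_weight hI).1 (le_refl (contentIdeal I L))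
  have h2 := mul_conj_mem (σ := σ) (h1 i j) (h1 k l)
  rw [map_mul] at h2
  have h3 : contentIdeal I L * weight (I : FractionalIdeal (𝓞 K)⁰ K) i j *
      (conjIdeal σ (contentIdeal I L) * conjIdeal σ (weight (I : FractionalIdeal (𝓞 K)⁰ K) k l)) ≤
      spanSingleton (𝓞 K)⁰ r * weight (I : FractionalIdeal (𝓞 K)⁰ K) i j *
        conjIdeal σ (weight (I : FractionalIdeal (𝓞 K)⁰ K) k l) := by
    rw [show ∀ a b c d : FractionalIdeal (𝓞 K)⁰ K, a * b * (c * d) = (a * c) * b * d by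
      intros; ring]
    gcongr
  exact h3 h2

/-- The weighted entries of L generate its content, so the condition extends by linearity, one
factor at a time, with a conjugation in between to move the other factor into place. -/
theorem PairwiseIntegral.mul_conj_mem (hK : Module.finrank ℚ K = 2) (hσ : σ ≠ AlgEquiv.refl)
    (hI : I ≠ ⊥) (hr : σ r = r) (h : PairwiseIntegral σ I L r) {x y : K}
    (hx : x ∈ contentIdeal I L) (hy : y ∈ contentIdeal I L) :
    x * σ y ∈ spanSingleton (𝓞 K)⁰ r := by
  have key : ∀ (t : K) (A : FractionalIdeal (𝓞 K)⁰ K),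
      (∀ i j, t * L i j ∈ A * weight (I : FractionalIdeal (𝓞 K)⁰ K) i j) →
      ∀ z ∈ contentIdeal I L, t * z ∈ A := by
    intro t A ht z hz
    have h1 : contentIdeal I (t • L) ≤ A := (contentIdeal_le_iff_weight hI).2 (by simpa using ht)
    rw [contentIdeal_smul, spanSingleton_mul_le_iff] at h1
    exact h1 z hz
  have h1 : ∀ k l, σ (L k l) * x ∈
      spanSingleton (𝓞 K)⁰ r * conjIdeal σ (weight (I : FractionalIdeal (𝓞 K)⁰ K) k l) := by
    intro k l
    refine key _ _ (fun i j => ?_) x hx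
    rw [mul_comm (σ (L k l)), mul_right_comm]
    exact h i j k l
  have h2 := key (σ x) (spanSingleton (𝓞 K)⁰ r) (fun k l => by
    have := conj_mem_conjIdeal (σ := σ) (h1 k l)
    rwa [map_mul, map_mul, conjIdeal_conjIdeal hK hσ, conjIdeal_spanSingleton hK hσ, hr,
      conj_conj hK hσ, mul_comm (L k l)] at this) y hy
  have := conj_mem_conjIdeal (σ := σ) h2
  rwa [map_mul, conj_conj hK hσ, conjIdeal_spanSingleton hK hσ, hr] at this

theorem PairwiseIntegral.content_le (hK : Module.finrank ℚ K = 2) (hσ : σ ≠ AlgEquiv.refl)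
    (hI : I ≠ ⊥) (hr : σ r = r) (h : PairwiseIntegral σ I L r) :
    contentIdeal I L * conjIdeal σ (contentIdeal I L) ≤ spanSingleton (𝓞 K)⁰ r := by
  rw [FractionalIdeal.mul_le]
  intro x hx y hy
  obtain ⟨z, hz, rfl⟩ := exists_of_mem_conjIdeal hy
  exact h.mul_conj_mem hK hσ hI hr hx hz

/-- Integrality forces the square of the content to be generated by the determinant. -/
theorem PairwiseIntegral.content_sq (hK : Module.finrank ℚ K = 2) (hσ : σ ≠ AlgEquiv.refl)
    (hI : I ≠ ⊥) (hr : σ r = r) (hr0 : r ≠ 0) (hdet : L.det * σ L.det = r ^ 2)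
    (h : PairwiseIntegral σ I L r) : contentIdeal I L ^ 2 = spanSingleton (𝓞 K)⁰ L.det := by
  have hd : L.det ≠ 0 := left_ne_zero_of_mul (hdet.trans_ne (pow_ne_zero _ hr0))
  have hd' : σ L.det ≠ 0 := right_ne_zero_of_mul (hdet.trans_ne (pow_ne_zero _ hr0))
  have h1 := spanSingleton_det_le hI L
  refine le_antisymm ?_ h1
  set A := contentIdeal I L
  have h2 : spanSingleton (𝓞 K)⁰ (σ L.det) ≤ conjIdeal σ A ^ 2 := by
    rw [← conjIdeal_spanSingleton hK hσ, ← map_pow]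
    exact conjIdeal_mono h1
  -- Writing d = det L: A² (d') ⊆ A² A'² ⊆ (r²) = (d d'), after which (d') cancels.
  have h3 : A ^ 2 * spanSingleton (𝓞 K)⁰ (σ L.det) ≤
      spanSingleton (𝓞 K)⁰ L.det * spanSingleton (𝓞 K)⁰ (σ L.det) := by
    calc A ^ 2 * spanSingleton (𝓞 K)⁰ (σ L.det) ≤ A ^ 2 * conjIdeal σ A ^ 2 := by gcongr
      _ = (A * conjIdeal σ A) * (A * conjIdeal σ A) := by ring
      _ ≤ spanSingleton (𝓞 K)⁰ r * spanSingleton (𝓞 K)⁰ r := by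
          have := h.content_le hK hσ hI hr
          gcongr
      _ = _ := by
          rw [spanSingleton_mul_spanSingleton, spanSingleton_mul_spanSingleton, hdet, sq]
  have h4 : spanSingleton (𝓞 K)⁰ (σ L.det) ≠ 0 := spanSingleton_ne_zero_iff.2 hd'
  calc A ^ 2 = A ^ 2 * spanSingleton (𝓞 K)⁰ (σ L.det) * (spanSingleton (𝓞 K)⁰ (σ L.det))⁻¹ := by
        rw [mul_assoc, mul_inv_cancel₀ h4, mul_one]
    _ ≤ spanSingleton (𝓞 K)⁰ L.det * spanSingleton (𝓞 K)⁰ (σ L.det) *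
        (spanSingleton (𝓞 K)⁰ (σ L.det))⁻¹ := by gcongr
    _ = _ := by rw [mul_assoc, mul_inv_cancel₀ h4, mul_one]

/-- If the square of the content is generated by a determinant of positive norm, then the product
of the content and its conjugate is generated by a rational number. -/
theorem exists_content_mul_conj_le (hK : Module.finrank ℚ K = 2) (hσ : σ ≠ AlgEquiv.refl)
    {A : FractionalIdeal (𝓞 K)⁰ K} {d : K} (hd : 0 < Algebra.norm ℚ d)
    (h : A ^ 2 = spanSingleton (𝓞 K)⁰ d) :
    ∃ q : ℚ, 0 < q ∧ (q : K) ^ 2 = d * σ d ∧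
      A * conjIdeal σ A ≤ spanSingleton (𝓞 K)⁰ (q : K) := by
  -- The rational generator is the absolute norm of A, a positive square root of d d'.
  have h1 : absNorm A ^ 2 = Algebra.norm ℚ d := by
    rw [← map_pow, h, absNorm_span_singleton, abs_of_pos hd]
  have hq : absNorm A ≠ 0 := fun h0 => by rw [h0] at h1; norm_num at h1; exact hd.ne h1
  have h2 : ((absNorm A : ℚ) : K) ^ 2 = d * σ d := by
    rw [← norm_eq_mul_conj hK hσ, ← h1]; push_cast; rfl
  have hq' : ((absNorm A : ℚ) : K) ≠ 0 := by exact_mod_cast hq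
  refine ⟨absNorm A, lt_of_le_of_ne (absNorm_nonneg A) hq.symm, h2, ?_⟩
  intro x hx
  rw [mem_spanSingleton_iff_div hq', mem_one_iff_isIntegral]
  -- Since (A A')² = (q²), the square of x/q is integral, hence so is x/q.
  have h3 : x * x ∈ spanSingleton (𝓞 K)⁰ (((absNorm A : ℚ) : K) ^ 2) := by
    have := mul_mem_mul hx hx
    rwa [show ∀ a b : FractionalIdeal (𝓞 K)⁰ K, a * b * (a * b) = a ^ 2 * b ^ 2 by
      intros; ring, ← map_pow, h, conjIdeal_spanSingleton hK hσ, spanSingleton_mul_spanSingleton,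
      ← h2] at this
  rw [mem_spanSingleton_iff_div (pow_ne_zero _ hq'), mem_one_iff_isIntegral, ← sq, ← div_pow] at h3
  exact h3.of_pow (by norm_num)

end Content

/-! ### Lattice preservation as a condition on products of entries. -/

section Lattice
variable {K : Type*} [Field K] [NumberField K]

/-- The vectors `(N a, x, x', b)` with integers `a`, `b` and `x ∈ J`. -/
def IsLatticeVector (σ : K ≃ₐ[ℚ] K) (J : FractionalIdeal (𝓞 K)⁰ K) (x : Fin 4 → K) : Prop :=
  x 0 ∈ J * conjIdeal σ J ∧ σ (x 0) = x 0 ∧ x 1 ∈ J ∧ x 2 = σ (x 1) ∧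
    x 3 ∈ (1 : FractionalIdeal (𝓞 K)⁰ K) ∧ σ (x 3) = x 3

variable {σ : K ≃ₐ[ℚ] K} {J : FractionalIdeal (𝓞 K)⁰ K} {L : Matrix (Fin 2) (Fin 2) K} {r : K}

theorem omegaMatrix_conj_mulVec (L : Matrix (Fin 2) (Fin 2) K) (x : Fin 4 → K) :
    (omegaMatrix L (L.map σ)).mulVec x =
      ![L 0 0 * σ (L 0 0) * x 0 - L 0 0 * σ (L 0 1) * x 1 - σ (L 0 0) * L 0 1 * x 2
          - L 0 1 * σ (L 0 1) * x 3,
        -(L 0 0 * σ (L 1 0) * x 0) + L 0 0 * σ (L 1 1) * x 1 + L 0 1 * σ (L 1 0) * x 2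
          + L 0 1 * σ (L 1 1) * x 3,
        -(σ (L 0 0) * L 1 0 * x 0) + σ (L 0 1) * L 1 0 * x 1 + σ (L 0 0) * L 1 1 * x 2
          + σ (L 0 1) * L 1 1 * x 3,
        -(L 1 0 * σ (L 1 0) * x 0) + L 1 0 * σ (L 1 1) * x 1 + σ (L 1 0) * L 1 1 * x 2
          + L 1 1 * σ (L 1 1) * x 3] := by
  ext i
  fin_cases i <;> simp [omegaMatrix, Matrix.mulVec, dotProduct, Fin.sum_univ_succ] <;> ring

/-- The weights are chosen so that every summand of every coordinate lands in r times the ideal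
required there. The conjugation conditions hold because conjugation only permutes summands and
exchanges the two middle coordinates. -/
theorem PairwiseIntegral.isLatticeVector (hK : Module.finrank ℚ K = 2) (hσ : σ ≠ AlgEquiv.refl)
    (hJ : J ≠ 0) (hr : σ r = r) (hr0 : r ≠ 0) (h : PairwiseIntegral σ J L r) {x : Fin 4 → K}
    (hx : IsLatticeVector σ J x) :
    IsLatticeVector σ J (r⁻¹ • (omegaMatrix L (L.map σ)).mulVec x) := by
  have hJ' : conjIdeal σ J ≠ 0 := (map_ne_zero_iff _ (conjIdeal σ).injective).2 hJ
  obtain ⟨h0, s0, h1, h2, h3, s3⟩ := hx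
  rw [omegaMatrix_conj_mulVec]
  have m2 : x 2 ∈ conjIdeal σ J := h2 ▸ conj_mem_conjIdeal h1
  have m : ∀ {i j k l A B} {y : K}, y ∈ A → spanSingleton (𝓞 K)⁰ r * weight J i j *
      conjIdeal σ (weight J k l) * A = B → L i j * σ (L k l) * y ∈ B := by
    intro i j k l A B y hy e
    rw [← e]
    exact mul_mem_mul (h i j k l) hy
  have cc := conj_conj hK hσ
  refine ⟨?_, ?_, ?_, ?_, ?_, ?_⟩
  · simp only [Pi.smul_apply, smul_eq_mul, Matrix.cons_val_zero]
    rw [inv_mul_mem_iff hr0, mul_comm (σ (L 0 0)) (L 0 1)]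
    refine sub_mem' (sub_mem' (sub_mem' (m h0 ?_) (m h1 ?_)) (m m2 ?_)) (m h3 ?_) <;>
      simp [weight] <;> ring
  · simp [map_inv₀, hr, s0, s3, h2, cc]
    left; ring
  · simp only [Pi.smul_apply, smul_eq_mul, Matrix.cons_val_one, Matrix.cons_val_zero]
    rw [inv_mul_mem_iff hr0]
    refine add_mem' (add_mem' (add_mem' (neg_mem' (m h0 ?_)) (m h1 ?_)) (m m2 ?_)) (m h3 ?_) <;>
      simp [weight] <;> field_simp
  · simp [map_inv₀, hr, s0, s3, h2, cc]
    left; ring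
  · simp only [Pi.smul_apply, smul_eq_mul, Matrix.cons_val]
    rw [inv_mul_mem_iff hr0, mul_comm (σ (L 1 0)) (L 1 1)]
    refine add_mem' (add_mem' (add_mem' (neg_mem' (m h0 ?_)) (m h1 ?_)) (m m2 ?_)) (m h3 ?_) <;>
      simp [weight] <;> field_simp
  · simp [map_inv₀, hr, s0, s3, h2, cc]
    left; ring

/-- The vectors (N, 0, 0, 0) and (0, 0, 0, 1) isolate single products of entries. The vectors (0, t,
t', 0) only give sums of two, which are separated by the sum-and-product criterion because the
product of the two summands regroups into products already controlled. -/
theorem pairwiseIntegral_of_isLatticeVector (hK : Module.finrank ℚ K = 2)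
    (hσ : σ ≠ AlgEquiv.refl) (hJ : J ≠ 0) {N : ℕ} (hN : N ≠ 0)
    (hJN : J * conjIdeal σ J = spanSingleton (𝓞 K)⁰ (N : K)) (hr : σ r = r) (hr0 : r ≠ 0)
    (h : ∀ x, IsLatticeVector σ J x →
      IsLatticeVector σ J (r⁻¹ • (omegaMatrix L (L.map σ)).mulVec x)) :
    PairwiseIntegral σ J L r := by
  have hJ' : conjIdeal σ J ≠ 0 := (map_ne_zero_iff _ (conjIdeal σ).injective).2 hJ
  have hN' : (N : K) ≠ 0 := Nat.cast_ne_zero.2 hN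
  have hR : spanSingleton (𝓞 K)⁰ r ≠ 0 := spanSingleton_ne_zero_iff.2 hr0
  have cc := conj_conj hK hσ
  set R := spanSingleton (𝓞 K)⁰ r with hRdef
  have cR : conjIdeal σ R = R := by rw [hRdef, conjIdeal_spanSingleton hK hσ, hr]
  have z : ∀ A : FractionalIdeal (𝓞 K)⁰ K, (0 : K) ∈ A := zero_mem
  -- images of the lattice vectors
  obtain ⟨p1, -, p2, -, p3, -⟩ := h ![(N : K), 0, 0, 0]
    ⟨by rw [hJN]; exact mem_spanSingleton_self _ _, by simp, z _, by simp, z _, by simp⟩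
  obtain ⟨q1, -, q2, -, q3, -⟩ := h ![0, 0, 0, 1]
    ⟨z _, by simp, z _, by simp, one_mem_one _, by simp⟩
  have ht : ∀ t ∈ J, _ := fun t ht => h ![0, t, σ t, 0]
    ⟨z _, by simp, ht, by simp, z _, by simp⟩
  rw [omegaMatrix_conj_mulVec] at p1 p2 p3 q1 q2 q3
  simp only [omegaMatrix_conj_mulVec] at ht
  simp only [Pi.smul_apply, smul_eq_mul, Matrix.cons_val, inv_mul_mem_iff hr0, mul_zero, sub_zero,
    add_zero, neg_zero, zero_add, zero_sub, mul_one, ← hRdef] at p1 p2 p3 q1 q2 q3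
  have t1 : ∀ t ∈ J, L 0 0 * σ (L 0 1) * t + σ (L 0 0) * L 0 1 * σ t ∈ R * (J * conjIdeal σ J) := by
    intro t h'
    have := (ht t h').1
    simp only [Pi.smul_apply, smul_eq_mul, Matrix.cons_val, inv_mul_mem_iff hr0, mul_zero, sub_zero,
      zero_sub] at this
    convert! neg_mem' this using 1
    ring
  have t2 : ∀ t ∈ J, L 0 0 * σ (L 1 1) * t + L 0 1 * σ (L 1 0) * σ t ∈ R * J := by
    intro t h'
    have := (ht t h').2.2.1
    simpa only [Pi.smul_apply, smul_eq_mul, Matrix.cons_val, inv_mul_mem_iff hr0, mul_zero, neg_zero,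
      zero_add, add_zero] using this
  have t3 : ∀ t ∈ J, L 1 0 * σ (L 1 1) * t + σ (L 1 0) * L 1 1 * σ t ∈ R * 1 := by
    intro t h'
    have := (ht t h').2.2.2.2.1
    simpa only [Pi.smul_apply, smul_eq_mul, Matrix.cons_val, inv_mul_mem_iff hr0, mul_zero, neg_zero,
      zero_add, add_zero] using this
  have dN : ∀ {A : FractionalIdeal (𝓞 K)⁰ K} {y : K}, y * N ∈ A →
      y ∈ A * (J * conjIdeal σ J)⁻¹ := by
    intro A y hy
    rw [hJN]
    refine mem_mul_inv_of_forall (spanSingleton_ne_zero_iff.2 hN') fun w hw => ?_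
    obtain ⟨c, rfl⟩ := (mem_spanSingleton _).1 hw
    rw [mul_smul_comm]
    exact Submodule.smul_mem A.1 c hy
  have cast : ∀ {A B : FractionalIdeal (𝓞 K)⁰ K} {y : K}, y ∈ A → A = B → y ∈ B :=
    fun hy e => e ▸ hy
  have nm : ∀ t ∈ J, t * σ t ∈ J * conjIdeal σ J := fun t ht => mul_conj_mem ht ht
  have a00 : L 0 0 * σ (L 0 0) ∈ R := cast (dN p1) (by field_simp)
  have ac : L 0 0 * σ (L 1 0) ∈ R * (conjIdeal σ J)⁻¹ :=
    cast (dN (by simpa using neg_mem' p2)) (by field_simp)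
  have cc' : L 1 0 * σ (L 1 0) ∈ R * J⁻¹ * (conjIdeal σ J)⁻¹ :=
    cast (dN (by simpa using neg_mem' p3)) (by field_simp)
  have bb : L 0 1 * σ (L 0 1) ∈ R * (J * conjIdeal σ J) := by simpa using neg_mem' q1
  have bd : L 0 1 * σ (L 1 1) ∈ R * J := q2
  have dd : L 1 1 * σ (L 1 1) ∈ R := by simpa using q3
  have ab : L 0 0 * σ (L 0 1) ∈ R * conjIdeal σ J := by
    refine cast (mem_mul_inv_of_forall (A := R * (J * conjIdeal σ J)) hJ fun t h' =>
      mem_of_add_mem_of_mul_mem (t1 t h') ?_) (by field_simp)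
    rw [show L 0 0 * σ (L 0 1) * t * (σ (L 0 0) * L 0 1 * σ t) =
      (L 0 0 * σ (L 0 0)) * (L 0 1 * σ (L 0 1)) * (t * σ t) by ring]
    exact cast (mul_mem_mul (mul_mem_mul a00 bb) (nm t h')) (by ring)
  have cd : L 1 0 * σ (L 1 1) ∈ R * J⁻¹ := by
    refine cast (mem_mul_inv_of_forall (A := R * 1) hJ fun t h' =>
      mem_of_add_mem_of_mul_mem (t3 t h') ?_) (by rw [mul_one])
    rw [show L 1 0 * σ (L 1 1) * t * (σ (L 1 0) * L 1 1 * σ t) =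
      (L 1 0 * σ (L 1 0)) * (L 1 1 * σ (L 1 1)) * (t * σ t) by ring]
    exact cast (mul_mem_mul (mul_mem_mul cc' dd) (nm t h')) (by field_simp)
  -- The product of αδ't and βγ't' regroups as (αγ')(βδ')(tt'); it serves both remaining cases.
  have prod : ∀ t ∈ J, L 0 0 * σ (L 1 1) * t * (L 0 1 * σ (L 1 0) * σ t) ∈ R * J * (R * J) := by
    intro t h'
    rw [show L 0 0 * σ (L 1 1) * t * (L 0 1 * σ (L 1 0) * σ t) =
      (L 0 0 * σ (L 1 0)) * (L 0 1 * σ (L 1 1)) * (t * σ t) by ring]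
    exact cast (mul_mem_mul (mul_mem_mul ac bd) (nm t h')) (by field_simp)
  have ad : L 0 0 * σ (L 1 1) ∈ R :=
    cast (mem_mul_inv_of_forall (A := R * J) hJ fun t h' =>
      mem_of_add_mem_of_mul_mem (t2 t h') (prod t h')) (by field_simp)
  have bc : L 0 1 * σ (L 1 0) ∈ R * J * (conjIdeal σ J)⁻¹ := by
    refine mem_mul_inv_of_forall (A := R * J) hJ' fun w hw => ?_
    obtain ⟨t, h', rfl⟩ := exists_of_mem_conjIdeal hw
    refine mem_of_add_mem_of_mul_mem (y := L 0 0 * σ (L 1 1) * t) ?_ ?_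
    · rw [add_comm]; exact t2 t h'
    · rw [mul_comm (L 0 1 * σ (L 1 0) * σ t)]; exact prod t h'
  -- Conjugation exchanges the two index pairs, so ten of the sixteen products suffice.
  have symm : ∀ i j k l, L i j * σ (L k l) ∈ R * weight J i j * conjIdeal σ (weight J k l) →
      L k l * σ (L i j) ∈ R * weight J k l * conjIdeal σ (weight J i j) := by
    intro i j k l h'
    have := conj_mem_conjIdeal (σ := σ) h'
    rw [map_mul, map_mul, map_mul, cc, cR, conjIdeal_conjIdeal hK hσ, mul_comm (σ (L i j))] at this
    exact cast this (by ring)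
  have g01 : L 0 0 * σ (L 0 1) ∈ R * weight J 0 0 * conjIdeal σ (weight J 0 1) := by
    simpa [weight] using ab
  have g02 : L 0 0 * σ (L 1 0) ∈ R * weight J 0 0 * conjIdeal σ (weight J 1 0) := by
    simpa [weight, map_inv₀] using ac
  have g03 : L 0 0 * σ (L 1 1) ∈ R * weight J 0 0 * conjIdeal σ (weight J 1 1) := by
    simpa [weight] using ad
  have g12 : L 0 1 * σ (L 1 0) ∈ R * weight J 0 1 * conjIdeal σ (weight J 1 0) := by
    simpa [weight, map_inv₀] using bc
  have g13 : L 0 1 * σ (L 1 1) ∈ R * weight J 0 1 * conjIdeal σ (weight J 1 1) := by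
    simpa [weight] using bd
  have g23 : L 1 0 * σ (L 1 1) ∈ R * weight J 1 0 * conjIdeal σ (weight J 1 1) := by
    simpa [weight] using cd
  have g00 : L 0 0 * σ (L 0 0) ∈ R * weight J 0 0 * conjIdeal σ (weight J 0 0) := by
    simpa [weight] using a00
  have g33 : L 1 1 * σ (L 1 1) ∈ R * weight J 1 1 * conjIdeal σ (weight J 1 1) := by
    simpa [weight] using dd
  intro i j k l
  fin_cases i <;> fin_cases j <;> fin_cases k <;> fin_cases l
  · exact g00
  · exact g01
  · exact g02
  · exact g03
  · exact symm _ _ _ _ g01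
  · simpa [weight, mul_assoc] using bb
  · exact g12
  · exact g13
  · exact symm _ _ _ _ g02
  · exact symm _ _ _ _ g12
  · simpa [weight, map_inv₀] using cc'
  · exact g23
  · exact symm _ _ _ _ g03
  · exact symm _ _ _ _ g13
  · exact symm _ _ _ _ g23
  · exact g33

end Lattice

/-! ### The lattice basis Ĝ H_N and the Gram matrix T. -/

section LatticeBasis

/-- The matrix `Ĝ H_N` over an arbitrary commutative ring. -/
def latticeBasis {R : Type*} [CommRing R] (N u v u' v' : R) : Matrix (Fin 4) (Fin 4) R :=
  !![N, 0, 0, 0; 0, u, v, 0; 0, u', v', 0; 0, 0, 0, 1]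

theorem det_latticeBasis {R : Type*} [CommRing R] (N u v u' v' : R) :
    (latticeBasis N u v u' v').det = N * (u * v' - v * u') := by
  simp [latticeBasis, Matrix.det_succ_row_zero, Fin.sum_univ_succ, Fin.succAbove, Matrix.submatrix]
  ring

/-- Scaling the first basis vector by N makes the hyperbolic plane contribute N as well, so the
factor N comes out of the whole form. -/
theorem latticeBasis_transpose_mul {R : Type*} [CommRing R] (N u v u' v' : R)
    (T : Matrix (Fin 2) (Fin 2) ℤ)
    (hT : N • T.map (Int.cast : ℤ → R) = !![2 * u * u', u * v' + u' * v; u * v' + u' * v, 2 * v * v']) :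
    (latticeBasis N u v u' v').transpose * antidiag R * latticeBasis N u v u' v' =
      N • (addHyperbolic 1 T).map (Int.cast : ℤ → R) := by
  have e := fun i j => congrFun (congrFun hT i) j
  have e00 := e 0 0; have e01 := e 0 1; have e10 := e 1 0; have e11 := e 1 1
  simp at e00 e01 e10 e11
  ext i j
  fin_cases i <;> fin_cases j <;>
    simp [latticeBasis, antidiag, addHyperbolic, Matrix.mul_apply, Fin.sum_univ_succ, e00, e01, e10,
      e11] <;> ring

variable {K : Type*} [Field K] [NumberField K] {σ : K ≃ₐ[ℚ] K}
  {J : FractionalIdeal (𝓞 K)⁰ K} {u v : K} {N : ℕ}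

/-- `(u, v)` is a `ℤ`-basis of `J`, and `J J'` is generated by `N`. -/
structure IsNormBasis (σ : K ≃ₐ[ℚ] K) (J : FractionalIdeal (𝓞 K)⁰ K) (N : ℕ) (u v : K) : Prop where
  mem_iff : ∀ x, x ∈ J ↔ ∃ m n : ℤ, x = m * u + n * v
  indep : ∀ m n : ℤ, (m : K) * u + n * v = 0 → m = 0 ∧ n = 0
  pos : N ≠ 0
  mul_conj : J * conjIdeal σ J = spanSingleton (𝓞 K)⁰ (N : K)

theorem IsNormBasis.left_mem (h : IsNormBasis σ J N u v) : u ∈ J :=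
  (h.mem_iff u).2 ⟨1, 0, by simp⟩

theorem IsNormBasis.right_mem (h : IsNormBasis σ J N u v) : v ∈ J :=
  (h.mem_iff v).2 ⟨0, 1, by simp⟩

theorem IsNormBasis.cast_ne_zero (h : IsNormBasis σ J N u v) : (N : K) ≠ 0 :=
  Nat.cast_ne_zero.2 h.pos

theorem IsNormBasis.ne_zero (h : IsNormBasis σ J N u v) : J ≠ 0 := by
  rintro rfl
  have := h.mul_conj
  rw [zero_mul] at this
  exact h.cast_ne_zero (spanSingleton_eq_zero_iff.1 this.symm)

/-- If this vanished, u/v would be fixed by conjugation, hence rational, contradicting linear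
independence over ℤ. -/
theorem IsNormBasis.disc_ne_zero (hK : Module.finrank ℚ K = 2) (hσ : σ ≠ AlgEquiv.refl)
    (h : IsNormBasis σ J N u v) : u * σ v - v * σ u ≠ 0 := by
  intro h0
  have hv : v ≠ 0 := by
    rintro rfl
    exact one_ne_zero (h.indep 0 1 (by simp)).2
  have hv' : σ v ≠ 0 := by simpa using hv
  obtain ⟨q, hq⟩ := exists_rat_of_conj_eq hK hσ (x := u / v) (by
    rw [map_div₀, div_eq_div_iff hv' hv]; linear_combination -h0)
  have hd : (q.den : K) ≠ 0 := Nat.cast_ne_zero.2 q.den_ne_zero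
  have hq2 : (q : K) * q.den = q.num := by
    have := q.mul_den_eq_num
    exact_mod_cast congrArg (fun x : ℚ => (x : K)) this
  rw [eq_div_iff hv] at hq
  have := (h.indep q.den (-q.num) (by
    push_cast; rw [← hq2, ← hq]; ring)).1
  exact q.den_ne_zero (by exact_mod_cast this)

theorem IsNormBasis.det_ne_zero (hK : Module.finrank ℚ K = 2) (hσ : σ ≠ AlgEquiv.refl)
    (h : IsNormBasis σ J N u v) : (latticeBasis (N : K) u v (σ u) (σ v)).det ≠ 0 := by
  rw [det_latticeBasis]
  exact mul_ne_zero h.cast_ne_zero (h.disc_ne_zero hK hσ)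

theorem latticeBasis_mulVec {R : Type*} [CommRing R] (N u v u' v' : R) (x : Fin 4 → R) :
    (latticeBasis N u v u' v').mulVec x =
      ![N * x 0, u * x 1 + v * x 2, u' * x 1 + v' * x 2, x 3] := by
  ext i
  fin_cases i <;> simp [latticeBasis, Matrix.mulVec, dotProduct, Fin.sum_univ_succ]

theorem IsNormBasis.exists_int (hK : Module.finrank ℚ K = 2) (hσ : σ ≠ AlgEquiv.refl)
    (h : IsNormBasis σ J N u v) {x : K} (hx : x ∈ J * conjIdeal σ J) (hx' : σ x = x) :
    ∃ n : ℤ, x = N * n := by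
  rw [h.mul_conj, mem_spanSingleton_iff_div h.cast_ne_zero] at hx
  obtain ⟨n, hn⟩ := exists_int_of_mem_one hK hσ (by rw [map_div₀, hx', map_natCast]) hx
  exact ⟨n, by rw [hn]; have := h.cast_ne_zero; field_simp⟩

theorem IsNormBasis.mul_intCast_mem (h : IsNormBasis σ J N u v) (n : ℤ) :
    (N : K) * n ∈ J * conjIdeal σ J := by
  rw [h.mul_conj, mem_spanSingleton_iff_div h.cast_ne_zero, mul_div_cancel_left₀ _ h.cast_ne_zero]
  exact intCast_mem_one n

/-- Conjugation-fixed elements of J J' = (N) and of 𝓞 are integers times N and integers, so the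
ideal-theoretic lattice is the ℤ-span of the columns. -/
theorem IsNormBasis.isLatticeVector_iff (hK : Module.finrank ℚ K = 2) (hσ : σ ≠ AlgEquiv.refl)
    (h : IsNormBasis σ J N u v) {x : Fin 4 → K} :
    IsLatticeVector σ J x ↔ ∃ z : Fin 4 → ℤ,
      x = (latticeBasis (N : K) u v (σ u) (σ v)).mulVec fun i => (z i : K) := by
  constructor
  · rintro ⟨h0, s0, h1, h2, h3, s3⟩
    obtain ⟨a, ha⟩ := h.exists_int hK hσ h0 s0
    obtain ⟨m, n, hmn⟩ := (h.mem_iff _).1 h1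
    obtain ⟨b, hb⟩ := exists_int_of_mem_one hK hσ s3 h3
    refine ⟨![a, m, n, b], ?_⟩
    rw [latticeBasis_mulVec]
    ext i
    fin_cases i
    · exact ha
    · simp [hmn]; ring
    · simp [h2, hmn]; ring
    · exact hb.symm
  · rintro ⟨z, rfl⟩
    rw [latticeBasis_mulVec]
    refine ⟨h.mul_intCast_mem _, by simp, (h.mem_iff _).2 ⟨z 1, z 2, ?_⟩, by simp,
      intCast_mem_one _, by simp⟩
    simp; ring

/-- Lattice-preserving operators are given by integral matrices. -/
theorem IsNormBasis.exists_intMatrix (hK : Module.finrank ℚ K = 2) (hσ : σ ≠ AlgEquiv.refl)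
    (h : IsNormBasis σ J N u v) {W : Matrix (Fin 4) (Fin 4) K}
    (hW : ∀ x, IsLatticeVector σ J x → IsLatticeVector σ J (W.mulVec x)) :
    ∃ U : Matrix (Fin 4) (Fin 4) ℤ, W * latticeBasis (N : K) u v (σ u) (σ v) =
      latticeBasis (N : K) u v (σ u) (σ v) * U.map (Int.cast : ℤ → K) := by
  set Q := latticeBasis (N : K) u v (σ u) (σ v) with hQ
  have h1 : ∀ j, ∃ z : Fin 4 → ℤ, W.mulVec (Q.mulVec (Pi.single j 1)) = Q.mulVec fun i => (z i : K) := by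
    intro j
    apply (h.isLatticeVector_iff hK hσ).1
    apply hW
    refine (h.isLatticeVector_iff hK hσ).2 ⟨Pi.single j 1, ?_⟩
    congr 1
    ext i
    rcases eq_or_ne i j with rfl | hij
    · simp
    · simp [Pi.single_eq_of_ne hij]
  choose z hz using h1
  refine ⟨Matrix.of fun i j => z j i, ?_⟩
  ext i j
  have := congrFun (hz j) i
  rw [Matrix.mulVec_mulVec] at this
  have e : (Q * (Matrix.of fun i j => z j i).map (Int.cast : ℤ → K)) i j =
      Q.mulVec (fun i => (z j i : K)) i := by
    simp [Matrix.mul_apply, Matrix.mulVec, dotProduct]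
  rw [e, ← this]
  simp [Matrix.mulVec_single]

theorem IsNormBasis.isLatticeVector_mulVec (hK : Module.finrank ℚ K = 2) (hσ : σ ≠ AlgEquiv.refl)
    (h : IsNormBasis σ J N u v) {W : Matrix (Fin 4) (Fin 4) K} {U : Matrix (Fin 4) (Fin 4) ℤ}
    (hU : W * latticeBasis (N : K) u v (σ u) (σ v) =
      latticeBasis (N : K) u v (σ u) (σ v) * U.map (Int.cast : ℤ → K)) {x : Fin 4 → K}
    (hx : IsLatticeVector σ J x) : IsLatticeVector σ J (W.mulVec x) := by
  obtain ⟨z, rfl⟩ := (h.isLatticeVector_iff hK hσ).1 hx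
  refine (h.isLatticeVector_iff hK hσ).2 ⟨U.mulVec z, ?_⟩
  rw [Matrix.mulVec_mulVec, hU, ← Matrix.mulVec_mulVec]
  congr 1
  ext i
  simp [Matrix.mulVec, dotProduct]

/-- The normalised Gram matrix of a basis of an ideal is integral, even and non-degenerate. -/
theorem IsNormBasis.exists_gram (hK : Module.finrank ℚ K = 2) (hσ : σ ≠ AlgEquiv.refl)
    (h : IsNormBasis σ J N u v) :
    ∃ T : Matrix (Fin 2) (Fin 2) ℤ, (N : K) • T.map (Int.cast : ℤ → K) =
        !![2 * u * σ u, u * σ v + σ u * v; u * σ v + σ u * v, 2 * v * σ v] ∧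
      T.IsSymm ∧ T.det ≠ 0 ∧ ∀ i, Even (T i i) := by
  have cc := conj_conj hK hσ
  obtain ⟨a, ha⟩ := h.exists_int hK hσ (mul_conj_mem h.left_mem h.left_mem)
    (by rw [map_mul, cc, mul_comm])
  obtain ⟨c, hc⟩ := h.exists_int hK hσ (mul_conj_mem h.right_mem h.right_mem)
    (by rw [map_mul, cc, mul_comm])
  obtain ⟨b, hb⟩ := h.exists_int hK hσ (x := u * σ v + v * σ u)
    (add_mem' (mul_conj_mem h.left_mem h.right_mem) (mul_conj_mem h.right_mem h.left_mem))
    (by simp [cc]; ring)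
  refine ⟨!![2 * a, b; b, 2 * c], ?_, ?_, ?_, ?_⟩
  · ext i j
    fin_cases i <;> fin_cases j <;> simp
    · linear_combination -2 * ha
    · linear_combination -hb
    · linear_combination -hb
    · linear_combination -2 * hc
  · ext i j
    fin_cases i <;> fin_cases j <;> rfl
  · intro h0
    rw [Matrix.det_fin_two] at h0
    simp at h0
    have h1 : (2 * a * (2 * c) - b * b : K) = 0 := by exact_mod_cast congrArg (Int.cast : ℤ → K) h0
    apply h.disc_ne_zero hK hσ
    rw [← sq_eq_zero_iff]
    -- (uv' - vu')² = (uv' + vu')² - 4uu'vv' = N²(b² - 4ac) = -N² det T.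
    linear_combination -(N : K) ^ 2 * h1 + (u * σ v + v * σ u + N * b) * hb
      - 4 * (v * σ v) * ha - 4 * N * a * hc
  · intro i
    fin_cases i <;> simp

end LatticeBasis

/-! ### The dual lattice and the discriminant action. -/

section Dual
variable {K : Type*} [Field K] [NumberField K] {σ : K ≃ₐ[ℚ] K}
  {J : FractionalIdeal (𝓞 K)⁰ K} {u v r x : K} {N : ℕ} {L : Matrix (Fin 2) (Fin 2) K}
  {T : Matrix (Fin 2) (Fin 2) ℤ}

/-- The dual of `J` with respect to the trace form `tr (x y') / N`. -/
def IsDual (σ : K ≃ₐ[ℚ] K) (J : FractionalIdeal (𝓞 K)⁰ K) (x : K) : Prop :=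
  ∀ y ∈ J, x * σ y + σ x * y ∈ J * conjIdeal σ J

/-- Pairing x with s'y and subtracting s' times the pairing of x with y leaves (s - s') x y' ∈ J J',
and J' cancels. -/
theorem IsDual.sub_conj_mul_mem (hK : Module.finrank ℚ K = 2) (hσ : σ ≠ AlgEquiv.refl)
    (hJ : J ≠ 0) (hx : IsDual σ J x) {s : K} (hs : s ∈ (1 : FractionalIdeal (𝓞 K)⁰ K)) :
    (s - σ s) * x ∈ J := by
  have hJ' : conjIdeal σ J ≠ 0 := (map_ne_zero_iff _ (conjIdeal σ).injective).2 hJ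
  have h : (s - σ s) * x ∈ J * conjIdeal σ J * (conjIdeal σ J)⁻¹ := by
    refine mem_mul_inv_of_forall hJ' fun w hw => ?_
    obtain ⟨y, hy, rfl⟩ := exists_of_mem_conjIdeal hw
    have h1 := hx _ (show σ s * y ∈ J by
      have := mul_mem_mul (conj_mem_one (σ := σ) hs) hy; rwa [one_mul] at this)
    have h2 : σ s * (x * σ y + σ x * y) ∈ J * conjIdeal σ J := by
      have := mul_mem_mul (conj_mem_one (σ := σ) hs) (hx y hy); rwa [one_mul] at this
    have h3 := sub_mem' h1 h2
    rw [map_mul, conj_conj hK hσ] at h3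
    convert! h3 using 1
    ring
  rwa [mul_assoc, mul_inv_cancel₀ hJ', mul_one] at h

theorem IsDual.add_conj_mem_of_mem_conjIdeal (hK : Module.finrank ℚ K = 2)
    (hσ : σ ≠ AlgEquiv.refl) (hx : IsDual σ J x) {w : K} (hw : w ∈ conjIdeal σ J) :
    w * x + σ w * σ x ∈ J * conjIdeal σ J := by
  obtain ⟨y, hy, rfl⟩ := exists_of_mem_conjIdeal hw
  rw [conj_conj hK hσ, mul_comm (σ y), mul_comm y]
  exact hx y hy

theorem IsDual.add_conj_mem_of_mem_inv (hK : Module.finrank ℚ K = 2)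
    (hσ : σ ≠ AlgEquiv.refl) (h : IsNormBasis σ J N u v) (hx : IsDual σ J x) {w : K}
    (hw : w ∈ J⁻¹) : w * x + σ w * σ x ∈ (1 : FractionalIdeal (𝓞 K)⁰ K) := by
  have h1 : (N : K) * w ∈ conjIdeal σ J := by
    have := mul_mem_mul (mem_spanSingleton_self (𝓞 K)⁰ (N : K)) hw
    rwa [← h.mul_conj, mul_comm J, mul_assoc, mul_inv_cancel₀ h.ne_zero, mul_one] at this
  have h2 := hx.add_conj_mem_of_mem_conjIdeal hK hσ h1
  rw [h.mul_conj, mem_spanSingleton_iff_div h.cast_ne_zero, map_mul, map_natCast] at h2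
  have := h.cast_ne_zero
  rwa [show (N * w * x + N * σ w * σ x) / (N : K) = w * x + σ w * σ x by field_simp] at h2

/-- The action on the dual lattice modulo the lattice, multiplied by an element of the content. -/
theorem PairwiseIntegral.dual_congr (hK : Module.finrank ℚ K = 2) (hσ : σ ≠ AlgEquiv.refl)
    {I : Ideal (𝓞 K)} (hI : I ≠ ⊥) (hB : IsNormBasis σ (I : FractionalIdeal (𝓞 K)⁰ K) N u v)
    (hr : σ r = r) (hr0 : r ≠ 0) (h : PairwiseIntegral σ I L r) {t : K}
    (ht : t ∈ contentIdeal I L) (hx : IsDual σ (I : FractionalIdeal (𝓞 K)⁰ K) x) :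
    t * (L 0 0 * σ (L 1 1) * x + L 0 1 * σ (L 1 0) * σ x) - L.det * σ t * x ∈
      spanSingleton (𝓞 K)⁰ r * (contentIdeal I L * (I : FractionalIdeal (𝓞 K)⁰ K)) := by
  have hJ := hB.ne_zero
  have mem := (contentIdeal_le_iff_weight hI).1 (le_refl (contentIdeal I L))
  have hle := h.content_le hK hσ hI hr
  have cc := conj_conj hK hσ
  set J := (I : FractionalIdeal (𝓞 K)⁰ K)
  set A := contentIdeal I L
  have a : L 0 0 ∈ A := by simpa [weight] using mem 0 0
  have b : L 0 1 ∈ A * J := by simpa [weight] using mem 0 1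
  have c : L 1 0 ∈ A * J⁻¹ := by simpa [weight] using mem 1 0
  have d : L 1 1 ∈ A := by simpa [weight] using mem 1 1
  -- The difference equals α(tδ' - t'δ)x + β(t'γx + tγ'x'). After division by r, the first term is α
  -- (s - s') x with s integral, and the second is β times the trace of x against an element of J⁻¹.
  have h1 : r⁻¹ * (t * σ (L 1 1)) ∈ (1 : FractionalIdeal (𝓞 K)⁰ K) := by
    rw [inv_mul_mem_iff hr0, mul_one]
    exact hle (HilbertModular.mul_conj_mem ht d)
  have h2 : r⁻¹ * (σ t * L 1 0) ∈ J⁻¹ := by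
    rw [inv_mul_mem_iff hr0]
    have h3 : σ t * L 1 0 ∈ (A * conjIdeal σ A) * J⁻¹ := by
      have := mul_mem_mul c (conj_mem_conjIdeal (σ := σ) ht)
      rwa [mul_comm (L 1 0), mul_right_comm] at this
    exact (mul_le_mul_left hle _) h3
  have h3 := mul_mem_mul a (hx.sub_conj_mul_mem hK hσ hJ h1)
  have h4 := mul_mem_mul b (hx.add_conj_mem_of_mem_inv hK hσ hB h2)
  rw [mul_one] at h4
  have h5 := mul_mem_mul (mem_spanSingleton_self (𝓞 K)⁰ r) (add_mem' h3 h4)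
  convert! h5 using 1
  simp only [map_mul, map_inv₀, hr, cc, Matrix.det_fin_two]
  field_simp
  ring

/-- Only the middle coordinate carries a genuine congruence: the outer ones are traces of x against
elements of J' and J⁻¹, integral by duality. -/
theorem PairwiseIntegral.dual_apply (hK : Module.finrank ℚ K = 2) (hσ : σ ≠ AlgEquiv.refl)
    (hB : IsNormBasis σ J N u v) (hr : σ r = r) (hr0 : r ≠ 0) (h : PairwiseIntegral σ J L r)
    (hx : IsDual σ J x) (h1 : r⁻¹ * (L 0 0 * σ (L 1 1) * x + L 0 1 * σ (L 1 0) * σ x) - x ∈ J) :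
    IsLatticeVector σ J
      (r⁻¹ • (omegaMatrix L (L.map σ)).mulVec ![0, x, σ x, 0] - ![0, x, σ x, 0]) := by
  have cc := conj_conj hK hσ
  rw [omegaMatrix_conj_mulVec]
  have hab : r⁻¹ * (L 0 0 * σ (L 0 1)) ∈ conjIdeal σ J := by
    rw [inv_mul_mem_iff hr0]; simpa [weight] using h 0 0 0 1
  have hcd : r⁻¹ * (L 1 0 * σ (L 1 1)) ∈ J⁻¹ := by
    rw [inv_mul_mem_iff hr0]; simpa [weight] using h 1 0 1 1
  refine ⟨?_, ?_, ?_, ?_, ?_, ?_⟩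
  · have := neg_mem' (hx.add_conj_mem_of_mem_conjIdeal hK hσ hab)
    convert! this using 1
    simp [hr, cc]; ring
  · simp [hr, cc]; left; ring
  · simpa using h1
  · simp [hr, cc]; left; ring
  · have := hx.add_conj_mem_of_mem_inv hK hσ hB hcd
    convert! this using 1
    simp [hr, cc]; ring
  · simp [hr, cc]; left; ring

theorem addHyperbolic_mulVec {R : Type*} [CommRing R] (T : Matrix (Fin 2) (Fin 2) ℤ)
    (x : Fin 4 → R) : ((addHyperbolic 1 T).map (Int.cast : ℤ → R)).mulVec x =
      ![x 3, T 0 0 * x 1 + T 0 1 * x 2, T 1 0 * x 1 + T 1 1 * x 2, x 0] := by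
  ext i
  fin_cases i <;> simp [addHyperbolic, Matrix.mulVec, dotProduct, Fin.sum_univ_succ]

theorem map_intCast_mulVec {m n R : Type*} [Fintype n] [CommRing R] (X : Matrix m n ℤ) (z : n → ℤ) :
    (X.map (Int.cast : ℤ → R)).mulVec (fun i => (z i : R)) = fun i => ((X.mulVec z i : ℤ) : R) := by
  ext i
  simp [Matrix.mulVec, dotProduct]

theorem map_intCast_mul {m n p R : Type*} [Fintype n] [CommRing R] (X : Matrix m n ℤ)
    (Y : Matrix n p ℤ) : (X * Y).map (Int.cast : ℤ → R) =
      X.map (Int.cast : ℤ → R) * Y.map (Int.cast : ℤ → R) :=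
  Matrix.map_mul (f := Int.castRingHom R)

/-- Elements of the discriminant kernel act trivially on the dual lattice modulo the lattice. -/
theorem IsNormBasis.sub_isLatticeVector_of_isDual (hK : Module.finrank ℚ K = 2)
    (hσ : σ ≠ AlgEquiv.refl) (h : IsNormBasis σ J N u v)
    (hT : (N : K) • T.map (Int.cast : ℤ → K) =
        !![2 * u * σ u, u * σ v + σ u * v; u * σ v + σ u * v, 2 * v * σ v])
    {W : Matrix (Fin 4) (Fin 4) K} {X : Matrix (Fin 4) (Fin 4) ℤ}
    (hU : W * latticeBasis (N : K) u v (σ u) (σ v) = latticeBasis (N : K) u v (σ u) (σ v) *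
      (1 + X * addHyperbolic 1 T).map (Int.cast : ℤ → K)) (hx : IsDual σ J x) :
    IsLatticeVector σ J (W.mulVec ![0, x, σ x, 0] - ![0, x, σ x, 0]) := by
  have cc := conj_conj hK hσ
  have hd := h.disc_ne_zero hK hσ
  have e := fun i j => congrFun (congrFun hT i) j
  have e00 := e 0 0; have e01 := e 0 1; have e10 := e 1 0; have e11 := e 1 1
  simp at e00 e01 e10 e11
  obtain ⟨a, ha⟩ := h.exists_int hK hσ (hx u h.left_mem) (by simp [cc]; ring)
  obtain ⟨b, hb⟩ := h.exists_int hK hσ (hx v h.right_mem) (by simp [cc]; ring)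
  set p := (x * σ v - v * σ x) / (u * σ v - v * σ u) with hp
  set q := (u * σ x - x * σ u) / (u * σ v - v * σ u) with hq
  have h1 : u * p + v * q = x := by
    rw [hp, hq, mul_div_assoc', mul_div_assoc', ← add_div, div_eq_iff hd]; ring
  have h2 : σ u * p + σ v * q = σ x := by
    rw [hp, hq, mul_div_assoc', mul_div_assoc', ← add_div, div_eq_iff hd]; ring
  have hQy : ![0, x, σ x, 0] = (latticeBasis (N : K) u v (σ u) (σ v)).mulVec ![0, p, q, 0] := by
    rw [latticeBasis_mulVec]
    ext i
    fin_cases i <;> simp [h1, h2]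
  have ha' : T 0 0 * p + T 0 1 * q = a := by
    apply mul_left_cancel₀ h.cast_ne_zero
    linear_combination p * e00 + q * e01 + σ u * h1 + u * h2 + ha
  have hb' : T 1 0 * p + T 1 1 * q = b := by
    apply mul_left_cancel₀ h.cast_ne_zero
    linear_combination p * e10 + q * e11 + σ v * h1 + v * h2 + hb
  have hTy : ((addHyperbolic 1 T).map (Int.cast : ℤ → K)).mulVec ![0, p, q, 0] =
      fun i => (((![0, a, b, 0] : Fin 4 → ℤ) i : ℤ) : K) := by
    rw [addHyperbolic_mulVec]
    ext i
    fin_cases i <;> simp [ha', hb']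
  refine (h.isLatticeVector_iff hK hσ).2 ⟨X.mulVec ![0, a, b, 0], ?_⟩
  have h3 : (1 + X * addHyperbolic 1 T).map (Int.cast : ℤ → K) =
      1 + X.map (Int.cast : ℤ → K) * (addHyperbolic 1 T).map (Int.cast : ℤ → K) := by
    rw [← map_intCast_mul, Matrix.map_add _ Int.cast_add, Matrix.map_one _ Int.cast_zero Int.cast_one]
  rw [hQy, Matrix.mulVec_mulVec, hU, h3, mul_add, mul_one, Matrix.add_mulVec, add_sub_cancel_left,
    ← Matrix.mulVec_mulVec, ← Matrix.mulVec_mulVec, hTy, map_intCast_mulVec]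

/-- The required matrix is (U - 1) T₁⁻¹, and the columns of T₁⁻¹ span the dual lattice. Its
hyperbolic part is already integral, so only dual vectors with outer coordinates 0 need the
hypothesis. -/
theorem IsNormBasis.exists_eq_one_add_mul (hK : Module.finrank ℚ K = 2)
    (hσ : σ ≠ AlgEquiv.refl) (h : IsNormBasis σ J N u v)
    (hT : (N : K) • T.map (Int.cast : ℤ → K) =
        !![2 * u * σ u, u * σ v + σ u * v; u * σ v + σ u * v, 2 * v * σ v]) (hdet : T.det ≠ 0)
    {W : Matrix (Fin 4) (Fin 4) K} {U : Matrix (Fin 4) (Fin 4) ℤ}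
    (hU : W * latticeBasis (N : K) u v (σ u) (σ v) = latticeBasis (N : K) u v (σ u) (σ v) *
      U.map (Int.cast : ℤ → K))
    (hW : ∀ x, IsDual σ J x →
      IsLatticeVector σ J (W.mulVec ![0, x, σ x, 0] - ![0, x, σ x, 0])) :
    ∃ X : Matrix (Fin 4) (Fin 4) ℤ, U = 1 + X * addHyperbolic 1 T := by
  have cc := conj_conj hK hσ
  have e := fun i j => congrFun (congrFun hT i) j
  have e00 := e 0 0; have e01 := e 0 1; have e10 := e 1 0; have e11 := e 1 1
  simp at e00 e01 e10 e11
  set Q := latticeBasis (N : K) u v (σ u) (σ v) with hQ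
  have hQdet : IsUnit Q.det := (h.det_ne_zero hK hσ).isUnit
  have hdK : (T 0 0 : K) * T 1 1 - T 0 1 * T 1 0 ≠ 0 := by
    rw [Matrix.det_fin_two] at hdet
    exact_mod_cast hdet
  -- solve `U y - y = z` for `y` in the dual lattice
  have key : ∀ w : Fin 4 → ℤ, ∃ y : Fin 4 → K, ∃ z : Fin 4 → ℤ,
      ((addHyperbolic 1 T).map (Int.cast : ℤ → K)).mulVec y = (fun i => (w i : K)) ∧
      (U.map (Int.cast : ℤ → K)).mulVec y - y = fun i => (z i : K) := by
    intro w
    set p : K := (T 1 1 * w 1 - T 0 1 * w 2) / (T 0 0 * T 1 1 - T 0 1 * T 1 0) with hp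
    set q : K := (T 0 0 * w 2 - T 1 0 * w 1) / (T 0 0 * T 1 1 - T 0 1 * T 1 0) with hq
    have h1 : T 0 0 * p + T 0 1 * q = w 1 := by
      rw [hp, hq, mul_div_assoc', mul_div_assoc', ← add_div, div_eq_iff hdK]; ring
    have h2 : T 1 0 * p + T 1 1 * q = w 2 := by
      rw [hp, hq, mul_div_assoc', mul_div_assoc', ← add_div, div_eq_iff hdK]; ring
    have sp : σ p = p := by simp [hp]
    have sq : σ q = q := by simp [hq]
    have hx : IsDual σ J (u * p + v * q) := by
      intro t ht
      obtain ⟨m, n, rfl⟩ := (h.mem_iff t).1 ht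
      convert! h.mul_intCast_mem (m * w 1 + n * w 2) using 1
      simp only [map_add, map_mul, sp, sq, map_intCast]
      push_cast
      rw [← h1, ← h2]
      linear_combination -(m * p) * e00 - m * q * e01 - n * p * e10 - n * q * e11
    obtain ⟨z, hz⟩ := (h.isLatticeVector_iff hK hσ).1 (hW _ hx)
    have hz' : (U.map (Int.cast : ℤ → K)).mulVec ![0, p, q, 0] - ![0, p, q, 0] =
        fun i => (z i : K) := by
      apply Matrix.mulVec_injective_of_isUnit ((Matrix.isUnit_iff_isUnit_det _).2 hQdet)
      change Q.mulVec _ = Q.mulVec _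
      have : ![0, u * p + v * q, σ (u * p + v * q), 0] = Q.mulVec ![0, p, q, 0] := by
        rw [hQ, latticeBasis_mulVec]
        ext i
        fin_cases i <;> simp [sp, sq]
      rw [← hz, this, Matrix.mulVec_mulVec, hU, ← Matrix.mulVec_mulVec, Matrix.mulVec_sub]
    -- The hyperbolic plane swaps the outer coordinates, whence w 3 comes first and w 0 last.
    refine ⟨![w 3, p, q, w 0], fun i => w 3 * (U i 0 - (1 : Matrix (Fin 4) (Fin 4) ℤ) i 0) +
      w 0 * (U i 3 - (1 : Matrix (Fin 4) (Fin 4) ℤ) i 3) + z i, ?_, ?_⟩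
    · rw [addHyperbolic_mulVec]
      ext i
      fin_cases i <;> simp [h1, h2]
    · ext i
      have := congrFun hz' i
      have hone : ((![w 3, p, q, w 0] : Fin 4 → K) i) =
          w 3 * ((1 : Matrix (Fin 4) (Fin 4) ℤ) i 0 : ℤ) +
            w 0 * ((1 : Matrix (Fin 4) (Fin 4) ℤ) i 3 : ℤ) + (![0, p, q, 0] : Fin 4 → K) i := by
        fin_cases i <;> simp [Matrix.one_apply]
      rw [Pi.sub_apply, hone]
      push_cast
      rw [← this]
      simp [Matrix.mulVec, dotProduct, Fin.sum_univ_succ]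
      ring
  choose y z hy hz using fun j : Fin 4 => key (Pi.single j 1)
  refine ⟨Matrix.of fun i j => z j i, ?_⟩
  set X : Matrix (Fin 4) (Fin 4) ℤ := Matrix.of fun i j => z j i
  set Y : Matrix (Fin 4) (Fin 4) K := Matrix.of fun i j => y j i
  set TK := (addHyperbolic 1 T).map (Int.cast : ℤ → K)
  have hTY : TK * Y = 1 := by
    ext i j
    have := congrFun (hy j) i
    rw [show (TK * Y) i j = TK.mulVec (y j) i from rfl, this]
    rcases eq_or_ne i j with rfl | hij
    · simp
    · simp [hij]
  have hUY : U.map (Int.cast : ℤ → K) * Y - Y = X.map (Int.cast : ℤ → K) := by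
    ext i j
    exact congrFun (hz j) i
  have hYT : Y * TK = 1 := mul_eq_one_comm.1 hTY
  have hfin : U.map (Int.cast : ℤ → K) = (1 + X * addHyperbolic 1 T).map (Int.cast : ℤ → K) := by
    have h1 : (1 + X * addHyperbolic 1 T).map (Int.cast : ℤ → K) =
        1 + X.map (Int.cast : ℤ → K) * TK := by
      rw [← map_intCast_mul, Matrix.map_add _ Int.cast_add,
        Matrix.map_one _ Int.cast_zero Int.cast_one]
    rw [h1, ← hUY, sub_mul, Matrix.mul_assoc, hYT, mul_one]
    abel
  ext i j
  exact Int.cast_injective (α := K) (congrFun (congrFun hfin i) j)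

end Dual

/-! ### Principal content for elements of the discriminant kernel. -/

section Kernel
variable {K : Type*} [Field K] [NumberField K] {σ : K ≃ₐ[ℚ] K}

/-- A group of elements whose multiples by some `c ≠ 0` are integers is cyclic. -/
theorem exists_generator (S : AddSubgroup K) {c : K} (hc : c ≠ 0)
    (h : ∀ y ∈ S, ∃ n : ℤ, y * c = n) : ∃ g ∈ S, ∀ y ∈ S, ∃ n : ℤ, y = n * g := by
  let D : AddSubgroup ℤ := S.comap ((AddMonoidHom.mulRight c⁻¹).comp (Int.castAddHom K))
  obtain ⟨a, ha⟩ := Int.subgroup_cyclic D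
  have haD : a ∈ D := by rw [ha]; exact AddSubgroup.mem_closure_singleton_self a
  refine ⟨a * c⁻¹, haD, fun y hy => ?_⟩
  obtain ⟨n, hn⟩ := h y hy
  have hnD : n ∈ D := by
    change (n : K) * c⁻¹ ∈ S
    rwa [← hn, mul_inv_cancel_right₀ hc]
  rw [ha, AddSubgroup.mem_closure_singleton] at hnD
  obtain ⟨m, hm⟩ := hnD
  refine ⟨m, ?_⟩
  rw [← mul_assoc, eq_mul_inv_iff_mul_eq₀ hc, hn, ← hm]
  simp

/-- A generator of the group of all `s - s'` with integral `s`. -/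
theorem exists_conj_sub_generator (hK : Module.finrank ℚ K = 2) (hσ : σ ≠ AlgEquiv.refl) :
    ∃ w ∈ (1 : FractionalIdeal (𝓞 K)⁰ K), w - σ w ≠ 0 ∧
      ∀ s ∈ (1 : FractionalIdeal (𝓞 K)⁰ K), ∃ n : ℤ, s - σ s = n * (w - σ w) := by
  have cc := conj_conj hK hσ
  obtain ⟨s, hs, hs'⟩ := exists_integral_ne_conj hσ
  have h0 : s - σ s ≠ 0 := sub_ne_zero.2 hs'
  let S : AddSubgroup K := (1 : FractionalIdeal (𝓞 K)⁰ K).1.toAddSubgroup.map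
    (AddMonoidHom.id K - (σ : K →+ K))
  have hS : ∀ y, y ∈ S ↔ ∃ t ∈ (1 : FractionalIdeal (𝓞 K)⁰ K), t - σ t = y := fun y => Iff.rfl
  obtain ⟨g, hg, hgen⟩ := exists_generator S h0 (by
    intro y hy
    obtain ⟨t, ht, rfl⟩ := (hS y).1 hy
    -- A product of two such differences is integral and fixed by conjugation, hence an integer;
    -- this bounds the denominators of the group.
    have h1 : (t - σ t) * (s - σ s) ∈ (1 : FractionalIdeal (𝓞 K)⁰ K) := by
      have := mul_mem_mul (sub_mem' ht (conj_mem_one (σ := σ) ht))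
        (sub_mem' hs (conj_mem_one (σ := σ) hs))
      rwa [one_mul] at this
    obtain ⟨n, hn⟩ := exists_int_of_mem_one hK hσ (by simp [cc]; ring) h1
    exact ⟨n, hn.symm⟩)
  obtain ⟨w, hw, rfl⟩ := (hS g).1 hg
  refine ⟨w, hw, ?_, fun t ht => hgen _ ((hS _).2 ⟨t, ht, rfl⟩)⟩
  intro hw0
  obtain ⟨n, hn⟩ := hgen _ ((hS _).2 ⟨s, hs, rfl⟩)
  rw [hw0, mul_zero] at hn
  exact h0 hn

variable {u v r : K} {N : ℕ} {L : Matrix (Fin 2) (Fin 2) K} {I : Ideal (𝓞 K)}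

/-- If the operator attached to `L` acts trivially on the discriminant group, then the content
of `L` is principal, with a generator compatible with conjugation. -/
theorem PairwiseIntegral.exists_content_eq (hK : Module.finrank ℚ K = 2)
    (hσ : σ ≠ AlgEquiv.refl) (hI : I ≠ ⊥)
    (hB : IsNormBasis σ (I : FractionalIdeal (𝓞 K)⁰ K) N u v) (hr : σ r = r) (hr0 : r ≠ 0)
    (hdet : L.det * σ L.det = r ^ 2) (h : PairwiseIntegral σ I L r)
    (hW : ∀ x, IsDual σ (I : FractionalIdeal (𝓞 K)⁰ K) x →
      r⁻¹ * (L 0 0 * σ (L 1 1) * x + L 0 1 * σ (L 1 0) * σ x) - x ∈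
        (I : FractionalIdeal (𝓞 K)⁰ K)) :
    ∃ k : K, k ≠ 0 ∧ contentIdeal I L = spanSingleton (𝓞 K)⁰ k ∧ r * k = L.det * σ k := by
  have cc := conj_conj hK hσ
  have hJ := hB.ne_zero
  have hd : L.det ≠ 0 := left_ne_zero_of_mul (hdet.trans_ne (pow_ne_zero _ hr0))
  obtain ⟨w, hw, hw0, hgen⟩ := exists_conj_sub_generator hK hσ
  set A := contentIdeal I L with hA
  have hA0 : A ≠ 0 := by
    intro h0
    have := spanSingleton_det_le hI L
    rw [← hA, h0, sq, zero_mul, FractionalIdeal.le_zero_iff] at this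
    exact hd (spanSingleton_eq_zero_iff.1 this)
  -- the semilinear involution
  set e := r⁻¹ * L.det with he
  have hee : e * σ e = 1 := by
    rw [he, map_mul, map_inv₀, hr]
    field_simp
    exact hdet
  have hee' : ∀ x, e * (σ e * x) = x := fun x => by rw [← mul_assoc, hee, one_mul]
  -- the inverse of `w - σ w` times `J` is contained in the dual
  have hdual : ∀ y ∈ (I : FractionalIdeal (𝓞 K)⁰ K),
      IsDual σ (I : FractionalIdeal (𝓞 K)⁰ K) (y / (w - σ w)) := by
    intro y hy z hz
    have h1 := HilbertModular.mul_conj_mem (σ := σ) hy hz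
    rw [hB.mul_conj, mem_spanSingleton_iff_div hB.cast_ne_zero] at h1
    obtain ⟨n, hn⟩ := hgen _ h1
    convert! hB.mul_intCast_mem n using 1
    have hw1 : σ w - w ≠ 0 := by rw [← neg_sub]; exact neg_ne_zero.2 hw0
    have hN := hB.cast_ne_zero
    simp only [map_div₀, map_mul, cc, map_natCast, map_sub] at hn ⊢
    rw [← neg_sub w (σ w)]
    field_simp at hn ⊢
    linear_combination hn
  -- congruence
  have hcong : ∀ t ∈ A, (t - e * σ t) / (w - σ w) ∈ A := by
    intro t ht
    have h1 : (t - e * σ t) / (w - σ w) ∈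
        A * (I : FractionalIdeal (𝓞 K)⁰ K) * (I : FractionalIdeal (𝓞 K)⁰ K)⁻¹ := by
      -- For dual x, the general congruence and trivial action give t x ≡ e t' x modulo A J; take x
      -- = y/(w - w').
      refine mem_mul_inv_of_forall hJ fun y hy => ?_
      have h2 := (inv_mul_mem_iff hr0).2 (h.dual_congr hK hσ hI hB hr hr0 ht (hdual y hy))
      have h3 := mul_mem_mul ht (hW _ (hdual y hy))
      convert! sub_mem' h2 h3 using 1
      rw [he]
      ring
    rwa [mul_assoc, mul_inv_cancel₀ hJ, mul_one] at h1
  let S : AddSubgroup K :=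
    { carrier := {y | y ∈ A ∧ e * σ y = y}
      zero_mem' := ⟨zero_mem _, by simp⟩
      add_mem' := fun ha hb => ⟨add_mem' ha.1 hb.1, by rw [map_add, mul_add, ha.2, hb.2]⟩
      neg_mem' := fun ha => ⟨neg_mem' ha.1, by rw [map_neg, mul_neg, ha.2]⟩ }
  have hS : ∀ y, y ∈ S ↔ y ∈ A ∧ e * σ y = y := fun y => Iff.rfl
  -- a nonzero fixed vector
  obtain ⟨y0, hy0, hne⟩ : ∃ y ∈ S, y ≠ 0 := by
    by_contra! hall
    obtain ⟨t, ht, ht0⟩ : ∃ t ∈ A, t ≠ 0 := by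
      by_contra! hc
      exact hA0 (eq_zero_iff.2 hc)
    have fix : ∀ s ∈ A, s + e * σ s ∈ A → s + e * σ s = 0 := by
      intro s hs hm
      refine hall _ ((hS _).2 ⟨hm, ?_⟩)
      rw [map_add, map_mul, cc, mul_add, hee', add_comm]
    have hphi : ∀ s ∈ A, e * σ s ∈ A := by
      intro s hs
      have h1 := mul_mem_mul (sub_mem' hw (conj_mem_one (σ := σ) hw)) (hcong s hs)
      rw [one_mul, mul_div_cancel₀ _ hw0] at h1
      convert! sub_mem' hs h1 using 1
      ring
    have hmul : ∀ s ∈ A, (w - σ w) * s ∈ A := by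
      intro s hs
      have := mul_mem_mul (sub_mem' hw (conj_mem_one (σ := σ) hw)) hs
      rwa [one_mul] at this
    -- Without nonzero fixed vectors the involution would be -1 on A. But it is semilinear and w -
    -- w' changes sign under conjugation, so it would be both +1 and -1 on (w - w')t.
    have h1 := fix t ht (add_mem' ht (hphi t ht))
    have h2 := fix _ (hmul t ht) (add_mem' (hmul t ht) (hphi _ (hmul t ht)))
    rw [map_mul, map_sub, cc] at h2
    have h3 : 2 * ((w - σ w) * t) = 0 := by linear_combination h2 + (w - σ w) * h1
    exact (mul_ne_zero two_ne_zero (mul_ne_zero hw0 ht0)) h3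
  -- For fixed vectors y and y₀, y y₀'/r is integral and rational, so the fixed group is cyclic.
  have hc : σ y0 / r ≠ 0 := div_ne_zero (by simpa using hne) hr0
  obtain ⟨k, hk, hkgen⟩ := exists_generator S hc (by
    intro y hy
    have h1 := h.mul_conj_mem hK hσ hI hr ((hS _).1 hy).1 ((hS _).1 hy0).1
    rw [mem_spanSingleton_iff_div hr0] at h1
    obtain ⟨n, hn⟩ := exists_int_of_mem_one hK hσ (by
      rw [map_div₀, map_mul, cc, hr]
      congr 1
      calc σ y * y0 = σ y * (e * σ y0) := by rw [((hS _).1 hy0).2]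
        _ = (e * σ y) * σ y0 := by ring
        _ = _ := by rw [((hS _).1 hy).2]) h1
    exact ⟨n, by rw [hn]; ring⟩)
  have hk0 : k ≠ 0 := by
    rintro rfl
    obtain ⟨n, hn⟩ := hkgen y0 hy0
    exact hne (by simpa using hn)
  obtain ⟨hkA, hke⟩ := (hS k).1 hk
  refine ⟨k, hk0, le_antisymm ?_ (spanSingleton_le_iff_mem.2 hkA), ?_⟩
  · intro t ht
    -- Numerator and denominator both change sign, so the quotient is fixed and equals n k. Then t -
    -- n w k is fixed too, equal to m k, and t = (m + n w) k.
    have h1 : (t - e * σ t) / (w - σ w) ∈ S := by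
      refine (hS _).2 ⟨hcong t ht, ?_⟩
      have hw1 : σ w - w ≠ 0 := by rw [← neg_sub]; exact neg_ne_zero.2 hw0
      rw [map_div₀, map_sub, map_sub, map_mul, cc, cc, mul_div_assoc', mul_sub, hee',
        div_eq_div_iff hw1 hw0]
      ring
    obtain ⟨n, hn⟩ := hkgen _ h1
    have hn' : t - e * σ t = n * k * (w - σ w) := (div_eq_iff hw0).1 hn
    have h2 : t - n * (w * k) ∈ S := by
      refine (hS _).2 ⟨sub_mem' ht ?_, ?_⟩
      · have := mul_mem_mul (mul_mem_mul (intCast_mem_one n) hw) hkA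
        rwa [one_mul, one_mul, mul_assoc] at this
      · rw [map_sub, map_mul, map_mul, map_intCast]
        linear_combination -hn' - n * σ w * hke
    obtain ⟨m, hm⟩ := hkgen _ h2
    rw [mem_spanSingleton_iff_div hk0]
    have : t / k = m + n * w := by
      rw [div_eq_iff hk0]
      linear_combination hm
    rw [this]
    refine add_mem' (intCast_mem_one m) ?_
    have := mul_mem_mul (intCast_mem_one (K := K) n) hw
    rwa [one_mul] at this
  · rw [he] at hke
    calc r * k = r * (r⁻¹ * L.det * σ k) := by rw [hke]
      _ = L.det * σ k := by field_simp

/-- Operators in the discriminant kernel come from the Hilbert modular group. -/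
theorem PairwiseIntegral.exists_mem_hilbertModularGroup (hK : Module.finrank ℚ K = 2)
    (hσ : σ ≠ AlgEquiv.refl) (ι : K →+* ℝ) (hI : I ≠ ⊥)
    (hB : IsNormBasis σ (I : FractionalIdeal (𝓞 K)⁰ K) N u v) (hr : σ r = r) (hr0 : r ≠ 0)
    (hdet : L.det * σ L.det = r ^ 2) (hpos : 0 < ι L.det) (h : PairwiseIntegral σ I L r)
    (hW : ∀ x, IsDual σ (I : FractionalIdeal (𝓞 K)⁰ K) x →
      r⁻¹ * (L 0 0 * σ (L 1 1) * x + L 0 1 * σ (L 1 0) * σ x) - x ∈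
        (I : FractionalIdeal (𝓞 K)⁰ K)) :
    ∃ k : K, k ≠ 0 ∧ r = k * σ k ∧ (k⁻¹ • L).det = 1 ∧ InOrder I (k⁻¹ • L) := by
  obtain ⟨k, hk0, hk, hke⟩ := h.exists_content_eq hK hσ hI hB hr hr0 hdet hW
  have hk0' : σ k ≠ 0 := by simpa using hk0
  have hd : L.det ≠ 0 := left_ne_zero_of_mul (hdet.trans_ne (pow_ne_zero _ hr0))
  have hsq := h.content_sq hK hσ hI hr hr0 hdet
  rw [hk, sq, spanSingleton_mul_spanSingleton] at hsq
  -- From r k = det L · k' one gets det L = e k², while e is fixed by conjugation; as (k²) = (det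
  -- L), e is a rational unit, and positivity of det L excludes -1.
  set e := r / (k * σ k) with he
  have hde : L.det = e * (k * k) := by
    rw [he]; field_simp; linear_combination -hke
  have hfix : σ e = e := by rw [he, map_div₀, map_mul, hr, conj_conj hK hσ, mul_comm]
  have h1 : e ∈ (1 : FractionalIdeal (𝓞 K)⁰ K) := by
    have : L.det ∈ spanSingleton (𝓞 K)⁰ (k * k) := hsq ▸ mem_spanSingleton_self _ _
    rwa [mem_spanSingleton_iff_div (mul_ne_zero hk0 hk0), hde,
      mul_div_cancel_right₀ _ (mul_ne_zero hk0 hk0)] at this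
  have h2 : e⁻¹ ∈ (1 : FractionalIdeal (𝓞 K)⁰ K) := by
    have : k * k ∈ spanSingleton (𝓞 K)⁰ L.det := hsq ▸ mem_spanSingleton_self _ _
    rw [mem_spanSingleton_iff_div hd, hde] at this
    convert! this using 1
    field_simp
  obtain ⟨m, hm⟩ := exists_int_of_mem_one hK hσ hfix h1
  obtain ⟨n, hn⟩ := exists_int_of_mem_one hK hσ (by rw [map_inv₀, hfix]) h2
  have he0 : e ≠ 0 := div_ne_zero hr0 (mul_ne_zero hk0 hk0')
  have hmn : m * n = 1 := by
    have : (m : K) * n = 1 := by rw [hm, hn, mul_inv_cancel₀ he0]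
    exact_mod_cast this
  have hmpos : 0 < m := by
    rw [hde, ← hm, map_mul, map_mul, map_intCast] at hpos
    have : 0 < ι k * ι k := mul_self_pos.2 (by simpa using hk0)
    exact_mod_cast (pos_iff_pos_of_mul_pos hpos).2 this
  have hm1 : m = 1 := by
    rcases Int.eq_one_or_neg_one_of_mul_eq_one hmn with h | h
    · exact h
    · omega
  rw [hm1, Int.cast_one] at hm
  refine ⟨k, hk0, ?_, ?_, ?_⟩
  · rw [he, eq_div_iff (mul_ne_zero hk0 hk0'), one_mul] at hm
    exact hm.symm
  · rw [Matrix.det_smul, hde, ← hm]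
    simp
    field_simp
  · have hc : contentIdeal I (k⁻¹ • L) ≤ 1 := by
      rw [contentIdeal_smul, hk, spanSingleton_mul_spanSingleton, inv_mul_cancel₀ hk0,
        spanSingleton_one]
    rw [contentIdeal_le_iff hI] at hc
    simpa [InOrder] using hc

end Kernel

/-! ### Passing between real matrices and matrices over K. -/

section Transfer
open Matrix
variable {K : Type*} [Field K] [NumberField K] {σ : K ≃ₐ[ℚ] K} {ι : K →+* ℝ}
  {J : FractionalIdeal (𝓞 K)⁰ K} {u v r : K} {N : ℕ} {L : Matrix (Fin 2) (Fin 2) K}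
  {T : Matrix (Fin 2) (Fin 2) ℤ} {I : Ideal (𝓞 K)} {a b : ℝ}
  {A B : SpecialLinearGroup (Fin 2) ℝ}

/-- The real matrix `Ĝ H_N`. -/
noncomputable def realBasis (ι : K →+* ℝ) (σ : K ≃ₐ[ℚ] K) (N : ℕ) (u v : K) :
    Matrix (Fin 4) (Fin 4) ℝ :=
  latticeBasis (N : ℝ) (ι u) (ι v) (ι (σ u)) (ι (σ v))

theorem latticeBasis_map {R S : Type*} [CommRing R] [CommRing S] (f : R →+* S) (N u v u' v' : R) :
    (latticeBasis N u v u' v').map f = latticeBasis (f N) (f u) (f v) (f u') (f v') := by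
  ext i j
  fin_cases i <;> fin_cases j <;> simp [latticeBasis]

theorem realBasis_eq_map (ι : K →+* ℝ) (σ : K ≃ₐ[ℚ] K) (N : ℕ) (u v : K) :
    realBasis ι σ N u v = (latticeBasis (N : K) u v (σ u) (σ v)).map ι := by
  rw [latticeBasis_map, map_natCast, realBasis]

theorem hat_mul_HMat (ι : K →+* ℝ) (σ : K ≃ₐ[ℚ] K) (N : ℕ) (u v : K) :
    hat (baseChange ι σ u v) * HMat N = realBasis ι σ N u v := by
  ext i j
  fin_cases i <;> fin_cases j <;>
    simp [hat, baseChange, HMat, realBasis, latticeBasis, Matrix.mul_apply, Fin.sum_univ_succ]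

theorem HMat_inv_mul_tilde (ι : K →+* ℝ) (σ : K ≃ₐ[ℚ] K) (N : ℕ) (u v : K)
    (M M' : Matrix (Fin 2) (Fin 2) ℝ) :
    (HMat N)⁻¹ * tilde (baseChange ι σ u v) M M' * HMat N =
      (realBasis ι σ N u v)⁻¹ * omegaMatrix M M' * realBasis ι σ N u v := by
  rw [← hat_mul_HMat, Matrix.mul_inv_rev, tilde, Omega_eq]
  simp only [Matrix.mul_assoc]

theorem IsNormBasis.isUnit_det_realBasis (hK : Module.finrank ℚ K = 2) (hσ : σ ≠ AlgEquiv.refl)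
    (ι : K →+* ℝ) (h : IsNormBasis σ J N u v) : IsUnit (realBasis ι σ N u v).det := by
  rw [realBasis_eq_map, show (latticeBasis (N : K) u v (σ u) (σ v)).map ι =
    ι.mapMatrix (latticeBasis (N : K) u v (σ u) (σ v)) from rfl, ← RingHom.map_det]
  exact (h.det_ne_zero hK hσ).isUnit.map ι

theorem map_map_intCast (ι : K →+* ℝ) {m n : Type*} (U : Matrix m n ℤ) :
    (U.map (Int.cast : ℤ → K)).map ι = U.map (Int.cast : ℤ → ℝ) := by
  ext i j
  simp

theorem realBasis_transpose_mul (ι : K →+* ℝ)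
    (hT : (N : K) • T.map (Int.cast : ℤ → K) =
        !![2 * u * σ u, u * σ v + σ u * v; u * σ v + σ u * v, 2 * v * σ v]) :
    (realBasis ι σ N u v).transpose * antidiag ℝ * realBasis ι σ N u v =
      (N : ℝ) • (addHyperbolic 1 T).map (Int.cast : ℤ → ℝ) := by
  apply latticeBasis_transpose_mul
  ext i j
  have := congrArg ι (congrFun (congrFun hT i) j)
  have h2 : ι 2 = 2 := map_ofNat ι 2
  fin_cases i <;> fin_cases j <;> simpa [h2] using this

/-- Rationality: an identity of real matrices comes from an identity over `K`. -/
theorem IsNormBasis.intertwine_iff (hK : Module.finrank ℚ K = 2) (hσ : σ ≠ AlgEquiv.refl)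
    (ι : K →+* ℝ) (h : IsNormBasis σ J N u v) {W : Matrix (Fin 4) (Fin 4) K}
    {U : Matrix (Fin 4) (Fin 4) ℤ} :
    U.map (Int.cast : ℤ → ℝ) = (realBasis ι σ N u v)⁻¹ * W.map ι * realBasis ι σ N u v ↔
      W * latticeBasis (N : K) u v (σ u) (σ v) =
        latticeBasis (N : K) u v (σ u) (σ v) * U.map (Int.cast : ℤ → K) := by
  have hQ := h.isUnit_det_realBasis hK hσ ι
  have h1 : (U.map (Int.cast : ℤ → ℝ) = (realBasis ι σ N u v)⁻¹ * W.map ι * realBasis ι σ N u v) ↔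
      W.map ι * realBasis ι σ N u v = realBasis ι σ N u v * U.map (Int.cast : ℤ → ℝ) := by
    constructor
    · intro h1
      rw [h1, Matrix.mul_assoc, mul_nonsing_inv_cancel_left _ _ hQ]
    · intro h1
      rw [Matrix.mul_assoc, h1, nonsing_inv_mul_cancel_left _ _ hQ]
  rw [h1, realBasis_eq_map, ← map_map_intCast ι, ← Matrix.map_mul, ← Matrix.map_mul]
  constructor
  · intro h2
    ext i j
    exact ι.injective (congrFun (congrFun h2 i) j)
  · intro h2
    rw [h2]

/-- Ω is bilinear, so the real scalars a and b cancel against r; L over K can then stand for the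
real pair (A, B). -/
theorem map_inv_smul_omegaMatrix (hA : L.map ι = b • A.1)
    (hB : L.map (fun x => ι (σ x)) = a • B.1) (hr : ι r = a * b) (hr0 : r ≠ 0) :
    (r⁻¹ • omegaMatrix L (L.map σ)).map ι = omegaMatrix A.1 B.1 := by
  have h1 : (r⁻¹ • omegaMatrix L (L.map σ)).map ι = (ι r)⁻¹ • (omegaMatrix L (L.map σ)).map ι := by
    ext i j
    simp
  have h2 : (L.map σ).map ι = L.map (fun x => ι (σ x)) := rfl
  have h3 : a * b ≠ 0 := by rw [← hr]; simpa using hr0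
  rw [h1, omegaMatrix_map, h2, hA, hB, omegaMatrix_smul, smul_smul, hr, mul_comm b a,
    inv_mul_cancel₀ h3, one_smul]

theorem mem_SO0Int_iff (hK : Module.finrank ℚ K = 2) (hσ : σ ≠ AlgEquiv.refl)
    (ι : K →+* ℝ) (h : IsNormBasis σ J N u v)
    (hT : (N : K) • T.map (Int.cast : ℤ → K) =
        !![2 * u * σ u, u * σ v + σ u * v; u * σ v + σ u * v, 2 * v * σ v])
    {U : SpecialLinearGroup (Fin 4) ℤ} :
    U ∈ SO0Int (addHyperbolic 1 T) ↔ ∃ A B : SpecialLinearGroup (Fin 2) ℝ,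
      U.1.map (Int.cast : ℤ → ℝ) =
        (realBasis ι σ N u v)⁻¹ * omegaMatrix A.1 B.1 * realBasis ι σ N u v := by
  have hN : (N : ℝ) ≠ 0 := Nat.cast_ne_zero.2 h.pos
  refine (mem_SO0Real_iff (h.isUnit_det_realBasis hK hσ ι) hN
    (realBasis_transpose_mul ι hT)).trans ?_
  refine exists_congr fun A => exists_congr fun B => ?_
  exact ⟨fun h => congrArg Subtype.val h, fun h => Subtype.ext h⟩

theorem PairwiseIntegral.exists_mem_SO0Int (hK : Module.finrank ℚ K = 2) (hσ : σ ≠ AlgEquiv.refl)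
    (h : IsNormBasis σ J N u v)
    (hT : (N : K) • T.map (Int.cast : ℤ → K) =
        !![2 * u * σ u, u * σ v + σ u * v; u * σ v + σ u * v, 2 * v * σ v])
    (hA : L.map ι = b • A.1) (hB : L.map (fun x => ι (σ x)) = a • B.1) (hr : ι r = a * b)
    (hr0 : r ≠ 0) (hr' : σ r = r) (hL : PairwiseIntegral σ J L r) :
    ∃ U ∈ SO0Int (addHyperbolic 1 T), U.1.map (Int.cast : ℤ → ℝ) =
        (realBasis ι σ N u v)⁻¹ * omegaMatrix A.1 B.1 * realBasis ι σ N u v ∧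
      r⁻¹ • omegaMatrix L (L.map σ) * latticeBasis (N : K) u v (σ u) (σ v) =
        latticeBasis (N : K) u v (σ u) (σ v) * U.1.map (Int.cast : ℤ → K) := by
  obtain ⟨U, hU⟩ := h.exists_intMatrix hK hσ (W := r⁻¹ • omegaMatrix L (L.map σ)) fun x hx => by
    rw [Matrix.smul_mulVec]
    exact hL.isLatticeVector hK hσ h.ne_zero hr' hr0 hx
  have h1 := (h.intertwine_iff hK hσ ι).2 hU
  rw [map_inv_smul_omegaMatrix hA hB hr hr0] at h1
  have hdet : U.det = 1 := by
    have h2 := (conjOmega _ (h.isUnit_det_realBasis hK hσ ι) (A, B)).2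
    rw [coe_conjOmega, ← h1, show U.map (Int.cast : ℤ → ℝ) = (Int.castRingHom ℝ).mapMatrix U from rfl,
      ← RingHom.map_det, eq_intCast] at h2
    exact_mod_cast h2
  exact ⟨⟨U, hdet⟩, (mem_SO0Int_iff hK hσ ι h hT).2 ⟨A, B, h1⟩, h1, hU⟩

/-- The position of the pair `(p, k)` in the standard basis. -/
def pairIndex (p k : Fin 2) : Fin 4 := !![0, 1; 2, 3] p k

/-- The sign attached to the pair `(p, k)`. -/
def pairSign (R : Type*) [CommRing R] (p k : Fin 2) : R := !![1, -1; -1, -1] p k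

/-- The Kronecker product structure made explicit: every product A_pq B_kl can be read off from an
entry of Ω. -/
theorem omegaMatrix_pairIndex {R : Type*} [CommRing R] (A B : Matrix (Fin 2) (Fin 2) R)
    (p k q l : Fin 2) : pairSign R p k * pairSign R q l *
      omegaMatrix A B (pairIndex p k) (pairIndex q l) = A p q * B k l := by
  fin_cases p <;> fin_cases k <;> fin_cases q <;> fin_cases l <;>
    simp [omegaMatrix, pairIndex, pairSign, mul_comm]

theorem swap_pairIndex (p k : Fin 2) : Equiv.swap 1 2 (pairIndex p k) = pairIndex k p := by
  fin_cases p <;> fin_cases k <;> decide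

theorem pairSign_comm (R : Type*) [CommRing R] (p k : Fin 2) : pairSign R p k = pairSign R k p := by
  fin_cases p <;> fin_cases k <;> rfl

theorem map_pairSign {R S : Type*} [CommRing R] [CommRing S] (f : R →+* S) (p k : Fin 2) :
    f (pairSign R p k) = pairSign S p k := by
  fin_cases p <;> fin_cases k <;> simp [pairSign]

theorem latticeBasis_map_conj (hK : Module.finrank ℚ K = 2) (hσ : σ ≠ AlgEquiv.refl) :
    (latticeBasis (N : K) u v (σ u) (σ v)).map σ =
      (latticeBasis (N : K) u v (σ u) (σ v)).submatrix (Equiv.swap 1 2) id := by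
  have cc := conj_conj hK hσ
  ext i j
  fin_cases i
  · fin_cases j <;> simp [latticeBasis, Equiv.swap_apply_of_ne_of_ne]
  · fin_cases j <;> simp [latticeBasis]
  · fin_cases j <;> simp [latticeBasis, cc]
  · have : Equiv.swap (1 : Fin 4) 2 3 = 3 := by decide
    fin_cases j <;> simp [latticeBasis, this]

/-- Conjugation fixes the integral matrix U and swaps the two middle rows of the lattice basis, so
on W = Q U Q⁻¹ it swaps the middle rows and columns. -/
theorem IsNormBasis.map_conj_eq_submatrix (hK : Module.finrank ℚ K = 2) (hσ : σ ≠ AlgEquiv.refl)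
    (h : IsNormBasis σ J N u v) {W : Matrix (Fin 4) (Fin 4) K} {U : Matrix (Fin 4) (Fin 4) ℤ}
    (hU : W * latticeBasis (N : K) u v (σ u) (σ v) =
      latticeBasis (N : K) u v (σ u) (σ v) * U.map (Int.cast : ℤ → K)) :
    W.map σ = W.submatrix (Equiv.swap 1 2) (Equiv.swap 1 2) := by
  set Q := latticeBasis (N : K) u v (σ u) (σ v) with hQ
  have hdet : IsUnit (Q.submatrix (Equiv.swap 1 2) id).det := by
    rw [← latticeBasis_map_conj hK hσ]
    change IsUnit ((σ : K →+* K).mapMatrix Q).det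
    rw [← RingHom.map_det]
    exact (h.det_ne_zero hK hσ).isUnit.map _
  have hUσ : (U.map (Int.cast : ℤ → K)).map σ = U.map (Int.cast : ℤ → K) := by
    ext i j; simp
  have h1 : W.map σ * Q.submatrix (Equiv.swap 1 2) id =
      W.submatrix (Equiv.swap 1 2) (Equiv.swap 1 2) * Q.submatrix (Equiv.swap 1 2) id := by
    have h2 : (W * Q).map (σ : K →+* K) = (Q * U.map (Int.cast : ℤ → K)).map (σ : K →+* K) := by
      rw [hU]
    rw [Matrix.map_mul, Matrix.map_mul] at h2
    have h3 : Q.map (σ : K →+* K) = Q.submatrix (Equiv.swap 1 2) id := latticeBasis_map_conj hK hσ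
    rw [h3] at h2
    calc W.map σ * Q.submatrix (Equiv.swap 1 2) id
        = Q.submatrix (Equiv.swap 1 2) id * (U.map (Int.cast : ℤ → K)).map σ := h2
      _ = (Q * U.map (Int.cast : ℤ → K)).submatrix (Equiv.swap 1 2) id := by rw [hUσ]; rfl
      _ = (W * Q).submatrix (Equiv.swap 1 2) id := by rw [hU]
      _ = _ := (Matrix.submatrix_mul_equiv W Q _ (Equiv.swap 1 2) id).symm
  have h4 := congrArg (· * (Q.submatrix (Equiv.swap 1 2) id)⁻¹) h1
  simpa only [mul_nonsing_inv_cancel_right _ _ hdet] using h4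

theorem exists_ne_zero_of_specialLinear (A : SpecialLinearGroup (Fin 2) ℝ) : ∃ i j, A.1 i j ≠ 0 := by
  by_contra! h
  have := A.2
  rw [det_fin_two] at this
  simp [h] at this

/-- An integral element of the identity component comes from a matrix over `K`. -/
theorem exists_matrix_of_intertwine (hK : Module.finrank ℚ K = 2) (hσ : σ ≠ AlgEquiv.refl)
    (ι : K →+* ℝ) (h : IsNormBasis σ J N u v) {U : Matrix (Fin 4) (Fin 4) ℤ}
    (hU : U.map (Int.cast : ℤ → ℝ) =
      (realBasis ι σ N u v)⁻¹ * omegaMatrix A.1 B.1 * realBasis ι σ N u v) :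
    ∃ (L : Matrix (Fin 2) (Fin 2) K) (r : K) (a b : ℝ), L.map ι = b • A.1 ∧
      L.map (fun x => ι (σ x)) = a • B.1 ∧ ι r = a * b ∧ r ≠ 0 ∧ σ r = r ∧
      L.det * σ L.det = r ^ 2 ∧ ι L.det = b ^ 2 ∧ ι (σ L.det) = a ^ 2 ∧
      PairwiseIntegral σ J L r ∧
      r⁻¹ • omegaMatrix L (L.map σ) * latticeBasis (N : K) u v (σ u) (σ v) =
        latticeBasis (N : K) u v (σ u) (σ v) * U.map (Int.cast : ℤ → K) := by
  have cc := conj_conj hK hσ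
  set Q := latticeBasis (N : K) u v (σ u) (σ v) with hQ
  have hQdet : IsUnit Q.det := (h.det_ne_zero hK hσ).isUnit
  set W := Q * U.map (Int.cast : ℤ → K) * Q⁻¹ with hW
  have hWQ : W * Q = Q * U.map (Int.cast : ℤ → K) := by
    rw [hW, Matrix.mul_assoc, nonsing_inv_mul _ hQdet, Matrix.mul_one]
  have hWmap : W.map ι = omegaMatrix A.1 B.1 := by
    have hR := h.isUnit_det_realBasis hK hσ ι
    have h1 := (h.intertwine_iff hK hσ ι).2 hWQ
    rw [hU] at h1
    have h2 := congrArg (fun X => realBasis ι σ N u v * X * (realBasis ι σ N u v)⁻¹) h1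
    have h3 : ∀ X : Matrix (Fin 4) (Fin 4) ℝ, realBasis ι σ N u v * ((realBasis ι σ N u v)⁻¹ * X *
        realBasis ι σ N u v) * (realBasis ι σ N u v)⁻¹ = X := by
      intro X
      rw [Matrix.mul_assoc, Matrix.mul_assoc, Matrix.mul_assoc, mul_nonsing_inv _ hR, Matrix.mul_one,
        mul_nonsing_inv_cancel_left _ _ hR]
    simp only [h3] at h2
    exact h2.symm
  have hsub := h.map_conj_eq_submatrix hK hσ hWQ
  have hWe : ∀ p k q l, ι (pairSign K p k * pairSign K q l * W (pairIndex p k) (pairIndex q l)) =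
      A.1 p q * B.1 k l := by
    intro p k q l
    rw [← omegaMatrix_pairIndex, ← hWmap, map_mul, map_mul, map_pairSign, map_pairSign]
    rfl
  have hWc : ∀ p k q l,
      σ (pairSign K p k * pairSign K q l * W (pairIndex p k) (pairIndex q l)) =
        pairSign K k p * pairSign K l q * W (pairIndex k p) (pairIndex l q) := by
    intro p k q l
    have := congrFun (congrFun hsub (pairIndex p k)) (pairIndex q l)
    rw [map_apply, submatrix_apply, swap_pairIndex, swap_pairIndex] at this
    rw [map_mul, map_mul, this, pairSign_comm K k p, pairSign_comm K l q]
    congr 2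
    · exact map_pairSign (σ : K →+* K) p k
    · exact map_pairSign (σ : K →+* K) q l
  obtain ⟨k, l, hkl⟩ := exists_ne_zero_of_specialLinear B
  obtain ⟨p, q, hpq⟩ := exists_ne_zero_of_specialLinear A
  set F : Fin 2 → Fin 2 → Fin 2 → Fin 2 → K := fun p k q l =>
    pairSign K p k * pairSign K q l * W (pairIndex p k) (pairIndex q l) with hF
  -- The nonzero element A_pq B_kl of K has conjugate A_kl B_pq, so A_kl ≠ 0 for the very indices
  -- chosen for B.
  have hAkl : A.1 k l ≠ 0 := by
    have h1 : F p k q l ≠ 0 := by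
      intro h0
      have := hWe p k q l
      rw [show pairSign K p k * pairSign K q l * W (pairIndex p k) (pairIndex q l) = F p k q l from rfl,
        h0, map_zero] at this
      exact mul_ne_zero hpq hkl this.symm
    have h2 : σ (F p k q l) ≠ 0 := by simpa using h1
    have h3 : ι (σ (F p k q l)) ≠ 0 := by simpa using h2
    rw [hF] at h3
    simp only [hWc, hWe] at h3
    exact left_ne_zero_of_mul h3
  -- L is B_kl A read inside K; its conjugate is A_kl B, and r = A_kl B_kl is fixed by conjugation.
  let L : Matrix (Fin 2) (Fin 2) K := Matrix.of fun p q => F p k q l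
  have hLA : L.map ι = B.1 k l • A.1 := by
    ext p q
    exact (hWe p k q l).trans (mul_comm _ _)
  have hLB : L.map (fun x => ι (σ x)) = A.1 k l • B.1 := by
    ext p q
    exact (congrArg ι (hWc p k q l)).trans (hWe k p l q)
  have hr : ι (F k k l l) = A.1 k l * B.1 k l := hWe k k l l
  have hr0 : F k k l l ≠ 0 := by
    intro h0
    rw [h0, map_zero] at hr
    exact mul_ne_zero hAkl hkl hr.symm
  have hr' : σ (F k k l l) = F k k l l := hWc k k l l
  have hd1 : ι L.det = B.1 k l ^ 2 := by
    rw [RingHom.map_det]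
    change (L.map ι).det = _
    rw [hLA, det_smul, A.2]
    simp
  have hd2 : ι (σ L.det) = A.1 k l ^ 2 := by
    have : ι (σ L.det) = (ι.comp (σ : K →+* K)) L.det := rfl
    rw [this, RingHom.map_det]
    change (L.map (fun x => ι (σ x))).det = _
    rw [hLB, det_smul, B.2]
    simp
  have hWL : (F k k l l)⁻¹ • omegaMatrix L (L.map σ) = W := by
    have h1 := map_inv_smul_omegaMatrix hLA hLB hr hr0
    rw [← hWmap] at h1
    ext i j
    exact ι.injective (congrFun (congrFun h1 i) j)
  have hint : (F k k l l)⁻¹ • omegaMatrix L (L.map σ) * Q = Q * U.map (Int.cast : ℤ → K) := by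
    rw [hWL, hWQ]
  refine ⟨L, F k k l l, A.1 k l, B.1 k l, hLA, hLB, hr, hr0, hr', ?_, hd1, hd2, ?_, hint⟩
  · apply ι.injective
    rw [map_mul, map_pow, hd1, hd2, hr]
    ring
  · refine pairwiseIntegral_of_isLatticeVector hK hσ h.ne_zero h.pos h.mul_conj hr' hr0 fun x hx => ?_
    rw [← Matrix.smul_mulVec]
    exact h.isLatticeVector_mulVec hK hσ hint hx

end Transfer

/-- A multiplicative relation between two groups that is total, surjective modulo `Q` and compatible
with normal subgroups `P`, `Q` induces an isomorphism of the quotients. -/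
theorem exists_mulEquiv_of_relation {G H : Type*} [Group G] [Group H] (P : Subgroup G) [P.Normal]
    (Q : Subgroup H) [Q.Normal] (R : G → H → Prop)
    (mul : ∀ g g' h h', R g h → R g' h' → R (g * g') (h * h')) (total : ∀ g, ∃ h, R g h)
    (surj : ∀ h, ∃ g h', R g h' ∧ h⁻¹ * h' ∈ Q) (iff : ∀ g h, R g h → (g ∈ P ↔ h ∈ Q)) :
    ∃ ψ : G ⧸ P ≃* H ⧸ Q, ∀ g h, R g h → ψ (QuotientGroup.mk g) = QuotientGroup.mk h := by
  choose f hf using total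
  have uniq : ∀ g h h', R g h → R g h' → (QuotientGroup.mk h : H ⧸ Q) = QuotientGroup.mk h' := by
    intro g h h' h1 h2
    have h3 := (iff _ _ (mul _ _ _ _ (hf g⁻¹) h1)).1 (by simp)
    have h4 := (iff _ _ (mul _ _ _ _ (hf g⁻¹) h2)).1 (by simp)
    rw [QuotientGroup.eq]
    have := Q.mul_mem (Q.inv_mem h3) h4
    simpa [mul_assoc] using this
  let φ : G →* H ⧸ Q := MonoidHom.mk' (fun g => QuotientGroup.mk (f g)) fun a b =>
    uniq _ _ _ (hf (a * b)) (mul _ _ _ _ (hf a) (hf b))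
  have hφ : ∀ g, φ g = QuotientGroup.mk (f g) := fun g => rfl
  have hker : φ.ker = P := by
    ext g
    rw [MonoidHom.mem_ker, hφ, QuotientGroup.eq_one_iff, iff _ _ (hf g)]
  have hsurj : Function.Surjective φ := by
    intro x
    obtain ⟨h, rfl⟩ := QuotientGroup.mk_surjective x
    obtain ⟨g, h', h1, h2⟩ := surj h
    exact ⟨g, (uniq _ _ _ (hf g) h1).trans (QuotientGroup.eq.2 h2).symm⟩
  refine ⟨(QuotientGroup.quotientMulEquivOfEq hker.symm).trans
    (QuotientGroup.quotientKerEquivOfSurjective φ hsurj), fun g h hR => ?_⟩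
  exact uniq _ _ _ (hf g) hR

/-! ### Conjugates up to sign, and scalar matrices. -/

section Conjugates
open Matrix
variable {K : Type*} [Field K] [NumberField K] {σ : K ≃ₐ[ℚ] K} {ι : K →+* ℝ}

/-- For nonzero matrices, L₁ = τL₂ with τ ∈ K and τ²d₂ = d₁. Conjugating, τ' is a square root of
d₁'/d₂', whose sign is not determined by that of τ. -/
theorem conj_eq_or_eq_neg {d₁ d₂ : K} {L₁ L₂ : Matrix (Fin 2) (Fin 2) K}
    (h₁ : TotallyPositive ι σ d₁) (h₂ : TotallyPositive ι σ d₂)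
    (h : (Real.sqrt (ι d₁))⁻¹ • L₁.map ι = (Real.sqrt (ι d₂))⁻¹ • L₂.map ι) :
    (Real.sqrt (ι (σ d₁)))⁻¹ • L₁.map (fun x => ι (σ x)) =
        (Real.sqrt (ι (σ d₂)))⁻¹ • L₂.map (fun x => ι (σ x)) ∨
      (Real.sqrt (ι (σ d₁)))⁻¹ • L₁.map (fun x => ι (σ x)) =
        -((Real.sqrt (ι (σ d₂)))⁻¹ • L₂.map (fun x => ι (σ x))) := by
  have s₁ := Real.sqrt_pos.2 h₁.1
  have s₂ := Real.sqrt_pos.2 h₂.1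
  have t₁ := Real.sqrt_pos.2 h₁.2
  have t₂ := Real.sqrt_pos.2 h₂.2
  have e : ∀ i j, ι (L₁ i j) * Real.sqrt (ι d₂) = ι (L₂ i j) * Real.sqrt (ι d₁) := by
    intro i j
    have := congrFun (congrFun h i) j
    simp only [Matrix.smul_apply, map_apply, smul_eq_mul] at this
    field_simp at this
    linarith
  by_cases h0 : L₂ = 0
  · have : L₁ = 0 := by
      ext i j
      have := e i j
      rw [h0] at this
      simpa [s₂.ne'] using this
    left
    rw [h0, this]
    ext; simp
  obtain ⟨i, j, hij⟩ : ∃ i j, L₂ i j ≠ 0 := by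
    by_contra! hc
    exact h0 (by ext i j; exact hc i j)
  have hij' : ι (L₂ i j) ≠ 0 := by simpa using hij
  set τ := L₁ i j / L₂ i j with hτ
  have hιτ : ι τ * Real.sqrt (ι d₂) = Real.sqrt (ι d₁) := by
    rw [hτ, map_div₀, div_mul_eq_mul_div, e, mul_div_cancel_left₀ _ hij']
  have hL : ∀ k l, L₁ k l = τ * L₂ k l := by
    intro k l
    apply ι.injective
    apply mul_right_cancel₀ s₂.ne'
    rw [e, map_mul, mul_right_comm, hιτ, mul_comm]
  have hd : τ ^ 2 * d₂ = d₁ := by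
    apply ι.injective
    rw [map_mul, map_pow, ← Real.sq_sqrt h₁.1.le, ← hιτ, mul_pow, Real.sq_sqrt h₂.1.le]
  have hd' : (ι (σ τ) * Real.sqrt (ι (σ d₂))) ^ 2 = Real.sqrt (ι (σ d₁)) ^ 2 := by
    rw [mul_pow, Real.sq_sqrt h₁.2.le, Real.sq_sqrt h₂.2.le, ← hd]
    simp
  rcases sq_eq_sq_iff_eq_or_eq_neg.1 hd' with h | h
  · left
    ext k l
    simp only [Matrix.smul_apply, map_apply, smul_eq_mul, hL, map_mul, ← h]
    have : ι (σ τ) ≠ 0 := fun h0 => by rw [h0, zero_mul] at h; exact t₁.ne h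
    field_simp
  · right
    rw [← neg_eq_iff_eq_neg] at h
    ext k l
    simp only [Matrix.smul_apply, map_apply, smul_eq_mul, hL, map_mul, ← h, Matrix.neg_apply]
    have : ι (σ τ) ≠ 0 := fun h0 => by rw [h0, zero_mul, neg_zero] at h; exact t₁.ne h
    field_simp

theorem IsConjugate.mul {M₁ M₂ M₁' M₂' : SpecialLinearGroup (Fin 2) ℝ}
    (h₁ : IsConjugate ι σ M₁ M₁') (h₂ : IsConjugate ι σ M₂ M₂') :
    IsConjugate ι σ (M₁ * M₂) (M₁' * M₂') := by
  obtain ⟨d, L, hd, e, e'⟩ := h₁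
  obtain ⟨c, P, hc, f, f'⟩ := h₂
  refine ⟨d * c, L * P, ⟨?_, ?_⟩, ?_, ?_⟩
  · rw [map_mul]; exact mul_pos hd.1 hc.1
  · rw [map_mul, map_mul]; exact mul_pos hd.2 hc.2
  · change M₁.1 * M₂.1 = _
    rw [e, f, map_mul, Real.sqrt_mul hd.1.le, Matrix.map_mul,
      Matrix.smul_mul, Matrix.mul_smul, smul_smul, mul_inv]
  · have : (L * P).map (fun x => ι (σ x)) = L.map (fun x => ι (σ x)) * P.map (fun x => ι (σ x)) :=
      Matrix.map_mul (f := ι.comp (σ : K →+* K))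
    change M₁'.1 * M₂'.1 = _
    rw [e', f', map_mul, map_mul, Real.sqrt_mul hd.2.le, this,
      Matrix.smul_mul, Matrix.mul_smul, smul_smul, mul_inv]

/-- A Kronecker product that is a nonzero scalar has scalar factors, and a scalar in SL₂(ℝ) is ±1.
-/
theorem eq_one_or_eq_neg_one_of_omegaMatrix {A B : SpecialLinearGroup (Fin 2) ℝ} {c : ℝ}
    (hc : c ≠ 0) (h : omegaMatrix A.1 B.1 = c • 1) : A.1 = 1 ∨ A.1 = -1 := by
  have e := fun i j => congrFun (congrFun h i) j
  have e00 := e 0 0; have e02 := e 0 2; have e20 := e 2 0; have e22 := e 2 2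
  simp [omegaMatrix] at e00 e02 e20 e22
  have hB : B.1 0 0 ≠ 0 := right_ne_zero_of_mul (e00.trans_ne hc)
  have h01 : A.1 0 1 = 0 := e02.resolve_left hB
  have h10 : A.1 1 0 = 0 := e20.resolve_left hB
  have h11 : A.1 1 1 = A.1 0 0 := mul_left_cancel₀ hB (by rw [e22, mul_comm, e00])
  have hd := A.2
  rw [det_fin_two, h01, h11, zero_mul, sub_zero] at hd
  rcases mul_self_eq_one_iff.1 hd with h | h
  · left
    ext i j
    fin_cases i <;> fin_cases j <;> simp [h01, h10, h11, h]
  · right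
    ext i j
    fin_cases i <;> fin_cases j <;> simp [h01, h10, h11, h]

theorem map_intCast_injective {m n : Type*} :
    Function.Injective fun U : Matrix m n ℤ => U.map (Int.cast : ℤ → ℝ) :=
  fun _ _ h => Matrix.map_injective Int.cast_injective h

variable {Q : Matrix (Fin 4) (Fin 4) ℝ} {U : Matrix (Fin 4) (Fin 4) ℤ}

theorem eq_one_or_eq_neg_one_of_intertwine (hQ : IsUnit Q.det) {A B : SpecialLinearGroup (Fin 2) ℝ}
    (h : U.map (Int.cast : ℤ → ℝ) = Q⁻¹ * omegaMatrix A.1 B.1 * Q) (hU : U = 1 ∨ U = -1) :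
    A.1 = 1 ∨ A.1 = -1 := by
  have h1 : omegaMatrix A.1 B.1 = Q * U.map (Int.cast : ℤ → ℝ) * Q⁻¹ := by
    rw [h, Matrix.mul_assoc, Matrix.mul_assoc, Matrix.mul_assoc, mul_nonsing_inv _ hQ, Matrix.mul_one,
      mul_nonsing_inv_cancel_left _ _ hQ]
  rcases hU with rfl | rfl
  · apply eq_one_or_eq_neg_one_of_omegaMatrix one_ne_zero
    rw [h1, Matrix.map_one _ Int.cast_zero Int.cast_one, Matrix.mul_one, mul_nonsing_inv _ hQ, one_smul]
  · apply eq_one_or_eq_neg_one_of_omegaMatrix (neg_ne_zero.2 one_ne_zero)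
    have : (-1 : Matrix (Fin 4) (Fin 4) ℤ).map (Int.cast : ℤ → ℝ) = -1 := by
      ext i j; simp [Matrix.one_apply]
    rw [h1, this, Matrix.mul_neg, Matrix.mul_one, Matrix.neg_mul, mul_nonsing_inv _ hQ]
    simp

theorem eq_of_intertwine (hQ : IsUnit Q.det) {W : Matrix (Fin 4) (Fin 4) ℝ}
    (h : U.map (Int.cast : ℤ → ℝ) = Q⁻¹ * W * Q) : (W = 1 → U = 1) ∧ (W = -1 → U = -1) := by
  constructor
  · rintro rfl
    apply map_intCast_injective
    change U.map (Int.cast : ℤ → ℝ) = (1 : Matrix (Fin 4) (Fin 4) ℤ).map (Int.cast : ℤ → ℝ)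
    rw [h, Matrix.mul_one, nonsing_inv_mul _ hQ, Matrix.map_one _ Int.cast_zero Int.cast_one]
  · rintro rfl
    apply map_intCast_injective
    change U.map (Int.cast : ℤ → ℝ) = (-1 : Matrix (Fin 4) (Fin 4) ℤ).map (Int.cast : ℤ → ℝ)
    rw [h, Matrix.mul_neg, Matrix.mul_one, Matrix.neg_mul, nonsing_inv_mul _ hQ]
    ext i j; simp [Matrix.one_apply]

theorem intertwine_mul (hQ : IsUnit Q.det) {V : Matrix (Fin 4) (Fin 4) ℤ}
    {A B A' B' : Matrix (Fin 2) (Fin 2) ℝ}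
    (h : U.map (Int.cast : ℤ → ℝ) = Q⁻¹ * omegaMatrix A B * Q)
    (h' : V.map (Int.cast : ℤ → ℝ) = Q⁻¹ * omegaMatrix A' B' * Q) :
    (U * V).map (Int.cast : ℤ → ℝ) = Q⁻¹ * omegaMatrix (A * A') (B * B') * Q := by
  rw [map_intCast_mul, h, h', omegaMatrix_mul]
  simp only [Matrix.mul_assoc]
  rw [mul_nonsing_inv_cancel_left _ _ hQ]

end Conjugates

/-! ### The two isomorphisms. -/

section Main
open Matrix
variable {K : Type*} [Field K] [NumberField K] {σ : K ≃ₐ[ℚ] K} {ι : K →+* ℝ}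
  {u v : K} {N : ℕ} {T : Matrix (Fin 2) (Fin 2) ℤ} {I : Ideal (𝓞 K)}

theorem isNormBasis_of_basis (hK : Module.finrank ℚ K = 2) (hσ : σ ≠ AlgEquiv.refl) (hI : I ≠ ⊥)
    (B : Module.Basis (Fin 2) ℤ I) :
    IsNormBasis σ (I : FractionalIdeal (𝓞 K)⁰ K) (Ideal.absNorm I)
      ((B 0 : 𝓞 K) : K) ((B 1 : 𝓞 K) : K) := by
  have hcoe : ∀ m n : ℤ, (((m • B 0 + n • B 1 : I) : 𝓞 K) : K) =
      m * ((B 0 : 𝓞 K) : K) + n * ((B 1 : 𝓞 K) : K) := by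
    intro m n
    simp
  refine ⟨fun x => ?_, fun m n h => ?_, ?_, coeIdeal_mul_conjIdeal hK hσ hI⟩
  · rw [mem_coeIdeal]
    constructor
    · rintro ⟨y, hy, rfl⟩
      refine ⟨B.repr ⟨y, hy⟩ 0, B.repr ⟨y, hy⟩ 1, ?_⟩
      rw [← hcoe, ← Fin.sum_univ_two fun i => B.repr ⟨y, hy⟩ i • B i, B.sum_repr]
    · rintro ⟨m, n, rfl⟩
      exact ⟨_, (m • B 0 + n • B 1 : I).2, hcoe m n⟩
  · rw [← hcoe] at h
    have h1 : m • B 0 + n • B 1 = 0 := by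
      apply Subtype.ext
      exact RingOfIntegers.coe_injective (h.trans (map_zero _).symm)
    have h2 := Fintype.linearIndependent_iff.1 B.linearIndependent ![m, n] (by simpa using h1)
    exact ⟨h2 0, h2 1⟩
  · rwa [Ne, Ideal.absNorm_eq_zero_iff]

theorem mem_pm_iff {n : Type*} [Fintype n] [DecidableEq n] {R : Type*} [CommRing R]
    {Γ : Subgroup (SpecialLinearGroup n R)} {U : Γ} : U ∈ pm Γ ↔ U.1.1 = 1 ∨ U.1.1 = -1 :=
  Iff.rfl

/-- The content C is contained in 𝓞, and 1 = det L ∈ C² ⊆ C. -/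
theorem contentIdeal_eq_one (hI : I ≠ ⊥) {L : Matrix (Fin 2) (Fin 2) K} (hL : InOrder I L)
    (hdet : L.det = 1) : contentIdeal I L = 1 := by
  have hle : contentIdeal I L ≤ 1 := (contentIdeal_le_iff hI).2 (by simpa [InOrder] using hL)
  refine le_antisymm hle ?_
  have h1 := spanSingleton_det_le hI L
  rw [hdet, spanSingleton_one, sq] at h1
  calc (1 : FractionalIdeal (𝓞 K)⁰ K) ≤ contentIdeal I L * contentIdeal I L := h1
    _ ≤ contentIdeal I L * 1 := by gcongr
    _ = _ := mul_one _

/-- The isomorphism from the Hilbert modular group to the discriminant kernel. -/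
theorem exists_equiv_discKernel (hK : Module.finrank ℚ K = 2) (hσ : σ ≠ AlgEquiv.refl)
    (ι : K →+* ℝ) (hI : I ≠ ⊥) (hB : IsNormBasis σ (I : FractionalIdeal (𝓞 K)⁰ K) N u v)
    (hT : (N : K) • T.map (Int.cast : ℤ → K) =
        !![2 * u * σ u, u * σ v + σ u * v; u * σ v + σ u * v, 2 * v * σ v]) (hTdet : T.det ≠ 0) :
    ∃ ψ : (hilbertModularGroup I ⧸ pm (hilbertModularGroup I)) ≃* discKernel (addHyperbolic 1 T),
      ∀ M : hilbertModularGroup I,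
        (ψ (QuotientGroup.mk M)).1.1.map (Int.cast : ℤ → ℝ) =
          (realBasis ι σ N u v)⁻¹ * omegaMatrix (M.1.1.map ι) (M.1.1.map fun x => ι (σ x)) *
            realBasis ι σ N u v := by
  have hQ := hB.isUnit_det_realBasis hK hσ ι
  let R : hilbertModularGroup I → discKernel (addHyperbolic 1 T) → Prop := fun M U =>
    U.1.1.map (Int.cast : ℤ → ℝ) =
      (realBasis ι σ N u v)⁻¹ * omegaMatrix (M.1.1.map ι) (M.1.1.map fun x => ι (σ x)) *
        realBasis ι σ N u v
  let Mι : SpecialLinearGroup (Fin 2) K → SpecialLinearGroup (Fin 2) ℝ := SpecialLinearGroup.map ι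
  let Mσ : SpecialLinearGroup (Fin 2) K → SpecialLinearGroup (Fin 2) ℝ :=
    SpecialLinearGroup.map (ι.comp (σ : K →+* K))
  have total : ∀ M, ∃ U, R M U := by
    intro M
    have hM : InOrder I M.1.1 := M.2
    have hc := contentIdeal_eq_one hI hM M.1.2
    have hP : PairwiseIntegral σ (I : FractionalIdeal (𝓞 K)⁰ K) M.1.1 1 :=
      pairwiseIntegral_of_content_le hI (by rw [hc, map_one, mul_one, spanSingleton_one])
    obtain ⟨U, hU, h1, h2⟩ := hP.exists_mem_SO0Int hK hσ (ι := ι) (A := Mι M.1) (B := Mσ M.1)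
      (a := 1) (b := 1) hB hT (by rw [one_smul]; rfl) (by rw [one_smul]; rfl) (by simp) one_ne_zero
      (map_one _)
    obtain ⟨X, hX⟩ := hB.exists_eq_one_add_mul hK hσ hT hTdet h2 fun x hx => by
      rw [Matrix.smul_mulVec]
      refine hP.dual_apply hK hσ hB (map_one _) one_ne_zero hx ?_
      -- With content 𝓞, r = 1 and det = 1, the choice t = 1 makes the general congruence the
      -- triviality of the action.
      have := hP.dual_congr hK hσ hI hB (map_one _) one_ne_zero (t := 1)
        (by rw [hc]; exact one_mem_one _) hx
      rw [hc, spanSingleton_one, one_mul, one_mul, M.1.2] at this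
      simpa using this
    exact ⟨⟨U, hU, X, hX⟩, h1⟩
  have mul : ∀ M M' U U', R M U → R M' U' → R (M * M') (U * U') := by
    intro M M' U U' h h'
    have e1 : (M.1.1 * M'.1.1).map ι = M.1.1.map ι * M'.1.1.map ι := Matrix.map_mul
    have e2 : (M.1.1 * M'.1.1).map (fun x => ι (σ x)) =
        M.1.1.map (fun x => ι (σ x)) * M'.1.1.map (fun x => ι (σ x)) :=
      Matrix.map_mul (f := ι.comp (σ : K →+* K))
    change (U.1.1 * U'.1.1).map (Int.cast : ℤ → ℝ) = (realBasis ι σ N u v)⁻¹ *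
      omegaMatrix ((M.1.1 * M'.1.1).map ι) ((M.1.1 * M'.1.1).map fun x => ι (σ x)) *
      realBasis ι σ N u v
    rw [e1, e2]
    exact intertwine_mul hQ h h'
  have surj : ∀ U, ∃ M U', R M U' ∧ U⁻¹ * U' ∈ (⊥ : Subgroup (discKernel (addHyperbolic 1 T))) := by
    intro U
    obtain ⟨X, hX⟩ := U.2.2
    obtain ⟨A, B, hAB⟩ := (mem_SO0Int_iff hK hσ ι hB hT).1 U.2.1
    obtain ⟨L, r, a, b, hLA, hLB, hr, hr0, hr', hd, hd1, hd2, hP, hint⟩ :=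
      exists_matrix_of_intertwine hK hσ ι hB hAB
    have hb : 0 < b ^ 2 := by
      have : ι r ≠ 0 := by simpa using hr0
      rw [hr] at this
      have := right_ne_zero_of_mul this
      positivity
    obtain ⟨k, hk0, hrk, hdet, hord⟩ := hP.exists_mem_hilbertModularGroup hK hσ ι hI hB hr' hr0 hd
      (hd1 ▸ hb) fun x hx => by
        have := hint
        rw [show U.1.1 = _ from hX] at this
        have := (hB.sub_isLatticeVector_of_isDual hK hσ hT this hx).2.2.1
        rw [Matrix.smul_mulVec, omegaMatrix_conj_mulVec] at this
        simpa using this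
    refine ⟨⟨⟨k⁻¹ • L, hdet⟩, hord⟩, U, ?_, by simp⟩
    change U.1.1.map (Int.cast : ℤ → ℝ) = (realBasis ι σ N u v)⁻¹ *
      omegaMatrix ((k⁻¹ • L).map ι) ((k⁻¹ • L).map fun x => ι (σ x)) * realBasis ι σ N u v
    rw [(hB.intertwine_iff hK hσ ι).2 hint, hrk]
    have hk0' : σ k ≠ 0 := by simpa using hk0
    have e1 : (k⁻¹ • L).map ι = (ι k)⁻¹ • L.map ι := by ext; simp
    have e2 : (k⁻¹ • L).map (fun x => ι (σ x)) = (ι (σ k))⁻¹ • L.map (fun x => ι (σ x)) := by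
      ext; simp
    have e3 : ((k * σ k)⁻¹ • omegaMatrix L (L.map σ)).map ι =
        ((ι k)⁻¹ * (ι (σ k))⁻¹) • (omegaMatrix L (L.map σ)).map ι := by
      ext; simp [mul_comm]
    rw [e1, e2, e3, omegaMatrix_smul, omegaMatrix_map]
    rfl
  have iff : ∀ M U, R M U → (M ∈ pm (hilbertModularGroup I) ↔
      U ∈ (⊥ : Subgroup (discKernel (addHyperbolic 1 T)))) := by
    intro M U h
    rw [mem_pm_iff, Subgroup.mem_bot]
    constructor
    · intro hM
      have hone : omegaMatrix (M.1.1.map ι) (M.1.1.map fun x => ι (σ x)) = 1 := by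
        rcases hM with hM | hM <;> rw [hM] <;> ext i j <;> fin_cases i <;> fin_cases j <;>
          simp [omegaMatrix]
      exact Subtype.ext (Subtype.ext ((eq_of_intertwine hQ h).1 hone))
    · rintro rfl
      have := eq_one_or_eq_neg_one_of_intertwine (A := Mι M.1) (B := Mσ M.1) hQ h (Or.inl rfl)
      have inj : Function.Injective fun X : Matrix (Fin 2) (Fin 2) K => X.map ι :=
        fun _ _ h => Matrix.map_injective ι.injective h
      refine this.imp (fun h1 => inj ?_) fun h1 => inj ?_
      · change (Mι M.1).1 = (1 : Matrix (Fin 2) (Fin 2) K).map ι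
        rw [h1, Matrix.map_one _ (map_zero ι) (map_one ι)]
      · change (Mι M.1).1 = (-1 : Matrix (Fin 2) (Fin 2) K).map ι
        rw [h1]
        ext i j
        simp [Matrix.one_apply, apply_ite]
  obtain ⟨ψ, hψ⟩ := exists_mulEquiv_of_relation _ _ R mul total surj iff
  refine ⟨ψ.trans QuotientGroup.quotientBot, fun M => ?_⟩
  obtain ⟨U, hU⟩ := total M
  rw [MulEquiv.trans_apply, hψ M U hU]
  exact hU

theorem exists_sign_of_isConjugate {L : Matrix (Fin 2) (Fin 2) K}
    {M M' : SpecialLinearGroup (Fin 2) ℝ} (hd : TotallyPositive ι σ L.det)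
    (hM : M.1 = (Real.sqrt (ι L.det))⁻¹ • L.map ι) (h : IsConjugate ι σ M M') :
    ∃ e : ℝ, (e = 1 ∨ e = -1) ∧
      M'.1 = e • ((Real.sqrt (ι (σ L.det)))⁻¹ • L.map (fun x => ι (σ x))) := by
  obtain ⟨d, P, hd', h1, h2⟩ := h
  rcases conj_eq_or_eq_neg hd' hd (h1.symm.trans hM) with h | h
  · exact ⟨1, Or.inl rfl, by rw [one_smul]; exact h2.trans h⟩
  · exact ⟨-1, Or.inr rfl, by rw [neg_one_smul]; exact h2.trans h⟩

theorem exists_isConjugate {L : Matrix (Fin 2) (Fin 2) K}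
    {M : SpecialLinearGroup (Fin 2) ℝ} (hd : TotallyPositive ι σ L.det)
    (hM : M.1 = (Real.sqrt (ι L.det))⁻¹ • L.map ι) : ∃ M', IsConjugate ι σ M M' := by
  have hs := Real.sqrt_pos.2 hd.2
  refine ⟨⟨(Real.sqrt (ι (σ L.det)))⁻¹ • L.map (fun x => ι (σ x)), ?_⟩, L.det, L, hd, hM, rfl⟩
  have : (L.map (fun x => ι (σ x))).det = ι (σ L.det) :=
    (RingHom.map_det (ι.comp (σ : K →+* K)) L).symm
  rw [det_smul, this, Fintype.card_fin, inv_pow, Real.sq_sqrt hd.2.le, inv_mul_cancel₀ hd.2.ne']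

/-- Elements of the extended group act by integral matrices. -/
theorem exists_mem_SO0Int_of_isConjugate (hK : Module.finrank ℚ K = 2) (hσ : σ ≠ AlgEquiv.refl)
    (hI : I ≠ ⊥) (hB : IsNormBasis σ (I : FractionalIdeal (𝓞 K)⁰ K) N u v)
    (hT : (N : K) • T.map (Int.cast : ℤ → K) =
        !![2 * u * σ u, u * σ v + σ u * v; u * σ v + σ u * v, 2 * v * σ v])
    {M M' : SpecialLinearGroup (Fin 2) ℝ} (hM : M ∈ hurwitzMaassGroup ι σ I hI)
    (h : IsConjugate ι σ M M') :
    ∃ U ∈ SO0Int (addHyperbolic 1 T), U.1.map (Int.cast : ℤ → ℝ) =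
        (realBasis ι σ N u v)⁻¹ * omegaMatrix M.1 M'.1 * realBasis ι σ N u v := by
  obtain ⟨L, -, hd, hc, hML⟩ := hM
  obtain ⟨e, he, hM'⟩ := exists_sign_of_isConjugate hd hML h
  have hn : 0 < Algebra.norm ℚ L.det := by
    have h1 := congrArg ι (norm_eq_mul_conj hK hσ L.det)
    rw [map_mul, map_ratCast] at h1
    have : (0 : ℝ) < (Algebra.norm ℚ L.det : ℚ) := h1 ▸ mul_pos hd.1 hd.2
    exact_mod_cast this
  obtain ⟨q, hq, hq2, hle⟩ := exists_content_mul_conj_le hK hσ hn hc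
  have s₁ := Real.sqrt_pos.2 hd.1
  have s₂ := Real.sqrt_pos.2 hd.2
  have hqr : (q : ℝ) = Real.sqrt (ι (σ L.det)) * Real.sqrt (ι L.det) := by
    have h1 := congrArg ι hq2
    rw [map_pow, map_mul, map_ratCast] at h1
    rw [← Real.sqrt_mul hd.2.le, mul_comm, ← h1, Real.sqrt_sq (by exact_mod_cast hq.le)]
  have hqK : (q : K) ≠ 0 := by exact_mod_cast hq.ne'
  -- The sign ambiguity of M' is absorbed into r = ±q, which generates the same ideal.
  obtain ⟨z, hz, hze⟩ : ∃ z : K, (z = 1 ∨ z = -1) ∧ ι z = e := by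
    rcases he with rfl | rfl
    · exact ⟨1, Or.inl rfl, map_one _⟩
    · exact ⟨-1, Or.inr rfl, by simp⟩
  have hee : e * e = 1 := by rcases he with rfl | rfl <;> norm_num
  have hle' : contentIdeal I L * conjIdeal σ (contentIdeal I L) ≤ spanSingleton (𝓞 K)⁰ (z * q) := by
    rcases hz with rfl | rfl
    · rwa [one_mul]
    · refine hle.trans (spanSingleton_le_iff_mem.2 ?_)
      rw [neg_one_mul]
      have := neg_mem' (mem_spanSingleton_self (𝓞 K)⁰ (-(q : K)))
      rwa [neg_neg] at this
  obtain ⟨U, hU, h1, -⟩ := (pairwiseIntegral_of_content_le hI hle').exists_mem_SO0Int hK hσ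
    (ι := ι) (A := M) (B := M') (a := e * Real.sqrt (ι (σ L.det))) (b := Real.sqrt (ι L.det)) hB hT
    (by rw [hML, smul_smul, mul_inv_cancel₀ s₁.ne', one_smul])
    (by rw [hM', smul_smul, smul_smul, mul_right_comm, mul_assoc e, mul_comm _ e, ← mul_assoc, hee,
      one_mul, mul_inv_cancel₀ s₂.ne', one_smul])
    (by rw [map_mul, map_ratCast, hze, hqr, mul_assoc])
    (mul_ne_zero (by rcases hz with rfl | rfl <;> simp) hqK)
    (by rcases hz with rfl | rfl <;> simp)
  exact ⟨U, hU, h1⟩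

/-- Multiples of a matrix by a suitable element of `K` have coefficients in the order, and the sign
of the multiple can be prescribed. -/
theorem exists_smul_inOrder (hI : I ≠ ⊥) (L : Matrix (Fin 2) (Fin 2) K) (ι : K →+* ℝ) {b : ℝ}
    (hb : b ≠ 0) : ∃ t : K, 0 < ι t * b ∧ InOrder I (t • L) := by
  -- A common denominator of the content clears L; replacing s by -s adjusts the sign.
  obtain ⟨s, hs, h⟩ := (contentIdeal I L).2
  have hs0 : ((s : 𝓞 K) : K) ≠ 0 := by
    simpa using nonZeroDivisors.ne_zero hs
  have hle : spanSingleton (𝓞 K)⁰ (s : K) * contentIdeal I L ≤ 1 := by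
    rw [spanSingleton_mul_le_iff]
    intro z hz
    obtain ⟨y, hy⟩ := h z hz
    rw [mem_one_iff]
    exact ⟨y, by rw [hy, Algebra.smul_def]⟩
  have hmem : ∀ e : K, e = 1 ∨ e = -1 → InOrder I ((e * s) • L) := by
    intro e he
    have he1 : spanSingleton (𝓞 K)⁰ e ≤ 1 := by
      rw [spanSingleton_le_iff_mem]
      rcases he with rfl | rfl
      · exact one_mem_one _
      · exact neg_mem' (one_mem_one _)
    have : contentIdeal I ((e * s) • L) ≤ 1 := by
      rw [contentIdeal_smul, ← spanSingleton_mul_spanSingleton, mul_assoc]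
      exact (mul_le_mul' he1 hle).trans (mul_one _).le
    simpa [InOrder] using (contentIdeal_le_iff hI).1 this
  have hne : ι s * b ≠ 0 := mul_ne_zero (by simpa using hs0) hb
  rcases hne.lt_or_gt with h | h
  · exact ⟨-1 * s, by simpa using h, hmem _ (Or.inr rfl)⟩
  · exact ⟨1 * s, by simpa using h, hmem _ (Or.inl rfl)⟩

/-- A pair of real matrices proportional to the two embeddings of an integral matrix `L` comes from
an element of the extended group and its conjugate, up to sign. -/
theorem PairwiseIntegral.mem_hurwitzMaassGroup (hK : Module.finrank ℚ K = 2)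
    (hσ : σ ≠ AlgEquiv.refl) (hI : I ≠ ⊥) {L : Matrix (Fin 2) (Fin 2) K} {r : K} {a b : ℝ}
    {A B : SpecialLinearGroup (Fin 2) ℝ} (hr : σ r = r) (hr0 : r ≠ 0)
    (hab : ι r = a * b) (hdet : L.det * σ L.det = r ^ 2) (h : PairwiseIntegral σ I L r)
    (hA : L.map ι = b • A.1) (hB : L.map (fun x => ι (σ x)) = a • B.1)
    (hb : ι L.det = b ^ 2) (ha : ι (σ L.det) = a ^ 2) :
    A ∈ hurwitzMaassGroup ι σ I hI ∧ ∃ B' : SpecialLinearGroup (Fin 2) ℝ,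
      IsConjugate ι σ A B' ∧ (B'.1 = B.1 ∨ B'.1 = -B.1) := by
  have hr0' : a * b ≠ 0 := hab ▸ (by simpa using hr0)
  have ha0 := left_ne_zero_of_mul hr0'
  -- Prescribing the sign of t b makes √(det tL) = t b, so normalising tL returns A itself. The sign
  -- at the other embedding is not controlled, hence B only up to sign.
  obtain ⟨t, ht, hord⟩ := exists_smul_inOrder hI L ι (right_ne_zero_of_mul hr0')
  have ht0 : t ≠ 0 := by
    rintro rfl
    simp at ht
  have hta : ι (σ t) * a ≠ 0 := mul_ne_zero (by simpa using ht0) ha0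
  have hd : (t • L).det = t ^ 2 * L.det := by rw [det_smul, Fintype.card_fin]
  have h1 : ι (t • L).det = (ι t * b) ^ 2 := by rw [hd, map_mul, map_pow, hb, mul_pow]
  have h2 : ι (σ (t • L).det) = (ι (σ t) * a) ^ 2 := by
    rw [hd, map_mul, map_mul, map_pow, map_pow, ha, mul_pow]
  have hpos : TotallyPositive ι σ (t • L).det := ⟨h1 ▸ by positivity, h2 ▸ by positivity⟩
  have hAL : A.1 = (Real.sqrt (ι (t • L).det))⁻¹ • (t • L).map ι := by
    have : (t • L).map ι = ι t • L.map ι := by ext; simp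
    rw [h1, Real.sqrt_sq ht.le, this, hA, smul_smul, smul_smul, mul_assoc,
      inv_mul_cancel₀ ht.ne', one_smul]
  have hsq : contentIdeal I (t • L) ^ 2 = spanSingleton (𝓞 K)⁰ (t • L).det := by
    rw [contentIdeal_smul, mul_pow, h.content_sq hK hσ hI hr hr0 hdet, hd, spanSingleton_pow,
      spanSingleton_mul_spanSingleton]
  refine ⟨⟨t • L, hord, hpos, hsq, hAL⟩, ?_⟩
  obtain ⟨B', hB'⟩ := exists_isConjugate hpos hAL
  refine ⟨B', hB', ?_⟩
  obtain ⟨e, he, h3⟩ := exists_sign_of_isConjugate hpos hAL hB'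
  have h4 : (t • L).map (fun x => ι (σ x)) = ι (σ t) • L.map (fun x => ι (σ x)) := by ext; simp
  rw [h4, hB, smul_smul, smul_smul, smul_smul, h2, Real.sqrt_sq_eq_abs] at h3
  rw [h3]
  have h5 : |ι (σ t) * a|⁻¹ * ι (σ t) * a = 1 ∨ |ι (σ t) * a|⁻¹ * ι (σ t) * a = -1 := by
    rw [mul_assoc]
    rcases abs_choice (ι (σ t) * a) with h | h <;> rw [h]
    · exact Or.inl (inv_mul_cancel₀ hta)
    · exact Or.inr (by rw [inv_neg, neg_mul, inv_mul_cancel₀ hta])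
  rw [mul_assoc, mul_assoc, ← mul_assoc _ (ι (σ t))]
  rcases he with rfl | rfl <;> rcases h5 with h5 | h5 <;> rw [h5] <;> simp

theorem omegaMatrix_neg_right {R : Type*} [CommRing R] (A B : Matrix (Fin 2) (Fin 2) R) :
    omegaMatrix A (-B) = -omegaMatrix A B := by
  have := omegaMatrix_smul 1 (-1) A B
  rwa [one_smul, one_mul, neg_one_smul, neg_one_smul] at this

/-- The isomorphism from the extended Hilbert modular group to the integral orthogonal group. -/
theorem exists_equiv_SO0Int (hK : Module.finrank ℚ K = 2) (hσ : σ ≠ AlgEquiv.refl)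
    (ι : K →+* ℝ) (hI : I ≠ ⊥) (hB : IsNormBasis σ (I : FractionalIdeal (𝓞 K)⁰ K) N u v)
    (hT : (N : K) • T.map (Int.cast : ℤ → K) =
        !![2 * u * σ u, u * σ v + σ u * v; u * σ v + σ u * v, 2 * v * σ v]) :
    ∃ ψ : (hurwitzMaassGroup ι σ I hI ⧸ pm (hurwitzMaassGroup ι σ I hI)) ≃*
        (SO0Int (addHyperbolic 1 T) ⧸ pm (SO0Int (addHyperbolic 1 T))),
      ∀ (M : hurwitzMaassGroup ι σ I hI) (M' : SpecialLinearGroup (Fin 2) ℝ),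
        IsConjugate ι σ M.1 M' → ∃ U : SO0Int (addHyperbolic 1 T),
          U.1.1.map (Int.cast : ℤ → ℝ) =
            (realBasis ι σ N u v)⁻¹ * omegaMatrix M.1.1 M'.1 * realBasis ι σ N u v ∧
          ψ (QuotientGroup.mk M) = QuotientGroup.mk U := by
  have hQ := hB.isUnit_det_realBasis hK hσ ι
  let R : hurwitzMaassGroup ι σ I hI → SO0Int (addHyperbolic 1 T) → Prop := fun M U =>
    ∃ M' : SpecialLinearGroup (Fin 2) ℝ, IsConjugate ι σ M.1 M' ∧
      U.1.1.map (Int.cast : ℤ → ℝ) =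
        (realBasis ι σ N u v)⁻¹ * omegaMatrix M.1.1 M'.1 * realBasis ι σ N u v
  have total : ∀ M, ∃ U, R M U := by
    rintro ⟨M, hM⟩
    obtain ⟨M', hM'⟩ : ∃ M', IsConjugate ι σ M M' := by
      obtain ⟨L, -, hd, -, hML⟩ := hM
      exact exists_isConjugate hd hML
    obtain ⟨U, hU, h⟩ := exists_mem_SO0Int_of_isConjugate hK hσ hI hB hT hM hM'
    exact ⟨⟨U, hU⟩, M', hM', h⟩
  have mul : ∀ M₁ M₂ U₁ U₂, R M₁ U₁ → R M₂ U₂ → R (M₁ * M₂) (U₁ * U₂) := by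
    rintro M₁ M₂ U₁ U₂ ⟨M₁', h₁, e₁⟩ ⟨M₂', h₂, e₂⟩
    exact ⟨M₁' * M₂', h₁.mul h₂, intertwine_mul hQ e₁ e₂⟩
  have surj : ∀ U, ∃ M U', R M U' ∧ U⁻¹ * U' ∈ pm (SO0Int (addHyperbolic 1 T)) := by
    intro U
    obtain ⟨A, B, hAB⟩ := (mem_SO0Int_iff hK hσ ι hB hT).1 U.2
    obtain ⟨L, r, a, b, hLA, hLB, hr, hr0, hr', hd, hd1, hd2, hP, -⟩ :=
      exists_matrix_of_intertwine hK hσ ι hB hAB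
    obtain ⟨hA, B', hAB', hs⟩ :=
      hP.mem_hurwitzMaassGroup hK hσ hI hr' hr0 hr hd hLA hLB hd1 hd2
    obtain ⟨U', hU', h⟩ := exists_mem_SO0Int_of_isConjugate hK hσ hI hB hT hA hAB'
    refine ⟨⟨A, hA⟩, ⟨U', hU'⟩, ⟨B', hAB', h⟩, ?_⟩
    have hinv : (U⁻¹).1.1 * U.1.1 = 1 := congrArg Subtype.val (inv_mul_cancel U.1)
    rw [mem_pm_iff]
    change (U⁻¹).1.1 * U'.1 = 1 ∨ (U⁻¹).1.1 * U'.1 = -1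
    rcases hs with hs | hs
    · left
      rw [hs, ← hAB] at h
      rw [map_intCast_injective h, hinv]
    · right
      have h' : U'.1 = -U.1.1 := by
        apply map_intCast_injective
        change U'.1.map (Int.cast : ℤ → ℝ) = (-U.1.1).map (Int.cast : ℤ → ℝ)
        rw [h, hs, omegaMatrix_neg_right, Matrix.mul_neg, Matrix.neg_mul, ← hAB]
        ext; simp
      rw [h', Matrix.mul_neg, hinv]
  have iff : ∀ M U, R M U → (M ∈ pm (hurwitzMaassGroup ι σ I hI) ↔
      U ∈ pm (SO0Int (addHyperbolic 1 T))) := by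
    rintro M U ⟨M', hM', h⟩
    rw [mem_pm_iff, mem_pm_iff]
    refine ⟨fun hM => ?_, eq_one_or_eq_neg_one_of_intertwine hQ h⟩
    -- M = ±1 is represented by a scalar of determinant 1 over K, so its conjugate is again ±1 and
    -- Ω(M, M') = ±1.
    obtain ⟨z, hz, hMz⟩ : ∃ z : K, (z = 1 ∨ z = -1) ∧ M.1.1 = ι z • (1 : Matrix _ _ ℝ) := by
      rcases hM with hM | hM
      · exact ⟨1, Or.inl rfl, by rw [hM, map_one, one_smul]⟩
      · exact ⟨-1, Or.inr rfl, by rw [hM, map_neg, map_one, neg_one_smul]⟩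
    have hdet : (z • (1 : Matrix (Fin 2) (Fin 2) K)).det = 1 := by
      rcases hz with rfl | rfl <;> simp [det_fin_two]
    have hz' : (z • (1 : Matrix (Fin 2) (Fin 2) K)).map ι = ι z • (1 : Matrix _ _ ℝ) := by
      ext i j; simp [Matrix.one_apply, apply_ite ι]
    have hz'' : (z • (1 : Matrix (Fin 2) (Fin 2) K)).map (fun x => ι (σ x)) =
        ι (σ z) • (1 : Matrix _ _ ℝ) := by
      ext i j; simp [Matrix.one_apply, apply_ite ι, apply_ite σ]
    obtain ⟨e, he, h1⟩ := exists_sign_of_isConjugate (L := z • (1 : Matrix (Fin 2) (Fin 2) K))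
      (by simp [hdet, TotallyPositive]) (by simp [hdet, hz', hMz]) hM'
    rw [hdet, hz'', map_one, map_one, Real.sqrt_one, inv_one, one_smul, smul_smul] at h1
    have hΩ : omegaMatrix M.1.1 M'.1 = (ι z * (e * ι (σ z))) • (1 : Matrix _ _ ℝ) := by
      rw [hMz, h1, omegaMatrix_smul, omegaMatrix_one]
    have := eq_of_intertwine hQ h
    rw [hΩ] at this
    rcases he with rfl | rfl
    · exact Or.inl (this.1 (by rcases hz with rfl | rfl <;> simp))
    · exact Or.inr (this.2 (by rcases hz with rfl | rfl <;> simp))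
  obtain ⟨ψ, hψ⟩ := exists_mulEquiv_of_relation _ _ R mul total surj iff
  refine ⟨ψ, fun M M' hM' => ?_⟩
  obtain ⟨U, hU, h⟩ := exists_mem_SO0Int_of_isConjugate hK hσ hI hB hT M.2 hM'
  exact ⟨⟨U, hU⟩, h, hψ M ⟨U, hU⟩ ⟨M', hM', h⟩⟩

theorem map_intCast_eq_gramMatrix (ι : K →+* ℝ) (hN : N ≠ 0)
    (hT : (N : K) • T.map (Int.cast : ℤ → K) =
        !![2 * u * σ u, u * σ v + σ u * v; u * σ v + σ u * v, 2 * v * σ v]) :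
    T.map (Int.cast : ℤ → ℝ) = (1 / (N : ℝ)) • gramMatrix ι σ u v := by
  have hN' : (N : ℝ) ≠ 0 := Nat.cast_ne_zero.2 hN
  have h : (N : ℝ) • T.map (Int.cast : ℤ → ℝ) = gramMatrix ι σ u v := by
    have h1 := congrArg (fun X => X.map ι) hT
    have h2 : ((N : K) • T.map (Int.cast : ℤ → K)).map ι = (N : ℝ) • T.map (Int.cast : ℤ → ℝ) := by
      ext; simp
    simp only [h2] at h1
    rw [h1]
    ext i j
    fin_cases i <;> fin_cases j <;>
      simp [gramMatrix, baseChange, Matrix.mul_apply, Fin.sum_univ_two, map_ofNat] <;> ring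
  rw [← h, smul_smul, one_div, inv_mul_cancel₀ hN', one_smul]

end Main

end HilbertModular

theorem theorem3 {K : Type*} [Field K] [NumberField K] (hK : Module.finrank ℚ K = 2)
    (ι : K →+* ℝ) (conj : K ≃ₐ[ℚ] K) (hconj : conj ≠ AlgEquiv.refl)
    (I : Ideal (NumberField.RingOfIntegers K)) (hI : I ≠ ⊥)
    (hprim : HilbertModular.IsPrimitiveIdeal I)
    (N : ℕ) (hN : N = Ideal.absNorm I)
    (B : Module.Basis (Fin 2) ℤ I)
    (u v : K) (hu : u = ((B 0 : NumberField.RingOfIntegers K) : K))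
    (hv : v = ((B 1 : NumberField.RingOfIntegers K) : K)) :
    ∃ T : Matrix (Fin 2) (Fin 2) ℤ,
      T.map (Int.cast : ℤ → ℝ) = (1 / (N : ℝ)) • HilbertModular.gramMatrix ι conj u v ∧
      T.IsSymm ∧ T.det ≠ 0 ∧ (∀ i, Even (T i i)) ∧
      (∃ ψ : (HilbertModular.hilbertModularGroup I ⧸
            HilbertModular.pm (HilbertModular.hilbertModularGroup I)) ≃*
          HilbertModular.discKernel (HilbertModular.addHyperbolic 1 T),
        ∀ M : HilbertModular.hilbertModularGroup I,
          ((ψ (QuotientGroup.mk M) : Matrix.SpecialLinearGroup (Fin 4) ℤ) :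
              Matrix (Fin 4) (Fin 4) ℤ).map (Int.cast : ℤ → ℝ) =
            (HilbertModular.HMat N)⁻¹ *
              HilbertModular.tilde (HilbertModular.baseChange ι conj u v)
                (((M : Matrix.SpecialLinearGroup (Fin 2) K) :
                  Matrix (Fin 2) (Fin 2) K).map ι)
                (((M : Matrix.SpecialLinearGroup (Fin 2) K) :
                  Matrix (Fin 2) (Fin 2) K).map (fun x => ι (conj x))) *
              HilbertModular.HMat N) ∧
      (∃ ψ' : (HilbertModular.hurwitzMaassGroup ι conj I hI ⧸
            HilbertModular.pm (HilbertModular.hurwitzMaassGroup ι conj I hI)) ≃*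
          (HilbertModular.SO0Int (HilbertModular.addHyperbolic 1 T) ⧸
            HilbertModular.pm (HilbertModular.SO0Int (HilbertModular.addHyperbolic 1 T))),
        ∀ (M : HilbertModular.hurwitzMaassGroup ι conj I hI)
          (M' : Matrix.SpecialLinearGroup (Fin 2) ℝ),
          HilbertModular.IsConjugate ι conj M M' →
          ∃ U : HilbertModular.SO0Int (HilbertModular.addHyperbolic 1 T),
            ((U : Matrix.SpecialLinearGroup (Fin 4) ℤ) :
                Matrix (Fin 4) (Fin 4) ℤ).map (Int.cast : ℤ → ℝ) =
              (HilbertModular.HMat N)⁻¹ *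
                HilbertModular.tilde (HilbertModular.baseChange ι conj u v)
                  ((M : Matrix.SpecialLinearGroup (Fin 2) ℝ) : Matrix (Fin 2) (Fin 2) ℝ)
                  (M' : Matrix (Fin 2) (Fin 2) ℝ) *
                HilbertModular.HMat N ∧
            ψ' (QuotientGroup.mk M) = QuotientGroup.mk U) := by
  subst hN hu hv
  have hB := HilbertModular.isNormBasis_of_basis hK hconj hI B
  obtain ⟨T, hT, hsymm, hdet, heven⟩ := hB.exists_gram hK hconj
  refine ⟨T, HilbertModular.map_intCast_eq_gramMatrix ι hB.pos hT, hsymm, hdet, heven, ?_, ?_⟩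
  · simp only [HilbertModular.HMat_inv_mul_tilde]
    exact HilbertModular.exists_equiv_discKernel hK hconj ι hI hB hT hdet
  · simp only [HilbertModular.HMat_inv_mul_tilde]
    exact HilbertModular.exists_equiv_SO0Int hK hconj ι hI hB hT
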